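/- **Conventions.** A $C^\infty$-ring is a set $\mathfrak C$ with operations $\Phi_f:\mathfrak C^n\to\mathfrak C$ for all $n\ge 0$ and all smooth $f:\mathbb R^n\to\mathbb R$, compatible with composition of smooth functions and with coordinate projections; it is in particular a commutative $\mathbb R$-algebra. An $\mathbb R$-point of $\mathfrak C$ is a morphism $p:\mathfrak C\to\mathbb R$ of $C^\infty$-rings, $\mathfrak C_p=\mathfrak C[s^{-1}:p(s)\neq 0]$ is the localization in $C^\infty$-rings, and $\pi_p:\mathfrak C\to\mathfrak C_p$ is the projection. $\mathfrak C$ is *fair* if it is finitely generated as a $C^\infty$-ring and $c=0$ whenever $\pi_p(c)=0$ for all $\mathbb R$-points $p$. A $C^\infty$-ringed space $X=(X,\mathcal O_X)$ is a topological space with a sheaf of $C^\infty$-rings; it is *local* if all its stalks are local rings with residue field $\mathbb R$. A morphism $f:X\to Y$ is a continuous map with a morphism $f^\sharp:\mathcal O_Y\to f_*\mathcal O_X$ of sheaves of $C^\infty$-rings. $\operatorname{Spec}\mathfrak C$ is the set of $\mathbb R$-points of $\mathfrak C$, with the smallest topology for which $p\mapsto p(c)$ is continuous for every $c\in\mathfrak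 C$, and with the sheaf of functions $s$, $s(p)\in\mathfrak C_p$, which are locally of the form $s(p)=\pi_p(c)\pi_p(d)^{-1}$ with $c,d\in\mathfrak C$ and $p(d)\ne 0$. A *$C^\infty$-scheme* is a local $C^\infty$-ringed space covered by open $U$ with $(U,\mathcal O_X|_U)\cong\operatorname{Spec}\mathfrak C$ for some $C^\infty$-ring $\mathfrak C$; it is *locally fair* if it can be covered by such $U$ with $\mathfrak C$ fair. For a $\mathfrak C$-module $M$, $\operatorname{MSpec}M$ is the sheaf of modules on $\operatorname{Spec}\mathfrak C$ associated to $U\mapsto M\otimes_{\mathfrak C}\mathcal O(U)$. An $\mathcal O_X$-module $\mathcal E$ is *quasicoherent* if $X$ is covered by open $U$ with isomorphisms $(U,\mathcal O_X|_U)\cong\operatorname{Spec}\mathfrak C$ under which $\mathcal E|_U\cong\operatorname{MSpec}M$ for some $\mathfrak C$-module $M$; $\mathrm{qcoh}(X)$ is the full subcategory of quasicoherent $\mathcal O_X$-modules. The cotangent module $\Omega_{\mathfrak C}$ is the $\mathfrak C$-module generated by symbols $dc$, $c\in\mathfrak C$, with relations $d\Phi_f(c_1,\dots,c_n)=\sum_i\Phi_{\partial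 f/\partial x_i}(c_1,\dots,c_n)\,dc_i$. The cotangent sheaf $T^*X$ is the sheafification of $U\mapsto\Omega_{\mathcal O_X(U)}$. For $f:X\to Y$, $\Omega_f:f^*(T^*Y)\to T^*X$ is the morphism of $\mathcal O_X$-modules induced by the maps $\Omega_{\mathcal O_Y(V)}\to\Omega_{\mathcal O_X(f^{-1}(V))}$, $dc\mapsto d(f^\sharp c)$. For $f:X\to Y$ and $g:Y\to Z$, $I_{f,g}:(g\circ f)^*\Rightarrow f^*\circ g^*$ is the canonical isomorphism of pullback functors of sheaves of modules. **Theorem.** (a) Let $f:X\to Y$ and $g:Y\to Z$ be morphisms of $C^\infty$-schemes. Then $$\Omega_{g\circ f}=\Omega_f\circ f^*(\Omega_g)\circ I_{f,g}(T^*Z)$$ as morphisms $(g\circ f)^*(T^*Z)\to T^*X$ of $\mathcal O_X$-modules. (b) Let $e:W\to X$, $f:W\to Y$, $g:X\to Z$, $h:Y\to Z$ be morphisms of locally fair $C^\infty$-schemes forming a Cartesian square, $g\circ e=h\circ f$ and $W=X\times_Z Y$, in the category of locally fair $C^\infty$-schemes. Then the $\mathcal O_W$-modules $(g\circ e)^*(T^*Z)$,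 $e^*(T^*X)\oplus f^*(T^*Y)$ and $T^*W$ are quasicoherent, and the sequence $$(g\circ e)^*(T^*Z)\xrightarrow{\ \bigl(e^*(\Omega_g)\circ I_{e,g}(T^*Z)\bigr)\,\oplus\,\bigl(-f^*(\Omega_h)\circ I_{f,h}(T^*Z)\bigr)\ }e^*(T^*X)\oplus f^*(T^*Y)\xrightarrow{\ \Omega_e\oplus\Omega_f\ }T^*W\longrightarrow 0$$ is exact in $\mathrm{qcoh}(W)$, and also in the category of $\mathcal O_W$-modules. -/

import Mathlib

open CategoryTheory Limits Opposite TopologicalSpace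
open scoped ContDiff

universe u

set_option linter.unusedSimpArgs false

/-! ### Smooth functions on `ℝⁿ` -/

/-- A smooth function `ℝⁿ → ℝ`. -/
structure SmoothFun (n : ℕ) where
  toFun : (Fin n → ℝ) → ℝ
  smooth : ContDiff ℝ ∞ toFun

namespace SmoothFun

@[ext]
theorem ext {n : ℕ} {f g : SmoothFun n} (h : ∀ x, f.toFun x = g.toFun x) : f = g := by
  cases f; cases g; congr; exact funext h

/-- The coordinate function `x ↦ xᵢ`. -/
def proj {n : ℕ} (i : Fin n) : SmoothFun n := ⟨fun x => x i, contDiff_apply ℝ ℝ i⟩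

/-- The composite `x ↦ g (f₁ x, …, fₘ x)`. -/
def comp {m n : ℕ} (g : SmoothFun m) (f : Fin m → SmoothFun n) : SmoothFun n :=
  ⟨fun x => g.toFun fun i => (f i).toFun x,
    g.smooth.comp (contDiff_pi.2 fun i => (f i).smooth)⟩

/-- The constant function with value `r`. -/
def const {n : ℕ} (r : ℝ) : SmoothFun n := ⟨fun _ => r, contDiff_const⟩

/-- The function `(x, y) ↦ x + y`. -/
def add : SmoothFun 2 := ⟨fun x => x 0 + x 1, (contDiff_apply ℝ ℝ 0).add (contDiff_apply ℝ ℝ 1)⟩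

/-- The function `(x, y) ↦ x y`. -/
def mul : SmoothFun 2 := ⟨fun x => x 0 * x 1, (contDiff_apply ℝ ℝ 0).mul (contDiff_apply ℝ ℝ 1)⟩

/-- The function `x ↦ r x`. -/
def smul (r : ℝ) : SmoothFun 1 := ⟨fun x => r * x 0, contDiff_const.mul (contDiff_apply ℝ ℝ 0)⟩

/-- The partial derivative `∂f/∂xᵢ`. -/
noncomputable def pderiv {n : ℕ} (i : Fin n) (f : SmoothFun n) : SmoothFun n :=
  ⟨fun x => fderiv ℝ f.toFun x (Pi.single i 1),
    (f.smooth.fderiv_right (m := ∞) (by simp)).clm_apply contDiff_const⟩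

/-- A smooth function of one variable. -/
def ofReal (f : ℝ → ℝ) (hf : ContDiff ℝ ∞ f) : SmoothFun 1 :=
  ⟨fun x => f (x 0), hf.comp (contDiff_apply ℝ ℝ 0)⟩

end SmoothFun

/-! ### `C^∞`-rings -/

/-- A `C^∞`-ring: a set `C` with an operation `Φ_f : Cⁿ → C` for every smooth `f : ℝⁿ → ℝ`,
compatible with composition and with the coordinate functions. -/
class CInfRing (C : Type u) where
  op : {n : ℕ} → SmoothFun n → (Fin n → C) → C
  op_comp : ∀ {m n : ℕ} (g : SmoothFun m) (f : Fin m → SmoothFun n) (c : Fin n → C),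
    op (g.comp f) c = op g fun i => op (f i) c
  op_proj : ∀ {n : ℕ} (i : Fin n) (c : Fin n → C), op (SmoothFun.proj i) c = c i

namespace CInfRing

section Algebra

variable {C : Type u} [CInfRing C]

noncomputable instance (priority := 50) : Add C := ⟨fun a b => op SmoothFun.add ![a, b]⟩
noncomputable instance (priority := 50) : Mul C := ⟨fun a b => op SmoothFun.mul ![a, b]⟩
noncomputable instance (priority := 50) : Zero C := ⟨op (SmoothFun.const 0) ![]⟩
noncomputable instance (priority := 50) : One C := ⟨op (SmoothFun.const 1) ![]⟩
noncomputable instance (priority := 50) : Neg C := ⟨fun a => op (SmoothFun.smul (-1)) ![a]⟩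

theorem add_def (a b : C) : a + b = op SmoothFun.add ![a, b] := rfl
theorem mul_def (a b : C) : a * b = op SmoothFun.mul ![a, b] := rfl
theorem zero_def : (0 : C) = op (SmoothFun.const 0) ![] := rfl
theorem one_def : (1 : C) = op (SmoothFun.const 1) ![] := rfl
theorem neg_def (a : C) : -a = op (SmoothFun.smul (-1)) ![a] := rfl

theorem op_add_op {n : ℕ} (f g : SmoothFun n) (v : Fin n → C) :
    op f v + op g v = op (SmoothFun.add.comp ![f, g]) v := by
  rw [op_comp, add_def]; congr 1; funext i; fin_cases i <;> rfl

theorem op_mul_op {n : ℕ} (f g : SmoothFun n) (v : Fin n → C) :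
    op f v * op g v = op (SmoothFun.mul.comp ![f, g]) v := by
  rw [op_comp, mul_def]; congr 1; funext i; fin_cases i <;> rfl

theorem neg_op {n : ℕ} (f : SmoothFun n) (v : Fin n → C) :
    -op f v = op ((SmoothFun.smul (-1)).comp ![f]) v := by
  rw [op_comp, neg_def]; congr 1; funext i; fin_cases i; rfl

theorem op_const {n : ℕ} (r : ℝ) (v : Fin n → C) :
    op (SmoothFun.const r) v = op (SmoothFun.const r) ![] := by
  have h := op_comp (C := C) (SmoothFun.const r) ![] v
  rw [show (fun i => op ((![] : Fin 0 → SmoothFun n) i) v) = ![] from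
    funext fun i => i.elim0] at h
  exact h

theorem exists_op₃ (a b c : C) : ∃ v : Fin 3 → C,
    a = op (SmoothFun.proj 0) v ∧ b = op (SmoothFun.proj 1) v ∧ c = op (SmoothFun.proj 2) v :=
  ⟨![a, b, c], by simp [op_proj], by simp [op_proj], by simp [op_proj]⟩

theorem exists_op₂ (a b : C) : ∃ v : Fin 2 → C,
    a = op (SmoothFun.proj 0) v ∧ b = op (SmoothFun.proj 1) v :=
  ⟨![a, b], by simp [op_proj], by simp [op_proj]⟩

theorem exists_op₁ (a : C) : ∃ v : Fin 1 → C, a = op (SmoothFun.proj 0) v :=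
  ⟨![a], by simp [op_proj]⟩

theorem op_eq_op {n : ℕ} {f g : SmoothFun n} (v : Fin n → C)
    (h : ∀ x, f.toFun x = g.toFun x) : op f v = op g v := by
  rw [SmoothFun.ext h]

/-- The underlying commutative ring of a `C^∞`-ring: `c + c' = Φ_{x+y}(c, c')`,
`c c' = Φ_{xy}(c, c')`, and `0`, `1` are the operations of the constants `0`, `1`. -/
noncomputable instance (priority := 50) toCommRing : CommRing C where
  add_assoc a b c := by
    obtain ⟨v, rfl, rfl, rfl⟩ := exists_op₃ a b c
    simp only [op_add_op, op_mul_op, neg_op]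
    exact op_eq_op v fun x => by
      simp [SmoothFun.comp, SmoothFun.add, SmoothFun.mul, SmoothFun.smul, SmoothFun.proj,
        SmoothFun.const, add_assoc]
  zero_add a := by
    obtain ⟨v, rfl⟩ := exists_op₁ a
    rw [zero_def, ← op_const 0 v]
    simp only [op_add_op, op_mul_op, neg_op]
    exact op_eq_op v fun x => by
      simp [SmoothFun.comp, SmoothFun.add, SmoothFun.mul, SmoothFun.smul, SmoothFun.proj,
        SmoothFun.const]
  add_zero a := by
    obtain ⟨v, rfl⟩ := exists_op₁ a
    rw [zero_def, ← op_const 0 v]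
    simp only [op_add_op, op_mul_op, neg_op]
    exact op_eq_op v fun x => by
      simp [SmoothFun.comp, SmoothFun.add, SmoothFun.mul, SmoothFun.smul, SmoothFun.proj,
        SmoothFun.const]
  add_comm a b := by
    obtain ⟨v, rfl, rfl⟩ := exists_op₂ a b
    simp only [op_add_op, op_mul_op, neg_op]
    exact op_eq_op v fun x => by
      simp [SmoothFun.comp, SmoothFun.add, SmoothFun.mul, SmoothFun.smul, SmoothFun.proj,
        SmoothFun.const, add_comm]
  mul_assoc a b c := by
    obtain ⟨v, rfl, rfl, rfl⟩ := exists_op₃ a b c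
    simp only [op_add_op, op_mul_op, neg_op]
    exact op_eq_op v fun x => by
      simp [SmoothFun.comp, SmoothFun.add, SmoothFun.mul, SmoothFun.smul, SmoothFun.proj,
        SmoothFun.const, mul_assoc]
  mul_comm a b := by
    obtain ⟨v, rfl, rfl⟩ := exists_op₂ a b
    simp only [op_add_op, op_mul_op, neg_op]
    exact op_eq_op v fun x => by
      simp [SmoothFun.comp, SmoothFun.add, SmoothFun.mul, SmoothFun.smul, SmoothFun.proj,
        SmoothFun.const, mul_comm]
  one_mul a := by
    obtain ⟨v, rfl⟩ := exists_op₁ a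
    rw [one_def, ← op_const 1 v]
    simp only [op_add_op, op_mul_op, neg_op]
    exact op_eq_op v fun x => by
      simp [SmoothFun.comp, SmoothFun.add, SmoothFun.mul, SmoothFun.smul, SmoothFun.proj,
        SmoothFun.const]
  mul_one a := by
    obtain ⟨v, rfl⟩ := exists_op₁ a
    rw [one_def, ← op_const 1 v]
    simp only [op_add_op, op_mul_op, neg_op]
    exact op_eq_op v fun x => by
      simp [SmoothFun.comp, SmoothFun.add, SmoothFun.mul, SmoothFun.smul, SmoothFun.proj,
        SmoothFun.const]
  zero_mul a := by
    obtain ⟨v, rfl⟩ := exists_op₁ a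
    rw [zero_def, ← op_const 0 v]
    simp only [op_add_op, op_mul_op, neg_op]
    exact op_eq_op v fun x => by
      simp [SmoothFun.comp, SmoothFun.add, SmoothFun.mul, SmoothFun.smul, SmoothFun.proj,
        SmoothFun.const]
  mul_zero a := by
    obtain ⟨v, rfl⟩ := exists_op₁ a
    rw [zero_def, ← op_const 0 v]
    simp only [op_add_op, op_mul_op, neg_op]
    exact op_eq_op v fun x => by
      simp [SmoothFun.comp, SmoothFun.add, SmoothFun.mul, SmoothFun.smul, SmoothFun.proj,
        SmoothFun.const]
  left_distrib a b c := by
    obtain ⟨v, rfl, rfl, rfl⟩ := exists_op₃ a b c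
    simp only [op_add_op, op_mul_op, neg_op]
    exact op_eq_op v fun x => by
      simp [SmoothFun.comp, SmoothFun.add, SmoothFun.mul, SmoothFun.smul, SmoothFun.proj,
        SmoothFun.const, mul_add]
  right_distrib a b c := by
    obtain ⟨v, rfl, rfl, rfl⟩ := exists_op₃ a b c
    simp only [op_add_op, op_mul_op, neg_op]
    exact op_eq_op v fun x => by
      simp [SmoothFun.comp, SmoothFun.add, SmoothFun.mul, SmoothFun.smul, SmoothFun.proj,
        SmoothFun.const, add_mul]
  neg_add_cancel a := by
    obtain ⟨v, rfl⟩ := exists_op₁ a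
    rw [zero_def, ← op_const 0 v]
    simp only [op_add_op, op_mul_op, neg_op]
    exact op_eq_op v fun x => by
      simp [SmoothFun.comp, SmoothFun.add, SmoothFun.mul, SmoothFun.smul, SmoothFun.proj,
        SmoothFun.const]
  nsmul := nsmulRec
  zsmul := zsmulRec

end Algebra

end CInfRing

/-- A morphism of `C^∞`-rings: a map commuting with all operations `Φ_f`. -/
structure CInfRingHom (C D : Type*) [CInfRing C] [CInfRing D] where
  toFun : C → D
  map_op : ∀ {n : ℕ} (f : SmoothFun n) (c : Fin n → C),
    toFun (CInfRing.op f c) = CInfRing.op f fun i => toFun (c i)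

namespace CInfRingHom

instance (C D : Type*) [CInfRing C] [CInfRing D] : FunLike (CInfRingHom C D) C D where
  coe := toFun
  coe_injective f g h := by cases f; cases g; congr

@[ext]
theorem ext {C D : Type*} [CInfRing C] [CInfRing D] {f g : CInfRingHom C D}
    (h : ∀ x, f x = g x) : f = g := DFunLike.ext f g h

theorem map_op' {C D : Type*} [CInfRing C] [CInfRing D] (φ : CInfRingHom C D) {n : ℕ}
    (f : SmoothFun n) (c : Fin n → C) :
    φ (CInfRing.op f c) = CInfRing.op f fun i => φ (c i) := φ.map_op f c

/-- The identity morphism. -/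
def id (C : Type*) [CInfRing C] : CInfRingHom C C := ⟨fun x => x, fun _ _ => rfl⟩

/-- Composition of morphisms. -/
def comp {C D E : Type*} [CInfRing C] [CInfRing D] [CInfRing E]
    (ψ : CInfRingHom D E) (φ : CInfRingHom C D) : CInfRingHom C E :=
  ⟨fun x => ψ (φ x), fun f c => by rw [map_op', map_op']⟩

/-- The underlying homomorphism of commutative rings. -/
noncomputable def toRingHom {C D : Type*} [CInfRing C] [CInfRing D] (φ : CInfRingHom C D) :
    C →+* D where
  toFun := φ
  map_one' := by
    rw [CInfRing.one_def, map_op', CInfRing.one_def]; congr 1; funext i; exact i.elim0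
  map_zero' := by
    rw [CInfRing.zero_def, map_op', CInfRing.zero_def]; congr 1; funext i; exact i.elim0
  map_add' a b := by
    rw [CInfRing.add_def, map_op', CInfRing.add_def]; congr 1; funext i; fin_cases i <;> rfl
  map_mul' a b := by
    rw [CInfRing.mul_def, map_op', CInfRing.mul_def]; congr 1; funext i; fin_cases i <;> rfl

end CInfRingHom

/-- The category of `C^∞`-rings. -/
structure CInfRingCat where
  of ::
  carrier : Type u
  [str : CInfRing carrier]

namespace CInfRingCat

instance : CoeSort CInfRingCat.{u} (Type u) := ⟨carrier⟩

instance (C : CInfRingCat.{u}) : CInfRing C := C.str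

/-- The type of morphisms in the category of `C^∞`-rings. -/
@[ext]
structure Hom (C D : CInfRingCat.{u}) where
  hom : CInfRingHom C D

instance : Category CInfRingCat.{u} where
  Hom C D := Hom C D
  id C := ⟨CInfRingHom.id C⟩
  comp f g := ⟨g.hom.comp f.hom⟩

instance : ConcreteCategory CInfRingCat.{u} (fun C D => CInfRingHom C D) where
  hom f := f.hom
  ofHom f := ⟨f⟩

/-- The functor sending a `C^∞`-ring to its underlying commutative ring. -/
noncomputable def toCommRingCat : CInfRingCat.{u} ⥤ CommRingCat.{u} where
  obj C := CommRingCat.of C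
  map f := CommRingCat.ofHom f.hom.toRingHom

/-- The functor sending a `C^∞`-ring to its underlying ring. -/
noncomputable def toRingCat : CInfRingCat.{u} ⥤ RingCat.{u} where
  obj C := RingCat.of C
  map f := RingCat.ofHom f.hom.toRingHom

end CInfRingCat

namespace CInfRing

/-! ### `ℝ`-points and localization -/

/-- An `ℝ`-point of a `C^∞`-ring `C`: a morphism of `C^∞`-rings `p : C → ℝ`, where `ℝ` has the
operations `Φ_f(x₁, …, xₙ) = f(x₁, …, xₙ)`. -/
structure RPoint (C : Type u) [CInfRing C] where
  toFun : C → ℝ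
  map_op : ∀ {n : ℕ} (f : SmoothFun n) (c : Fin n → C),
    toFun (op f c) = f.toFun fun i => toFun (c i)

instance (C : Type u) [CInfRing C] : CoeFun (RPoint C) (fun _ => C → ℝ) := ⟨RPoint.toFun⟩

/-- Formal expressions in elements of `C`, formal inverses of elements of `S`, and the
operations `Φ_f`. -/
inductive LocTerm (C : Type u) (S : Set C) : Type u
  | of (c : C) : LocTerm C S
  | inv (s : S) : LocTerm C S
  | op {n : ℕ} (f : SmoothFun n) (a : Fin n → LocTerm C S) : LocTerm C S

/-- The congruence generated by the axioms of `C^∞`-rings, by the requirement that `C` maps in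
by a morphism of `C^∞`-rings, and by `s s⁻¹ = 1` for `s ∈ S`. -/
inductive LocRel {C : Type u} [CInfRing C] (S : Set C) : LocTerm C S → LocTerm C S → Prop
  | refl (a) : LocRel S a a
  | symm {a b} : LocRel S a b → LocRel S b a
  | trans {a b c} : LocRel S a b → LocRel S b c → LocRel S a c
  | congr {n : ℕ} (f : SmoothFun n) (a b : Fin n → LocTerm C S) :
      (∀ i, LocRel S (a i) (b i)) → LocRel S (.op f a) (.op f b)
  | op_comp {m n : ℕ} (g : SmoothFun m) (f : Fin m → SmoothFun n) (a : Fin n → LocTerm C S) :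
      LocRel S (.op (g.comp f) a) (.op g fun i => .op (f i) a)
  | op_proj {n : ℕ} (i : Fin n) (a : Fin n → LocTerm C S) :
      LocRel S (.op (SmoothFun.proj i) a) (a i)
  | of_op {n : ℕ} (f : SmoothFun n) (c : Fin n → C) :
      LocRel S (.of (CInfRing.op f c)) (.op f fun i => .of (c i))
  | mul_inv (s : S) :
      LocRel S (.op SmoothFun.mul ![.of s.1, .inv s]) (.op (SmoothFun.const 1) ![])

section Localization

variable {C : Type u} [CInfRing C]

/-- The setoid defining the localization. -/
def locSetoid (S : Set C) : Setoid (LocTerm C S) :=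
  ⟨LocRel S, LocRel.refl, LocRel.symm, LocRel.trans⟩

/-- The localization `C[s⁻¹ : s ∈ S]`, obtained from `C` by adjoining in the sense of
`C^∞`-rings a generator `s⁻¹` and the relation `s s⁻¹ = 1` for each `s ∈ S`. -/
def Loc (S : Set C) : Type u := Quotient (locSetoid S)

/-- The class of a formal expression. -/
def Loc.mk (S : Set C) (a : LocTerm C S) : Loc S := Quotient.mk (locSetoid S) a

theorem Loc.mk_eq {S : Set C} {a b : LocTerm C S} (h : LocRel S a b) : Loc.mk S a = Loc.mk S b :=
  Quotient.sound (s := locSetoid S) h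

/-- The operations on the localization. -/
noncomputable def Loc.op {S : Set C} {n : ℕ} (f : SmoothFun n) (a : Fin n → Loc S) : Loc S :=
  Loc.mk S (.op f fun i => Quotient.out (s := locSetoid S) (a i))

theorem Loc.op_mk {S : Set C} {n : ℕ} (f : SmoothFun n) (a : Fin n → LocTerm C S) :
    Loc.op f (fun i => Loc.mk S (a i)) = Loc.mk S (.op f a) :=
  Loc.mk_eq (.congr f _ _ fun i => Quotient.mk_out (s := locSetoid S) (a i))

theorem Loc.exists_rep {S : Set C} {n : ℕ} (c : Fin n → Loc S) :
    ∃ a : Fin n → LocTerm C S, c = fun i => Loc.mk S (a i) :=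
  ⟨fun i => Quotient.out (s := locSetoid S) (c i),
    funext fun i => (Quotient.out_eq (s := locSetoid S) (c i)).symm⟩

noncomputable instance (S : Set C) : CInfRing (Loc S) where
  op := Loc.op
  op_comp g f c := by
    obtain ⟨a, rfl⟩ := Loc.exists_rep c
    simp only [Loc.op_mk]
    exact Loc.mk_eq (.op_comp g f a)
  op_proj i c := by
    obtain ⟨a, rfl⟩ := Loc.exists_rep c
    rw [Loc.op_mk]
    exact Loc.mk_eq (.op_proj i a)

/-- The canonical morphism `C → C[s⁻¹ : s ∈ S]`. -/
def Loc.of (S : Set C) : CInfRingHom C (Loc S) where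
  toFun c := Loc.mk S (.of c)
  map_op f c := (Loc.mk_eq (.of_op f c)).trans (Loc.op_mk f _).symm

theorem Loc.isUnit_of {S : Set C} {s : C} (hs : s ∈ S) : IsUnit (Loc.of S s) := by
  refine IsUnit.of_mul_eq_one (Loc.mk S (.inv ⟨s, hs⟩)) ?_
  have h := Loc.mk_eq (LocRel.mul_inv (C := C) (S := S) ⟨s, hs⟩)
  rw [← Loc.op_mk, ← Loc.op_mk] at h
  rw [mul_def, one_def]
  convert h using 1
  · change Loc.op _ _ = _
    congr 1; funext i; fin_cases i <;> rfl
  · change Loc.op _ _ = _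
    congr 1; funext i; exact i.elim0

/-- The localization `C_p = C[s⁻¹ : p(s) ≠ 0]` of `C` at an `ℝ`-point `p`. -/
abbrev LocalAt (p : RPoint C) : Type u := Loc {s : C | p s ≠ 0}

/-- The projection `π_p : C → C_p`. -/
abbrev toLocalAt (p : RPoint C) : CInfRingHom C (LocalAt p) := Loc.of {s : C | p s ≠ 0}

end Localization

/-- `C` is finitely generated: there are `c₁, …, cₙ ∈ C` such that every element of `C` has the
form `Φ_f(c₁, …, cₙ)`. -/
def FinitelyGenerated (C : Type u) [CInfRing C] : Prop :=
  ∃ (n : ℕ) (c : Fin n → C), ∀ x : C, ∃ f : SmoothFun n, x = op f c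

/-- `C` is fair: it is finitely generated, and an element which vanishes in `C_p` for all
`ℝ`-points `p` of `C` is zero. -/
def Fair (C : Type u) [CInfRing C] : Prop :=
  FinitelyGenerated C ∧ ∀ c : C, (∀ p : RPoint C, toLocalAt p c = 0) → c = 0

/-! ### Cotangent modules -/

/-- The submodule of the free module on symbols `dc`, `c ∈ C`, spanned by all
`dΦ_f(c₁, …, cₙ) - ∑ᵢ Φ_{∂f/∂xᵢ}(c₁, …, cₙ) dcᵢ`. -/
noncomputable def cotangentRelations (C : Type u) [CInfRing C] : Submodule C (C →₀ C) :=
  Submodule.span C {m | ∃ (n : ℕ) (f : SmoothFun n) (c : Fin n → C),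
    m = Finsupp.single (op f c) 1 - ∑ i, op (f.pderiv i) c • Finsupp.single (c i) 1}

/-- The cotangent module `Ω_C` of a `C^∞`-ring `C`. -/
abbrev Cotangent (C : Type u) [CInfRing C] : Type u := (C →₀ C) ⧸ cotangentRelations C

/-- The universal `C^∞`-derivation `d : C → Ω_C`. -/
noncomputable def d {C : Type u} [CInfRing C] (c : C) : Cotangent C :=
  (cotangentRelations C).mkQ (Finsupp.single c 1)

theorem d_op {C : Type u} [CInfRing C] {n : ℕ} (f : SmoothFun n) (c : Fin n → C) :
    d (op f c) = ∑ i, op (f.pderiv i) c • d (c i) := by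
  have h : (cotangentRelations C).mkQ
      (Finsupp.single (op f c) 1 - ∑ i, op (f.pderiv i) c • Finsupp.single (c i) 1) = 0 := by
    rw [Submodule.mkQ_apply, Submodule.Quotient.mk_eq_zero]
    exact Submodule.subset_span ⟨n, f, c, rfl⟩
  rw [map_sub, map_sum, sub_eq_zero] at h
  simp only [map_smul] at h
  exact h

/-- The `φ`-semilinear map from the free module on symbols `dc` to `Ω_D` sending `dc` to
`d(φ c)`. -/
noncomputable def cotangentFreeMap {C D : Type u} [CInfRing C] [CInfRing D]
    (φ : CInfRingHom C D) : (C →₀ C) →ₛₗ[φ.toRingHom] Cotangent D where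
  toFun m := m.sum fun c r => φ.toRingHom r • d (φ c)
  map_add' m m' := Finsupp.sum_add_index' (fun c => by rw [map_zero, zero_smul])
    (fun c r r' => by rw [map_add, add_smul])
  map_smul' r m := by
    rw [Finsupp.sum_smul_index (fun c => by rw [map_zero, zero_smul]), Finsupp.smul_sum]
    exact Finsupp.sum_congr fun c _ => by rw [map_mul, mul_smul]

theorem cotangentFreeMap_single {C D : Type u} [CInfRing C] [CInfRing D]
    (φ : CInfRingHom C D) (c : C) : cotangentFreeMap φ (Finsupp.single c 1) = d (φ c) := by
  change Finsupp.sum (Finsupp.single c (1 : C)) (fun c r => φ.toRingHom r • d (φ c)) = _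
  rw [Finsupp.sum_single_index (by rw [map_zero, zero_smul]), map_one, one_smul]

/-- The map `Ω_φ : Ω_C → Ω_D` induced by a morphism `φ : C → D` of `C^∞`-rings: the unique
`φ`-semilinear map with `Ω_φ (dc) = d(φ c)`. -/
noncomputable def cotangentMap {C D : Type u} [CInfRing C] [CInfRing D] (φ : CInfRingHom C D) :
    Cotangent C →ₛₗ[φ.toRingHom] Cotangent D :=
  (cotangentRelations C).liftQ (cotangentFreeMap φ) <| by
    refine Submodule.span_le.2 ?_
    rintro _ ⟨n, f, c, rfl⟩
    change cotangentFreeMap φ _ = 0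
    simp only [map_sub, map_sum, map_smulₛₗ, cotangentFreeMap_single]
    rw [sub_eq_zero, CInfRingHom.map_op', d_op]
    refine Finset.sum_congr rfl fun i _ => ?_
    congr 1
    exact (φ.map_op _ _).symm

theorem cotangentMap_d {C D : Type u} [CInfRing C] [CInfRing D] (φ : CInfRingHom C D) (c : C) :
    cotangentMap φ (d c) = d (φ c) :=
  cotangentFreeMap_single φ c

theorem span_range_d (C : Type u) [CInfRing C] :
    Submodule.span C (Set.range (d : C → Cotangent C)) = ⊤ := by
  have h : (d : C → Cotangent C) = (cotangentRelations C).mkQ ∘ fun c => Finsupp.single c 1 := rfl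
  have h' : Submodule.span C (Set.range fun c : C => Finsupp.single c (1 : C)) = ⊤ := by
    have := (Finsupp.basisSingleOne (R := C) (ι := C)).span_eq
    rwa [Finsupp.coe_basisSingleOne] at this
  rw [h, Set.range_comp, ← Submodule.map_span, h', Submodule.map_top, Submodule.range_mkQ]

end CInfRing

/-! ### `C^∞`-ringed spaces -/

/-- A `C^∞`-ringed space: a topological space with a sheaf of `C^∞`-rings, i.e. a presheaf of
`C^∞`-rings whose underlying presheaf of sets satisfies the sheaf axioms. -/
structure CInfRingedSpace extends
    AlgebraicGeometry.PresheafedSpace.{u, u + 1, u} CInfRingCat.{u} where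
  isSheaf : TopCat.Presheaf.IsSheaf (presheaf ⋙ forget CInfRingCat.{u})

namespace CInfRingedSpace

/-- A morphism of `C^∞`-ringed spaces is a continuous map `f : X → Y` together with a morphism
`f^♯ : 𝒪_Y → f_* 𝒪_X` of presheaves of `C^∞`-rings. -/
instance : Category CInfRingedSpace.{u} :=
  inferInstanceAs <| Category
    (InducedCategory (AlgebraicGeometry.PresheafedSpace CInfRingCat.{u}) toPresheafedSpace)

variable (X : CInfRingedSpace.{u})

/-- The underlying presheaf of commutative rings. -/
noncomputable abbrev commRingPresheaf : TopCat.Presheaf CommRingCat.{u} X.carrier :=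
  X.presheaf ⋙ CInfRingCat.toCommRingCat

/-- The underlying sheaf of rings. -/
noncomputable def ringSheaf :
    Sheaf (Opens.grothendieckTopology X.carrier) RingCat.{u} where
  obj := X.presheaf ⋙ CInfRingCat.toRingCat
  property := (TopCat.Presheaf.isSheaf_iff_isSheaf_comp (CategoryTheory.forget RingCat.{u})
    (X.presheaf ⋙ CInfRingCat.toRingCat)).2 X.isSheaf

/-- A `C^∞`-ringed space is local if each stalk of its structure sheaf is a local ring with
residue field `ℝ`. (A ring isomorphism of the residue field with `ℝ` is automatically one of
`ℝ`-algebras, as `ℝ` has no ring endomorphisms besides the identity.) -/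
def IsLocal : Prop :=
  ∀ x : X.carrier, ∃ _ : IsLocalRing (X.commRingPresheaf.stalk x),
    Nonempty (IsLocalRing.ResidueField (X.commRingPresheaf.stalk x) ≃+* ℝ)

/-- The open subspace `(U, 𝒪_X|_U)`. -/
noncomputable def restrict (U : Opens X.carrier) : CInfRingedSpace.{u} where
  toPresheafedSpace := X.toPresheafedSpace.restrict U.isOpenEmbedding
  isSheaf := TopCat.Presheaf.isSheaf_of_isOpenEmbedding
    (F := X.presheaf ⋙ forget CInfRingCat.{u}) U.isOpenEmbedding X.isSheaf

/-- The inclusion `(U, 𝒪_X|_U) → X`. -/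
noncomputable def ofRestrict (U : Opens X.carrier) : X.restrict U ⟶ X :=
  InducedCategory.homMk (X.toPresheafedSpace.ofRestrict U.isOpenEmbedding)

variable {X} {Y Z : CInfRingedSpace.{u}}

/-- The morphism of sheaves of rings underlying a morphism of `C^∞`-ringed spaces. -/
noncomputable def ringSheafHom (f : X ⟶ Y) :
    Y.ringSheaf ⟶ ((Opens.map f.hom.base).sheafPushforwardContinuous RingCat.{u}
      (Opens.grothendieckTopology Y.carrier) (Opens.grothendieckTopology X.carrier)).obj
        X.ringSheaf where
  hom := Functor.whiskerRight f.hom.c CInfRingCat.toRingCat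

/-! ### Sheaves of modules -/

variable (X) in
/-- The category of `𝒪_X`-modules. -/
abbrev Modules := SheafOfModules.{u} X.ringSheaf

variable (X) in
/-- The category of presheaves of `𝒪_X`-modules. -/
abbrev PreModules := PresheafOfModules.{u} X.ringSheaf.obj

variable (X) in
/-- Sheafification of presheaves of `𝒪_X`-modules. -/
noncomputable abbrev sheafify : X.PreModules ⥤ X.Modules :=
  PresheafOfModules.sheafification (𝟙 X.ringSheaf.obj)

/-- The morphism of presheaves of rings underlying a morphism of `C^∞`-ringed spaces. -/
noncomputable def ringPresheafHom (f : X ⟶ Y) :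
    Y.ringSheaf.obj ⟶ (Opens.map f.hom.base).op ⋙ X.ringSheaf.obj :=
  Functor.whiskerRight f.hom.c CInfRingCat.toRingCat

instance (f : X ⟶ Y) : (PresheafOfModules.pushforward.{u} (ringSheafHom f).hom).IsRightAdjoint :=
  inferInstanceAs (PresheafOfModules.pushforward.{u} (ringPresheafHom f)).IsRightAdjoint

instance (f : X ⟶ Y) : (SheafOfModules.pushforward.{u} (ringSheafHom f)).IsRightAdjoint :=
  inferInstance

/-- The pullback `f^*` from `𝒪_Y`-modules to `𝒪_X`-modules, left adjoint to `f_*`. -/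
noncomputable def pullback (f : X ⟶ Y) : Y.Modules ⥤ X.Modules :=
  SheafOfModules.pullback (ringSheafHom f)

/-- The canonical isomorphism `I_{f,g} : (g ∘ f)^* ≅ f^* g^*`. -/
noncomputable def pullbackComp (f : X ⟶ Y) (g : Y ⟶ Z) :
    pullback (f ≫ g) ≅ pullback g ⋙ pullback f :=
  (SheafOfModules.pullbackComp (ringSheafHom g) (ringSheafHom f)).symm

/-- Pullbacks along equal morphisms are identified. -/
noncomputable def pullbackCongr {f g : X ⟶ Y} (h : f = g) : pullback f ≅ pullback g :=
  eqToIso (by rw [h])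

/-! ### Cotangent sheaves -/

noncomputable instance (C : CInfRingCat.{u}) :
    Module (CInfRingCat.toRingCat.obj C) (CInfRing.Cotangent C) :=
  inferInstanceAs (Module C (CInfRing.Cotangent C))

/-- The cotangent module `Ω_C` as an object of the category of `C`-modules. -/
noncomputable def cotangentModuleCat (C : CInfRingCat.{u}) :
    ModuleCat.{u} (CInfRingCat.toRingCat.obj C) :=
  ModuleCat.of (CInfRingCat.toRingCat.obj C) (CInfRing.Cotangent C)

/-- The universal derivation `d : C → Ω_C`. -/
noncomputable def cotangentModuleCatD {C : CInfRingCat.{u}} (c : C) : cotangentModuleCat C :=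
  (CInfRing.d c : CInfRing.Cotangent C)

/-- `Ω_φ : Ω_C → Ω_D` as a morphism in the category of `C`-modules. -/
noncomputable def cotangentMapModuleCat {C D : CInfRingCat.{u}} (φ : C ⟶ D) :
    cotangentModuleCat C ⟶
      (ModuleCat.restrictScalars (CInfRingCat.toRingCat.map φ).hom).obj (cotangentModuleCat D) :=
  ModuleCat.ofHom
    (X := CInfRing.Cotangent C)
    (Y := (ModuleCat.restrictScalars (CInfRingCat.toRingCat.map φ).hom).obj
        (cotangentModuleCat D))
    { toFun := CInfRing.cotangentMap φ.hom
      map_add' := map_add (CInfRing.cotangentMap φ.hom)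
      map_smul' := (CInfRing.cotangentMap φ.hom).map_smulₛₗ }

theorem cotangentMapModuleCat_d {C D : CInfRingCat.{u}} (φ : C ⟶ D) (c : C) :
    (cotangentMapModuleCat φ).hom (cotangentModuleCatD c) = cotangentModuleCatD (φ.hom c) :=
  CInfRing.cotangentMap_d φ.hom c

theorem cotangentModuleCat_hom_ext {C : CInfRingCat.{u}}
    {M : ModuleCat.{u} (CInfRingCat.toRingCat.obj C)} {f g : cotangentModuleCat C ⟶ M}
    (h : ∀ c : C, f.hom (cotangentModuleCatD c) = g.hom (cotangentModuleCatD c)) : f = g :=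
  ModuleCat.hom_ext <| LinearMap.ext_on_range (v := fun c : C => cotangentModuleCatD c)
    (CInfRing.span_range_d C) h

variable (X) in
/-- The presheaf `𝒫T^*X : U ↦ Ω_{𝒪_X(U)}` of `𝒪_X`-modules. -/
noncomputable def preCotangent : X.PreModules where
  obj U := cotangentModuleCat (X.presheaf.obj U)
  map i := cotangentMapModuleCat (X.presheaf.map i)
  map_id U := cotangentModuleCat_hom_ext fun c =>
    (cotangentMapModuleCat_d _ c).trans <| congrArg cotangentModuleCatD
      (congrArg (fun φ : X.presheaf.obj U ⟶ X.presheaf.obj U => φ.hom c) (X.presheaf.map_id U))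
  map_comp {U V W} i j := cotangentModuleCat_hom_ext fun c => by
    have h := (congrArg (cotangentMapModuleCat (X.presheaf.map j)).hom
      (cotangentMapModuleCat_d (X.presheaf.map i) c)).trans
        (cotangentMapModuleCat_d (X.presheaf.map j) ((X.presheaf.map i).hom c))
    exact (cotangentMapModuleCat_d _ c).trans <| (congrArg cotangentModuleCatD
      (congrArg (fun φ : X.presheaf.obj U ⟶ X.presheaf.obj W => φ.hom c)
        (X.presheaf.map_comp i j))).trans h.symm

variable (X) in
/-- The cotangent sheaf `T^*X`, the sheafification of `𝒫T^*X`. -/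
noncomputable def cotangent : X.Modules := X.sheafify.obj X.preCotangent

/-- The morphism `𝒫T^*Y → f_* 𝒫T^*X` given on an open set `U ⊆ Y` by
`Ω_{f^♯(U)} : Ω_{𝒪_Y(U)} → Ω_{𝒪_X(f⁻¹(U))}`. -/
noncomputable def preOmegaAdj (f : X ⟶ Y) : Y.preCotangent ⟶
    (PresheafOfModules.pushforward (ringSheafHom f).hom).obj X.preCotangent where
  app U := cotangentMapModuleCat (f.hom.c.app U)
  naturality {U V} i := cotangentModuleCat_hom_ext fun c => by
    have h : (Y.presheaf.map i ≫ f.hom.c.app V).hom c =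
      (f.hom.c.app U ≫ X.presheaf.map ((Opens.map f.hom.base).op.map i)).hom c := by
      rw [f.hom.c.naturality]; rfl
    have h1 := (congrArg (cotangentMapModuleCat (f.hom.c.app V)).hom
      (cotangentMapModuleCat_d (Y.presheaf.map i) c)).trans
        (cotangentMapModuleCat_d (f.hom.c.app V) ((Y.presheaf.map i).hom c))
    have h2 := (congrArg (cotangentMapModuleCat
        (X.presheaf.map ((Opens.map f.hom.base).op.map i))).hom
      (cotangentMapModuleCat_d (f.hom.c.app U) c)).trans
        (cotangentMapModuleCat_d (X.presheaf.map ((Opens.map f.hom.base).op.map i))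
          ((f.hom.c.app U).hom c))
    exact h1.trans ((congrArg cotangentModuleCatD h).trans h2.symm)

/-- The morphism of presheaves `𝒫Ω_f : f^*(𝒫T^*Y) → 𝒫T^*X`, corresponding to
`𝒫T^*Y → f_* 𝒫T^*X` under the adjunction between pullback and pushforward of presheaves of
modules. -/
noncomputable def preOmega (f : X ⟶ Y) :
    (PresheafOfModules.pullback (ringSheafHom f).hom).obj Y.preCotangent ⟶ X.preCotangent :=
  ((PresheafOfModules.pullbackPushforwardAdjunction (ringSheafHom f).hom).homEquiv _ _).symm
    (preOmegaAdj f)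

/-- The morphism `Ω_f : f^*(T^*Y) → T^*X` of sheaves induced by `𝒫Ω_f`, where `f^*(T^*Y)` is
identified with the sheafification of the presheaf pullback `f^*(𝒫T^*Y)`. -/
noncomputable def Omega (f : X ⟶ Y) : (pullback f).obj Y.cotangent ⟶ X.cotangent :=
  (SheafOfModules.sheafificationCompPullback (ringSheafHom f)).hom.app Y.preCotangent ≫
    X.sheafify.map (preOmega f)


end CInfRingedSpace

/-! ### Spectra of `C^∞`-rings -/

namespace CInfRing

/-- The topology on the set of `ℝ`-points of `C`: the smallest one for which all maps
`c_* : p ↦ p(c)`, `c ∈ C`, are continuous. -/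
instance (C : Type u) [CInfRing C] : TopologicalSpace (RPoint C) :=
  ⨅ c : C, TopologicalSpace.induced (fun p : RPoint C => p c) inferInstance

theorem continuous_eval {C : Type u} [CInfRing C] (c : C) :
    Continuous fun p : RPoint C => p c :=
  continuous_iff_le_induced.2 (iInf_le _ c)

/-- The space `X_C` of `ℝ`-points of `C`. -/
def specTop (C : Type u) [CInfRing C] : TopCat.{u} := TopCat.of (RPoint C)

/-- The stalks `C_p` as a family over the space of `ℝ`-points. -/
abbrev specStalk (C : Type u) [CInfRing C] (p : specTop C) : Type u :=
  LocalAt (show RPoint C from p)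

/-- A function `s` with `s(p) ∈ C_p` is a fraction if there are `c, d ∈ C` such that `p(d) ≠ 0` and
`s(p) = π_p(c) π_p(d)⁻¹` for all `p`. -/
def isFractionPrelocal (C : Type u) [CInfRing C] :
    TopCat.PrelocalPredicate (X := specTop C) (specStalk C) where
  pred {U} s := ∃ c d : C, ∀ p : U, (show RPoint C from p.1) d ≠ 0 ∧
    s p * toLocalAt (show RPoint C from p.1) d = toLocalAt (show RPoint C from p.1) c
  res i s := by
    rintro ⟨c, d, h⟩
    exact ⟨c, d, fun p => h (i p)⟩

/-- A function `s` with `s(p) ∈ C_p` is regular if it is locally a fraction. -/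
def isRegular (C : Type u) [CInfRing C] :
    TopCat.LocalPredicate (X := specTop C) (specStalk C) :=
  (isFractionPrelocal C).sheafify

/-- Near a point where `d` does not vanish, the inverse of `d` is represented by an element of
`C`. -/
theorem exists_local_inverse {C : Type u} [CInfRing C] (d : C) (p₀ : RPoint C) (h₀ : p₀ d ≠ 0) :
    ∃ V : Set (RPoint C), IsOpen V ∧ p₀ ∈ V ∧ ∃ e : C, ∀ p ∈ V,
      toLocalAt p d * toLocalAt p e = 1 := by
  set t₀ := p₀ d with ht₀
  have ha : 0 < |t₀| := abs_pos.2 h₀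
  let χ : ContDiffBump t₀ := ⟨|t₀| / 4, |t₀| / 2, by positivity, by linarith⟩
  let χ' : ContDiffBump t₀ := ⟨|t₀| / 8, |t₀| / 4, by positivity, by linarith⟩
  have hpos : ∀ t : ℝ, t ^ 2 + 1 - χ t ≠ 0 := by
    intro t
    have h1 : χ t ≤ 1 := χ.le_one
    rcases eq_or_ne t 0 with rfl | ht
    · have : χ 0 = 0 := χ.zero_of_le_dist (by
        change |t₀| / 2 ≤ dist 0 t₀
        rw [dist_comm, Real.dist_eq, sub_zero]; linarith)
      rw [this]; norm_num
    · have : 0 < t ^ 2 := by positivity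
      exact ne_of_gt (by linarith)
  let r : SmoothFun 1 := SmoothFun.ofReal (fun t => t / (t ^ 2 + 1 - χ t))
    (contDiff_id.div (((contDiff_id.pow 2).add contDiff_const).sub χ.contDiff) hpos)
  let q : SmoothFun 1 := SmoothFun.ofReal (fun t => χ' t) χ'.contDiff
  have key : op q ![d] * (d * op r ![d]) = op q ![d] := by
    have hd : d = op (SmoothFun.proj 0) ![d] := by rw [op_proj]; rfl
    conv_lhs => enter [2, 1]; rw [hd]
    rw [op_mul_op, op_mul_op]
    refine op_eq_op _ fun x => ?_
    change χ' (x 0) * (x 0 * (x 0 / (x 0 ^ 2 + 1 - χ (x 0)))) = χ' (x 0)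
    generalize x 0 = t
    by_cases ht : dist t t₀ < |t₀| / 4
    · have h1 : χ t = 1 := χ.one_of_mem_closedBall (by
        rw [Metric.mem_closedBall]; exact ht.le)
      have h2 : t ≠ 0 := by
        rintro rfl
        rw [dist_comm, Real.dist_eq, sub_zero] at ht; linarith
      rw [h1]; field_simp; ring_nf
    · rw [χ'.zero_of_le_dist (not_lt.1 ht), zero_mul]
  refine ⟨(fun p : RPoint C => p d) ⁻¹' Metric.ball t₀ (|t₀| / 4),
    Metric.isOpen_ball.preimage (continuous_eval d),
    Metric.mem_ball_self (by positivity), op r ![d], fun p hp => ?_⟩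
  have hunit : IsUnit (toLocalAt p (op q ![d])) := by
    refine Loc.isUnit_of ?_
    change p (op q ![d]) ≠ 0
    rw [p.map_op]
    exact (χ'.pos_of_mem_ball hp).ne'
  have h := congrArg (toLocalAt p).toRingHom key
  rw [map_mul, map_mul] at h
  exact hunit.mul_left_cancel (h.trans (mul_one _).symm)

/-- A regular function is locally given by an element of `C`. -/
theorem exists_of_isRegular {C : Type u} [CInfRing C] {U : Opens (specTop C)}
    {s : ∀ p : U, specStalk C p.1} (hs : (isRegular C).pred s) (p₀ : U) :
    ∃ (V : Opens (specTop C)) (_ : p₀.1 ∈ V) (i : V ⟶ U) (c : C),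
      ∀ p : V, s (i p) = toLocalAt (show RPoint C from p.1) c := by
  obtain ⟨V, hV, i, c, d, h⟩ := hs p₀
  obtain ⟨V', hV'o, hV', e, he⟩ := exists_local_inverse d p₀.1 (h ⟨p₀.1, hV⟩).1
  refine ⟨V ⊓ ⟨V', hV'o⟩, ⟨hV, hV'⟩, homOfLE inf_le_left ≫ i, c * e, fun p => ?_⟩
  have h1 := (h ⟨p.1, p.2.1⟩).2
  have h2 := he p.1 p.2.2
  refine Eq.trans ?_ ((toLocalAt (show RPoint C from p.1)).toRingHom.map_mul c e).symm
  refine Eq.trans ?_ (congrArg (· * toLocalAt (show RPoint C from p.1) e) h1)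
  refine Eq.trans ?_ (mul_assoc _ _ _).symm
  exact ((congrArg _ h2).trans (mul_one _)).symm

/-- A function locally given by elements of `C` is regular. -/
theorem isRegular_of {C : Type u} [CInfRing C] {U : Opens (specTop C)}
    {s : ∀ p : U, specStalk C p.1}
    (hs : ∀ p₀ : U, ∃ (V : Opens (specTop C)) (_ : p₀.1 ∈ V) (i : V ⟶ U) (c : C),
      ∀ p : V, s (i p) = toLocalAt (show RPoint C from p.1) c) : (isRegular C).pred s := by
  intro p₀
  obtain ⟨V, hV, i, c, h⟩ := hs p₀
  refine ⟨V, hV, i, c, 1, fun p => ⟨?_, ?_⟩⟩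
  · rw [one_def, RPoint.map_op]; exact one_ne_zero
  · exact (congrArg₂ (· * ·) (h p)
      ((toLocalAt (show RPoint C from p.1)).toRingHom.map_one)).trans (mul_one _)

theorem isRegular_op {C : Type u} [CInfRing C] {U : Opens (specTop C)} {n : ℕ} (f : SmoothFun n)
    (s : Fin n → ∀ p : U, specStalk C p.1) (hs : ∀ k, (isRegular C).pred (s k)) :
    (isRegular C).pred fun p => op f fun k => s k p := by
  refine isRegular_of fun p₀ => ?_
  choose V hV i c h using fun k => exists_of_isRegular (hs k) p₀
  have hle : U ⊓ ⨅ k, V k ≤ U := inf_le_left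
  have hmem : p₀.1 ∈ U ⊓ ⨅ k, V k := by
    refine ⟨p₀.2, ?_⟩
    rw [Opens.coe_iInf, Set.mem_iInter]
    exact hV
  refine ⟨U ⊓ ⨅ k, V k, hmem, homOfLE hle, op f c, fun p => ?_⟩
  refine Eq.trans ?_ ((toLocalAt (show RPoint C from p.1)).map_op f c).symm
  change op f _ = op f _
  congr 1
  funext k
  exact h k ⟨p.1, (iInf_le V k) p.2.2⟩

/-- The ring `𝒪(U)` of regular functions on `U`, with the operations `Φ_f` taken pointwise. -/
def RegularFun {C : Type u} [CInfRing C] (U : Opens (specTop C)) : Type u :=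
  {s : ∀ p : U, specStalk C p.1 // (isRegular C).pred s}

noncomputable instance {C : Type u} [CInfRing C] (U : Opens (specTop C)) : CInfRing (RegularFun U) where
  op f s := ⟨fun p => op f fun k => (s k).1 p, isRegular_op f _ fun k => (s k).2⟩
  op_comp g f _ := Subtype.ext (funext fun _ => op_comp g f _)
  op_proj i _ := Subtype.ext (funext fun _ => op_proj i _)

/-- The restriction map `𝒪(U) → 𝒪(V)`. -/
noncomputable def RegularFun.res {C : Type u} [CInfRing C] {U V : Opens (specTop C)} (i : V ⟶ U) :
    CInfRingHom (RegularFun U) (RegularFun V) where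
  toFun s := ⟨fun p => s.1 (i p), (isRegular C).res i s.1 s.2⟩
  map_op _ _ := rfl

/-- The morphism `C → 𝒪(U)` sending `c` to the function `p ↦ π_p(c)`. -/
noncomputable def RegularFun.of {C : Type u} [CInfRing C] (U : Opens (specTop C)) :
    CInfRingHom C (RegularFun U) where
  toFun c := ⟨fun p => toLocalAt (show RPoint C from p.1) c,
    isRegular_of fun p₀ => ⟨U, p₀.2, 𝟙 U, c, fun _ => rfl⟩⟩
  map_op f c := Subtype.ext (funext fun p => (toLocalAt (show RPoint C from p.1)).map_op f c)

/-- The structure sheaf of `Spec C`. -/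
noncomputable def specPresheaf (C : Type u) [CInfRing C] : TopCat.Presheaf CInfRingCat.{u} (specTop C) where
  obj U := CInfRingCat.of (RegularFun U.unop)
  map i := ⟨RegularFun.res i.unop⟩

/-- The spectrum `Spec C = (X_C, 𝒪_{X_C})` of a `C^∞`-ring `C`. -/
noncomputable def Spec (C : Type u) [CInfRing C] : CInfRingedSpace.{u} where
  carrier := specTop C
  presheaf := specPresheaf C
  isSheaf := TopCat.subpresheafToTypes.isSheaf (isRegular C)

/-! ### The functor `MSpec` -/

section MSpec

open scoped TensorProduct

variable {C : Type u} [CInfRing C]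

noncomputable instance (U : Opens (specTop C)) : Algebra C (RegularFun U) :=
  (RegularFun.of U).toRingHom.toAlgebra

/-- The restriction map `𝒪(U) → 𝒪(V)` as a `C`-linear map. -/
noncomputable def RegularFun.resLinear {U V : Opens (specTop C)} (i : V ⟶ U) :
    RegularFun U →ₗ[C] RegularFun V where
  toFun := RegularFun.res i
  map_add' := map_add (RegularFun.res i).toRingHom
  map_smul' c s := by
    rw [Algebra.smul_def, Algebra.smul_def]
    exact map_mul (RegularFun.res i).toRingHom _ _

variable (M : Type u) [AddCommGroup M] [Module C M]

/-- The `𝒪(U)`-module `M ⊗_C 𝒪(U)`. -/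
noncomputable abbrev baseChange (U : Opens (specTop C)) : Type u := RegularFun U ⊗[C] M

noncomputable instance (U : (Opens (specTop C))ᵒᵖ) :
    Module ((Spec C).ringSheaf.obj.obj U) (baseChange M U.unop) :=
  inferInstanceAs (Module (RegularFun U.unop) (RegularFun U.unop ⊗[C] M))

theorem resLinear_smul {U V : Opens (specTop C)} (i : V ⟶ U) (s : RegularFun U)
    (m : baseChange M U) : (RegularFun.resLinear i).rTensor M (s • m) =
      RegularFun.res i s • (RegularFun.resLinear i).rTensor M m := by
  induction m using TensorProduct.induction_on with
  | zero => simp only [smul_zero, map_zero]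
  | add m m' h h' => simp only [smul_add, map_add, h, h']
  | tmul t m =>
    rw [TensorProduct.smul_tmul', LinearMap.rTensor_tmul, LinearMap.rTensor_tmul,
      TensorProduct.smul_tmul']
    congr 1
    exact map_mul (RegularFun.res i).toRingHom _ _

/-- `M ⊗_C 𝒪(U)` as an object of the category of `𝒪(U)`-modules. -/
noncomputable def preMSpecObj (U : (Opens (specTop C))ᵒᵖ) :
    ModuleCat.{u} ((Spec C).ringSheaf.obj.obj U) :=
  ModuleCat.of ((Spec C).ringSheaf.obj.obj U) (baseChange M U.unop)

/-- The restriction map `M ⊗_C 𝒪(U) → M ⊗_C 𝒪(V)`. -/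
noncomputable def preMSpecMap {U V : (Opens (specTop C))ᵒᵖ} (i : U ⟶ V) :
    preMSpecObj M U ⟶
      (ModuleCat.restrictScalars ((Spec C).ringSheaf.obj.map i).hom).obj (preMSpecObj M V) :=
  ModuleCat.ofHom
    (X := baseChange M U.unop)
    (Y := (ModuleCat.restrictScalars ((Spec C).ringSheaf.obj.map i).hom).obj (preMSpecObj M V))
    { toFun := (RegularFun.resLinear i.unop).rTensor M
      map_add' := map_add ((RegularFun.resLinear i.unop).rTensor M)
      map_smul' := resLinear_smul M i.unop }

theorem rTensor_res_id (U : Opens (specTop C)) (m : baseChange M U) :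
    (RegularFun.resLinear (𝟙 U)).rTensor M m = m :=
  LinearMap.congr_fun (LinearMap.rTensor_id M (RegularFun U)) m

theorem rTensor_res_comp {U V W : Opens (specTop C)} (i : V ⟶ U) (j : W ⟶ V)
    (m : baseChange M U) :
    (RegularFun.resLinear (j ≫ i)).rTensor M m =
      (RegularFun.resLinear j).rTensor M ((RegularFun.resLinear i).rTensor M m) :=
  LinearMap.congr_fun
    (LinearMap.rTensor_comp M (RegularFun.resLinear j) (RegularFun.resLinear i)) m

/-- The presheaf `U ↦ M ⊗_C 𝒪(U)` of modules on `Spec C`. -/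
noncomputable def preMSpec : (Spec C).PreModules where
  obj U := preMSpecObj M U
  map i := preMSpecMap M i
  map_id _ := ModuleCat.hom_ext (LinearMap.ext fun m => rTensor_res_id M _ m)
  map_comp i j := ModuleCat.hom_ext (LinearMap.ext fun m =>
    rTensor_res_comp M i.unop j.unop m)

/-- The `𝒪`-module `MSpec M` on `Spec C`: the sheafification of `U ↦ M ⊗_C 𝒪(U)`. -/
noncomputable def MSpec : (Spec C).Modules := (Spec C).sheafify.obj (preMSpec M)

end MSpec

end CInfRing

/-! ### `C^∞`-schemes -/

namespace CInfRingedSpace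

/-- `X` is an affine `C^∞`-scheme if it is isomorphic to `Spec C` for some `C^∞`-ring `C`. -/
def IsAffine (X : CInfRingedSpace.{u}) : Prop :=
  ∃ (C : Type u) (_ : CInfRing C), Nonempty (X ≅ CInfRing.Spec C)

/-- `X` is a `C^∞`-scheme if it is a local `C^∞`-ringed space which can be covered by open sets
`U` such that `(U, 𝒪_X|_U)` is an affine `C^∞`-scheme. -/
def IsScheme : ObjectProperty CInfRingedSpace.{u} := fun X =>
  X.IsLocal ∧ ∀ x : X.carrier, ∃ U : Opens X.carrier, x ∈ U ∧ (X.restrict U).IsAffine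

/-- A `C^∞`-scheme `X` is locally fair if it can be covered by open sets `U` such that
`(U, 𝒪_X|_U) ≅ Spec C` for some fair `C^∞`-ring `C`. -/
def IsLocallyFair : ObjectProperty CInfRingedSpace.{u} := fun X =>
  X.IsScheme ∧ ∀ x : X.carrier, ∃ U : Opens X.carrier, x ∈ U ∧
    ∃ (C : Type u) (_ : CInfRing C), CInfRing.Fair C ∧ Nonempty (X.restrict U ≅ CInfRing.Spec C)

/-- An `𝒪_X`-module `E` is quasicoherent if `X` can be covered by open sets `U` with an
isomorphism `φ : Spec C ≅ (U, 𝒪_X|_U)` under which `E|_U` corresponds to `MSpec M` for some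
`C`-module `M`; here `φ^*(E|_U)` is computed as the pullback of `E` along the composition of `φ`
with the inclusion `(U, 𝒪_X|_U) → X`. -/
def IsQuasicoherent (X : CInfRingedSpace.{u}) : ObjectProperty X.Modules := fun E =>
  ∀ x : X.carrier, ∃ U : Opens X.carrier, x ∈ U ∧
    ∃ (C : Type u) (_ : CInfRing C) (φ : CInfRing.Spec C ≅ X.restrict U)
      (M : Type u) (_ : AddCommGroup M) (_ : Module C M),
      Nonempty ((pullback (φ.hom ≫ X.ofRestrict U)).obj E ≅ CInfRing.MSpec M)

end CInfRingedSpace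

/-- The category of locally fair `C^∞`-schemes. -/
abbrev LocallyFairCInfScheme := CInfRingedSpace.IsLocallyFair.{u}.FullSubcategory

namespace CInfRingedSpace

/-- The category `qcoh(X)` of quasicoherent `𝒪_X`-modules. -/
abbrev QCoh (X : CInfRingedSpace.{u}) := (IsQuasicoherent X).FullSubcategory

variable {W X Y Z : CInfRingedSpace.{u}}

/-- The morphism `(e^*(Ω_g) ∘ I_{e,g}(T^*Z)) ⊕ -(f^*(Ω_h) ∘ I_{f,h}(T^*Z))` from
`(g ∘ e)^*(T^*Z)` to `e^*(T^*X) ⊕ f^*(T^*Y)` attached to a commutative square `g ∘ e = h ∘ f`. -/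
noncomputable def squareLeft (e : W ⟶ X) (f : W ⟶ Y) (g : X ⟶ Z) (h : Y ⟶ Z)
    (comm : e ≫ g = f ≫ h) : (pullback (e ≫ g)).obj Z.cotangent ⟶
      (pullback e).obj X.cotangent ⊞ (pullback f).obj Y.cotangent :=
  biprod.lift
    ((pullbackComp e g).hom.app Z.cotangent ≫ (pullback e).map (Omega g))
    (-((pullbackCongr comm).hom.app Z.cotangent ≫
      (pullbackComp f h).hom.app Z.cotangent ≫ (pullback f).map (Omega h)))

/-- The morphism `Ω_e ⊕ Ω_f : e^*(T^*X) ⊕ f^*(T^*Y) → T^*W`. -/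
noncomputable def squareRight (e : W ⟶ X) (f : W ⟶ Y) :
    (pullback e).obj X.cotangent ⊞ (pullback f).obj Y.cotangent ⟶ W.cotangent :=
  biprod.desc (Omega e) (Omega f)

end CInfRingedSpace

/-- The sequence `A → B → C → 0` is exact. -/
def IsRightExactSequence {𝒜 : Type*} [Category 𝒜] [Preadditive 𝒜] {A B C : 𝒜}
    (a : A ⟶ B) (b : B ⟶ C) : Prop :=
  ∃ w : a ≫ b = 0, (ShortComplex.mk a b w).Exact ∧ Epi b

theorem CategoryTheory.Adjunction.homEquiv_leftAdjointCompIso_inv_app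
    {C₀ C₁ C₂ : Type*} [Category C₀] [Category C₁] [Category C₂]
    {F₀₁ : C₀ ⥤ C₁} {F₁₂ : C₁ ⥤ C₂} {F₀₂ : C₀ ⥤ C₂}
    {G₁₀ : C₁ ⥤ C₀} {G₂₁ : C₂ ⥤ C₁} {G₂₀ : C₂ ⥤ C₀}
    (adj₀₁ : F₀₁ ⊣ G₁₀) (adj₁₂ : F₁₂ ⊣ G₂₁) (adj₀₂ : F₀₂ ⊣ G₂₀)
    (e : G₂₁ ⋙ G₁₀ ≅ G₂₀) {E : C₀} {F : C₂} (α : F₁₂.obj (F₀₁.obj E) ⟶ F) :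
    adj₀₂.homEquiv E F ((Adjunction.leftAdjointCompIso adj₀₁ adj₁₂ adj₀₂ e).inv.app E ≫ α) =
      adj₀₁.homEquiv _ _ (adj₁₂.homEquiv _ _ α) ≫ e.hom.app F := by
  have h := unit_conjugateEquiv (adj₀₁.comp adj₁₂) adj₀₂
    (Adjunction.leftAdjointCompIso adj₀₁ adj₁₂ adj₀₂ e).inv E
  rw [Adjunction.conjugateEquiv_leftAdjointCompIso_inv] at h
  have h2 := e.hom.naturality α
  dsimp at h h2
  simp only [Adjunction.homEquiv_unit, Functor.map_comp, Category.assoc, h2]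
  rw [← Category.assoc, ← h]
  simp

namespace CInfRing

/-- The semilinear map out of the cotangent module induced by a derivation. -/
noncomputable def cotangentLift {C D : Type u} [CInfRing C] [CInfRing D] {M : Type u}
    [AddCommGroup M] [Module D M] (φ : CInfRingHom C D) (δ : C → M)
    (hδ : ∀ {n : ℕ} (f : SmoothFun n) (c : Fin n → C),
      δ (op f c) = ∑ i, φ (op (f.pderiv i) c) • δ (c i)) :
    Cotangent C →ₛₗ[φ.toRingHom] M :=
  let L : (C →₀ C) →ₛₗ[φ.toRingHom] M :=
    { toFun := fun m => m.sum fun c r => φ.toRingHom r • δ c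
      map_add' := fun m m' => Finsupp.sum_add_index' (fun c => by rw [map_zero, zero_smul])
        (fun c r r' => by rw [map_add, add_smul])
      map_smul' := fun r m => by
        rw [Finsupp.sum_smul_index (fun c => by rw [map_zero, zero_smul]), Finsupp.smul_sum]
        exact Finsupp.sum_congr fun c _ => by rw [map_mul, mul_smul] }
  have hL : ∀ c, L (Finsupp.single c 1) = δ c := fun c => by
    change Finsupp.sum (Finsupp.single c (1 : C)) (fun c r => φ.toRingHom r • δ c) = _
    rw [Finsupp.sum_single_index (by rw [map_zero, zero_smul]), map_one, one_smul]
  (cotangentRelations C).liftQ L <| by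
    refine Submodule.span_le.2 ?_
    rintro _ ⟨n, f, c, rfl⟩
    change L _ = 0
    simp only [map_sub, map_sum, map_smulₛₗ, hL]
    rw [sub_eq_zero, hδ]
    rfl

theorem cotangentLift_d {C D : Type u} [CInfRing C] [CInfRing D] {M : Type u}
    [AddCommGroup M] [Module D M] (φ : CInfRingHom C D) (δ : C → M)
    (hδ : ∀ {n : ℕ} (f : SmoothFun n) (c : Fin n → C),
      δ (op f c) = ∑ i, φ (op (f.pderiv i) c) • δ (c i)) (c : C) :
    cotangentLift φ δ hδ (d c) = δ c := by
  change Finsupp.sum (Finsupp.single c (1 : C)) (fun c r => φ.toRingHom r • δ c) = _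
  rw [Finsupp.sum_single_index (by rw [map_zero, zero_smul]), map_one, one_smul]

end CInfRing

namespace CInfRingedSpace

variable {X Y Z : CInfRingedSpace.{u}}

/-- Sections of the structure sheaf over an open set. -/
abbrev Sec (X : CInfRingedSpace.{u}) (U : Opens X.carrier) : Type u := X.presheaf.obj (op U)

/-- Sections of a sheaf of modules over an open set. -/
abbrev MSec (F : X.Modules) (U : Opens X.carrier) : Type u := F.val.obj (op U)

noncomputable instance (F : X.Modules) (U : Opens X.carrier) : Module (Sec X U) (MSec F U) :=
  inferInstanceAs (Module (X.ringSheaf.obj.obj (op U)) (F.val.obj (op U)))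

/-- Restriction of sections of the structure sheaf. -/
def res {U V : Opens X.carrier} (h : V ≤ U) : CInfRingHom (Sec X U) (Sec X V) :=
  (X.presheaf.map (homOfLE h).op).hom

/-- Restriction of sections of a sheaf of modules. -/
noncomputable def mres {F : X.Modules} {U V : Opens X.carrier} (h : V ≤ U) :
    MSec F U →ₛₗ[(res (X := X) h).toRingHom] MSec F V where
  toFun := F.val.map (homOfLE h).op
  map_add' := map_add (F.val.map (homOfLE h).op).hom
  map_smul' := F.val.map_smul (homOfLE h).op

/-- Pullback of sections of the structure sheaf. -/
def pull (f : X ⟶ Y) (V : Opens Y.carrier) :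
    CInfRingHom (Sec Y V) (Sec X ((Opens.map f.hom.base).obj V)) :=
  (f.hom.c.app (op V)).hom

theorem res_res {U V W : Opens X.carrier} (h : V ≤ U) (h' : W ≤ V) (s : Sec X U) :
    res h' (res h s) = res (h'.trans h) s :=
  (congrArg (fun φ : X.presheaf.obj (op U) ⟶ X.presheaf.obj (op W) => φ.hom s)
    (X.presheaf.map_comp (homOfLE h).op (homOfLE h').op)).symm

theorem res_self {U : Opens X.carrier} (h : U ≤ U) (s : Sec X U) : res h s = s :=
  congrArg (fun φ : X.presheaf.obj (op U) ⟶ X.presheaf.obj (op U) => φ.hom s)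
    (X.presheaf.map_id (op U))

theorem mres_mres {F : X.Modules} {U V W : Opens X.carrier} (h : V ≤ U) (h' : W ≤ V)
    (s : MSec F U) : mres h' (mres h s) = mres (h'.trans h) s :=
  (F.val.map_comp_apply (homOfLE h).op (homOfLE h').op s).symm

theorem mres_self {F : X.Modules} {U : Opens X.carrier} (h : U ≤ U) (s : MSec F U) :
    mres h s = s :=
  congr($(F.val.presheaf.map_id (op U)) s)

theorem pull_res (f : X ⟶ Y) {U V : Opens Y.carrier} (h : V ≤ U) (s : Sec Y U) :
    pull f V (res h s) = res ((Opens.map f.hom.base).monotone h) (pull f U s) :=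
  congrArg (fun φ : Y.presheaf.obj (op U) ⟶ _ => φ.hom s) (f.hom.c.naturality (homOfLE h).op)

/-- The unit of sheafification for the cotangent presheaf. -/
noncomputable def toCotangent (X : CInfRingedSpace.{u}) : X.preCotangent ⟶ X.cotangent.val :=
  (PresheafOfModules.sheafificationAdjunction (𝟙 X.ringSheaf.obj)).unit.app X.preCotangent

/-- Morphisms out of the cotangent sheaf are determined by their restriction to the
cotangent presheaf. -/
noncomputable def cotangentHomEquiv (F : X.Modules) :
    (X.cotangent ⟶ F) ≃ (X.preCotangent ⟶ F.val) :=
  (PresheafOfModules.sheafificationAdjunction (𝟙 X.ringSheaf.obj)).homEquiv X.preCotangent F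

/-- The adjunction between pullback and pushforward. -/
noncomputable def pullbackHomEquiv (f : X ⟶ Y) (E : Y.Modules) (F : X.Modules) :
    ((pullback f).obj E ⟶ F) ≃ (E ⟶ (SheafOfModules.pushforward (ringSheafHom f)).obj F) :=
  (SheafOfModules.pullbackPushforwardAdjunction (ringSheafHom f)).homEquiv E F

theorem pullbackHomEquiv_naturality_left (f : X ⟶ Y) {E E' : Y.Modules} {F : X.Modules}
    (β : E ⟶ E') (α : (pullback f).obj E' ⟶ F) :
    pullbackHomEquiv f E F ((pullback f).map β ≫ α) = β ≫ pullbackHomEquiv f E' F α :=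
  (SheafOfModules.pullbackPushforwardAdjunction (ringSheafHom f)).homEquiv_naturality_left β α

theorem pullbackHomEquiv_naturality_right (f : X ⟶ Y) {E : Y.Modules} {F F' : X.Modules}
    (α : (pullback f).obj E ⟶ F) (β : F ⟶ F') :
    pullbackHomEquiv f E F' (α ≫ β) = pullbackHomEquiv f E F α ≫
      (SheafOfModules.pushforward (ringSheafHom f)).map β :=
  (SheafOfModules.pullbackPushforwardAdjunction (ringSheafHom f)).homEquiv_naturality_right α β

/-- Morphisms out of `f^*(T^*Y)` are determined by the corresponding morphisms of presheaves out
of `𝒫T^*Y`. -/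
noncomputable def preDer (f : X ⟶ Y) (F : X.Modules) :
    ((pullback f).obj Y.cotangent ⟶ F) ≃
      (Y.preCotangent ⟶ (PresheafOfModules.pushforward (ringSheafHom f).hom).obj F.val) :=
  (pullbackHomEquiv f Y.cotangent F).trans (cotangentHomEquiv _)

theorem preDer_apply (f : X ⟶ Y) (F : X.Modules) (α : (pullback f).obj Y.cotangent ⟶ F) :
    preDer f F α = toCotangent Y ≫ (pullbackHomEquiv f Y.cotangent F α).val := rfl

theorem preDer_comp (f : X ⟶ Y) {F G : X.Modules} (α : (pullback f).obj Y.cotangent ⟶ F)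
    (β : F ⟶ G) : preDer f G (α ≫ β) =
      preDer f F α ≫ (PresheafOfModules.pushforward (ringSheafHom f).hom).map β.val := by
  rw [preDer_apply, pullbackHomEquiv_naturality_right]
  rfl

theorem preDer_Omega (f : X ⟶ Y) : preDer f _ (Omega f) = preOmegaAdj f ≫
    (PresheafOfModules.pushforward (ringSheafHom f).hom).map (toCotangent X) := by
  let G := PresheafOfModules.pushforward.{u} (ringSheafHom f).hom
  let P := (PresheafOfModules.pullback (ringSheafHom f).hom).obj Y.preCotangent
  let η : Y.preCotangent ⟶ G.obj P :=
    (PresheafOfModules.pullbackPushforwardAdjunction (ringSheafHom f).hom).unit.app Y.preCotangent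
  let ε : P ⟶ (X.sheafify.obj P).val :=
    (PresheafOfModules.sheafificationAdjunction (𝟙 X.ringSheaf.obj)).unit.app P
  have h1 : preDer f _ ((SheafOfModules.sheafificationCompPullback (ringSheafHom f)).hom.app
      Y.preCotangent) = η ≫ G.map ε := Adjunction.homEquiv_leftAdjointUniq_hom_app
    ((PresheafOfModules.sheafificationAdjunction (𝟙 Y.ringSheaf.obj)).comp
      (SheafOfModules.pullbackPushforwardAdjunction (ringSheafHom f)))
    ((PresheafOfModules.pullbackPushforwardAdjunction (ringSheafHom f).hom).comp
      (PresheafOfModules.sheafificationAdjunction (𝟙 X.ringSheaf.obj))) Y.preCotangent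
  have h2 : preOmega f ≫ toCotangent X = ε ≫ (X.sheafify.map (preOmega f)).val :=
    (PresheafOfModules.sheafificationAdjunction (𝟙 X.ringSheaf.obj)).unit.naturality (preOmega f)
  have h3 : η ≫ G.map (preOmega f) = preOmegaAdj f :=
    ((PresheafOfModules.pullbackPushforwardAdjunction
      (ringSheafHom f).hom).homEquiv_unit _ _ _).symm.trans
      (Equiv.apply_symm_apply ((PresheafOfModules.pullbackPushforwardAdjunction
        (ringSheafHom f).hom).homEquiv _ _) (preOmegaAdj f))
  refine (preDer_comp f _ (X.sheafify.map (preOmega f))).trans ?_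
  refine (congrArg (· ≫ G.map (X.sheafify.map (preOmega f)).val) h1).trans ?_
  refine (Category.assoc η (G.map ε) _).trans ?_
  refine (congrArg (η ≫ ·) ((G.map_comp _ _).symm.trans
    ((congrArg G.map h2.symm).trans (G.map_comp _ _)))).trans ?_
  exact (Category.assoc _ _ _).symm.trans (congrArg (· ≫ G.map (toCotangent X)) h3)

theorem pullbackHomEquiv_pullbackComp (f : X ⟶ Y) (g : Y ⟶ Z) {E : Z.Modules} {F : X.Modules}
    (α : (pullback f).obj ((pullback g).obj E) ⟶ F) :
    pullbackHomEquiv (f ≫ g) E F ((pullbackComp f g).hom.app E ≫ α) =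
      pullbackHomEquiv g E _ (pullbackHomEquiv f _ F α) :=
  (Adjunction.homEquiv_leftAdjointCompIso_inv_app
    (SheafOfModules.pullbackPushforwardAdjunction (ringSheafHom g))
    (SheafOfModules.pullbackPushforwardAdjunction (ringSheafHom f))
    (SheafOfModules.pullbackPushforwardAdjunction (ringSheafHom (f ≫ g)))
    (SheafOfModules.pushforwardComp (ringSheafHom g) (ringSheafHom f)) α).trans
    (Category.comp_id _)

/-- The universal derivation into the cotangent sheaf. -/
noncomputable def dSec {U : Opens X.carrier} (c : Sec X U) : MSec X.cotangent U :=
  (toCotangent X).app (op U) (cotangentModuleCatD c)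

/-- The derivation `c ↦ α (f^* dc)` -/
noncomputable def der (f : X ⟶ Y) {F : X.Modules} (α : (pullback f).obj Y.cotangent ⟶ F)
    (V : Opens Y.carrier) (c : Sec Y V) : MSec F ((Opens.map f.hom.base).obj V) :=
  (preDer f F α).app (op V) (cotangentModuleCatD c)

theorem der_op (f : X ⟶ Y) {F : X.Modules} (α : (pullback f).obj Y.cotangent ⟶ F)
    {V : Opens Y.carrier} {n : ℕ} (h : SmoothFun n) (c : Fin n → Sec Y V) :
    der f α V (CInfRing.op h c) =
      ∑ i, pull f V (CInfRing.op (h.pderiv i) c) • der f α V (c i) := by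
  let L : CInfRing.Cotangent (Sec Y V) →ₛₗ[(pull f V).toRingHom]
      MSec F ((Opens.map f.hom.base).obj V) :=
    { toFun := (preDer f F α).app (op V)
      map_add' := map_add ((preDer f F α).app (op V)).hom
      map_smul' := ((preDer f F α).app (op V)).hom.map_smul }
  change L (CInfRing.d (CInfRing.op h c)) = ∑ i, (pull f V).toRingHom _ • L (CInfRing.d (c i))
  simp only [CInfRing.d_op, map_sum, map_smulₛₗ]

theorem der_res (f : X ⟶ Y) {F : X.Modules} (α : (pullback f).obj Y.cotangent ⟶ F)
    {U V : Opens Y.carrier} (h : V ≤ U) (c : Sec Y U) :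
    der f α V (res h c) = mres ((Opens.map f.hom.base).monotone h) (der f α U c) := by
  have h0 := PresheafOfModules.naturality_apply (preDer f F α) (homOfLE h).op
    (cotangentModuleCatD c)
  refine Eq.trans ?_ h0
  exact congrArg ((preDer f F α).app (op V)).hom
    (cotangentMapModuleCat_d (Y.presheaf.map (homOfLE h).op) c).symm

/-- The morphism of presheaves of modules induced by a derivation. -/
noncomputable def preHomOfDer (f : X ⟶ Y) (F : X.Modules)
    (δ : ∀ V : Opens Y.carrier, Sec Y V → MSec F ((Opens.map f.hom.base).obj V))
    (hδ : ∀ (V : Opens Y.carrier) {n : ℕ} (h : SmoothFun n) (c : Fin n → Sec Y V),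
      δ V (CInfRing.op h c) = ∑ i, pull f V (CInfRing.op (h.pderiv i) c) • δ V (c i))
    (hres : ∀ {U V : Opens Y.carrier} (h : V ≤ U) (c : Sec Y U),
      δ V (res h c) = mres ((Opens.map f.hom.base).monotone h) (δ U c)) :
    Y.preCotangent ⟶ (PresheafOfModules.pushforward (ringSheafHom f).hom).obj F.val where
  app V := ModuleCat.ofHom (X := CInfRing.Cotangent (Sec Y V.unop))
    (Y := (ModuleCat.restrictScalars (CInfRingCat.toRingCat.map (f.hom.c.app V)).hom).obj
      (show ModuleCat.{u} (CInfRingCat.toRingCat.obj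
        (X.presheaf.obj (op ((Opens.map f.hom.base).obj V.unop)))) from F.val.obj _))
    { toFun := CInfRing.cotangentLift (pull f V.unop) (δ V.unop) (hδ V.unop)
      map_add' := map_add _
      map_smul' := (CInfRing.cotangentLift (pull f V.unop) (δ V.unop) (hδ V.unop)).map_smulₛₗ }
  naturality {U V} i := cotangentModuleCat_hom_ext fun c => by
    have h1 := CInfRing.cotangentLift_d (pull f V.unop) (δ V.unop) (hδ V.unop)
      (res i.unop.le c)
    have h2 := CInfRing.cotangentLift_d (pull f U.unop) (δ U.unop) (hδ U.unop) c
    have h3 := hres i.unop.le c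
    refine (congrArg (CInfRing.cotangentLift (pull f V.unop) (δ V.unop) (hδ V.unop))
      (cotangentMapModuleCat_d (Y.presheaf.map i) c)).trans (h1.trans (h3.trans ?_))
    exact congrArg (mres ((Opens.map f.hom.base).monotone i.unop.le)) h2.symm

/-- Derivations induce morphisms out of the pullback of the cotangent sheaf. -/
theorem exists_der_eq (f : X ⟶ Y) (F : X.Modules)
    (δ : ∀ V : Opens Y.carrier, Sec Y V → MSec F ((Opens.map f.hom.base).obj V))
    (hδ : ∀ (V : Opens Y.carrier) {n : ℕ} (h : SmoothFun n) (c : Fin n → Sec Y V),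
      δ V (CInfRing.op h c) = ∑ i, pull f V (CInfRing.op (h.pderiv i) c) • δ V (c i))
    (hres : ∀ {U V : Opens Y.carrier} (h : V ≤ U) (c : Sec Y U),
      δ V (res h c) = mres ((Opens.map f.hom.base).monotone h) (δ U c)) :
    ∃ α : (pullback f).obj Y.cotangent ⟶ F, ∀ V c, der f α V c = δ V c := by
  refine ⟨(preDer f F).symm (preHomOfDer f F δ hδ hres), fun V c => ?_⟩
  unfold der
  rw [Equiv.apply_symm_apply]
  exact CInfRing.cotangentLift_d (pull f V) (δ V) (hδ V) c

theorem der_comp (f : X ⟶ Y) {F G : X.Modules} (α : (pullback f).obj Y.cotangent ⟶ F)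
    (β : F ⟶ G) (V : Opens Y.carrier) (c : Sec Y V) :
    der f (α ≫ β) V c = β.val.app (op ((Opens.map f.hom.base).obj V)) (der f α V c) := by
  unfold der
  rw [preDer_comp]
  rfl

theorem der_Omega (f : X ⟶ Y) (V : Opens Y.carrier) (c : Sec Y V) :
    der f (Omega f) V c = dSec (pull f V c) := by
  unfold der
  rw [preDer_Omega]
  exact congrArg ((toCotangent X).app (op ((Opens.map f.hom.base).obj V)))
    (cotangentMapModuleCat_d (f.hom.c.app (op V)) c)

theorem der_injective (f : X ⟶ Y) {F : X.Modules} {α β : (pullback f).obj Y.cotangent ⟶ F}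
    (h : ∀ V c, der f α V c = der f β V c) : α = β := by
  apply (preDer f F).injective
  apply PresheafOfModules.hom_ext
  intro V
  exact cotangentModuleCat_hom_ext fun c => h V.unop c

theorem der_pullbackComp (f : X ⟶ Y) (g : Y ⟶ Z) {F : X.Modules}
    (α : (pullback f).obj Y.cotangent ⟶ F) (V : Opens Z.carrier) (c : Sec Z V) :
    der (f ≫ g) ((pullbackComp f g).hom.app Z.cotangent ≫ (pullback f).map (Omega g) ≫ α) V c =
      der f α ((Opens.map g.hom.base).obj V) (pull g V c) := by
  have h : preDer (f ≫ g) F ((pullbackComp f g).hom.app Z.cotangent ≫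
      (pullback f).map (Omega g) ≫ α) = preDer g _ (Omega g ≫ pullbackHomEquiv f _ F α) := by
    rw [preDer_apply, pullbackHomEquiv_pullbackComp, pullbackHomEquiv_naturality_left]
    rfl
  unfold der
  rw [h]
  refine (der_comp g (Omega g) _ V c).trans ?_
  rw [der_Omega]
  rfl

theorem Omega_comp (f : X ⟶ Y) (g : Y ⟶ Z) : Omega (f ≫ g) =
    (pullbackComp f g).hom.app Z.cotangent ≫ (pullback f).map (Omega g) ≫ Omega f := by
  refine der_injective _ fun V c => ?_
  rw [der_pullbackComp, der_Omega, der_Omega]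
  rfl

end CInfRingedSpace

namespace SmoothFun

/-- The sum of a finite family of smooth functions. -/
def sum {n : ℕ} {ι : Type*} (s : Finset ι) (f : ι → SmoothFun n) : SmoothFun n :=
  ⟨fun x => ∑ i ∈ s, (f i).toFun x, ContDiff.sum fun i _ => (f i).smooth⟩

theorem pderiv_comp {m n : ℕ} (g : SmoothFun m) (f : Fin m → SmoothFun n) (i : Fin n)
    (x : Fin n → ℝ) : ((g.comp f).pderiv i).toFun x =
      ∑ j, (g.pderiv j).toFun (fun k => (f k).toFun x) * ((f j).pderiv i).toFun x := by
  have hf : ∀ k, DifferentiableAt ℝ (f k).toFun x := fun k =>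
    ((f k).smooth.differentiable (by simp)).differentiableAt
  have hF : DifferentiableAt ℝ (fun y => fun k => (f k).toFun y) x := differentiableAt_pi.2 hf
  have hg : DifferentiableAt ℝ g.toFun (fun k => (f k).toFun x) :=
    (g.smooth.differentiable (by simp)).differentiableAt
  change fderiv ℝ (g.toFun ∘ fun y => fun k => (f k).toFun y) x (Pi.single i 1) = _
  rw [fderiv_comp x hg hF, fderiv_pi hf]
  change (fderiv ℝ g.toFun fun k => (f k).toFun x).toLinearMap _ = _
  rw [LinearMap.pi_apply_eq_sum_univ]
  refine Finset.sum_congr rfl fun j _ => ?_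
  refine (mul_comm _ _).trans (congrArg₂ (· * ·)
    (congrArg (fderiv ℝ g.toFun fun k => (f k).toFun x) (funext fun k => ?_)) rfl)
  simp [Pi.single_apply, eq_comm]

theorem pderiv_proj {n : ℕ} (i j : Fin n) (x : Fin n → ℝ) :
    ((proj j).pderiv i).toFun x = if i = j then 1 else 0 := by
  change fderiv ℝ (fun y : Fin n → ℝ => y j) x (Pi.single i 1) = _
  rw [show (fun y : Fin n → ℝ => y j) = ContinuousLinearMap.proj (R := ℝ) (φ := fun _ => ℝ) j
    from rfl, ContinuousLinearMap.fderiv]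
  simp [Pi.single_apply, eq_comm]

theorem pderiv_add (i : Fin 2) (x : Fin 2 → ℝ) : (add.pderiv i).toFun x = 1 := by
  change fderiv ℝ (fun y : Fin 2 → ℝ => y 0 + y 1) x (Pi.single i 1) = _
  rw [show (fun y : Fin 2 → ℝ => y 0 + y 1) = ⇑(ContinuousLinearMap.proj (R := ℝ)
    (φ := fun _ => ℝ) (0 : Fin 2) + ContinuousLinearMap.proj (R := ℝ)
    (φ := fun _ => ℝ) (1 : Fin 2)) from rfl, ContinuousLinearMap.fderiv]
  fin_cases i <;> simp [Pi.single_apply]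

theorem pderiv_mul_zero (x : Fin 2 → ℝ) : (mul.pderiv 0).toFun x = x 1 := by
  change fderiv ℝ (fun y : Fin 2 → ℝ => y 0 * y 1) x (Pi.single 0 1) = _
  rw [fderiv_fun_mul (by fun_prop) (by fun_prop)]
  have h := fun j : Fin 2 => pderiv_proj 0 j x
  change ∀ j, fderiv ℝ (fun y : Fin 2 → ℝ => y j) x (Pi.single 0 1) = _ at h
  simp [h]

theorem pderiv_mul_one (x : Fin 2 → ℝ) : (mul.pderiv 1).toFun x = x 0 := by
  change fderiv ℝ (fun y : Fin 2 → ℝ => y 0 * y 1) x (Pi.single 1 1) = _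
  rw [fderiv_fun_mul (by fun_prop) (by fun_prop)]
  have h := fun j : Fin 2 => pderiv_proj 1 j x
  change ∀ j, fderiv ℝ (fun y : Fin 2 → ℝ => y j) x (Pi.single 1 1) = _ at h
  simp [h]

end SmoothFun

namespace CInfRing

section

variable {C : Type u} [CInfRing C]

theorem op_zero {n : ℕ} (v : Fin n → C) : op (SmoothFun.const 0) v = 0 := op_const 0 v

theorem op_one {n : ℕ} (v : Fin n → C) : op (SmoothFun.const 1) v = 1 := op_const 1 v

theorem op_eq_sum {n : ℕ} {ι : Type*} (s : Finset ι) (f : ι → SmoothFun n) {h : SmoothFun n}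
    (hh : ∀ x, h.toFun x = ∑ i ∈ s, (f i).toFun x) (v : Fin n → C) :
    op h v = ∑ i ∈ s, op (f i) v := by
  classical
  rw [op_eq_op (g := SmoothFun.sum s f) v hh]
  clear hh
  induction s using Finset.induction_on with
  | empty => exact (op_eq_op v fun x => by simp [SmoothFun.sum, SmoothFun.const]).trans (op_zero v)
  | insert a s ha ih =>
    rw [Finset.sum_insert ha, ← ih, op_add_op]
    exact op_eq_op v fun x => by simp [SmoothFun.sum, SmoothFun.comp, SmoothFun.add, ha]

end

/-! ### Square-zero extensions -/

/-- The square-zero extension `C ⊕ M` of a `C^∞`-ring `C` by a `C`-module `M`. -/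
@[ext]
structure SqZero (C M : Type u) where
  fst : C
  snd : M

namespace SqZero

variable {C M : Type u} [CInfRing C] [AddCommGroup M] [Module C M]

noncomputable instance : CInfRing (SqZero C M) where
  op f v := ⟨op f fun i => (v i).fst, ∑ i, op (f.pderiv i) (fun i => (v i).fst) • (v i).snd⟩
  op_comp {m n} g f v := by
    refine SqZero.ext (op_comp _ _ _) ?_
    dsimp only
    simp only [Finset.smul_sum, smul_smul]
    rw [Finset.sum_comm]
    refine Finset.sum_congr rfl fun i _ => ?_
    rw [← Finset.sum_smul]
    congr 1
    rw [op_eq_sum Finset.univ (fun j => SmoothFun.mul.comp ![(g.pderiv j).comp f, (f j).pderiv i])]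
    · refine Finset.sum_congr rfl fun j _ => ?_
      rw [← op_mul_op, op_comp]
    · intro x
      rw [SmoothFun.pderiv_comp]
      rfl
  op_proj {n} j v := by
    refine SqZero.ext (op_proj _ _) ?_
    dsimp only
    rw [Finset.sum_eq_single j]
    · rw [op_eq_op (g := SmoothFun.const 1) _ (fun x => by
        rw [SmoothFun.pderiv_proj, if_pos rfl]; rfl), op_one, one_smul]
    · intro i _ hi
      rw [op_eq_op (g := SmoothFun.const 0) _ (fun x => by
        rw [SmoothFun.pderiv_proj, if_neg hi]; rfl), op_zero, zero_smul]
    · exact fun h => absurd (Finset.mem_univ j) h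

theorem op_snd {n : ℕ} (f : SmoothFun n) (v : Fin n → SqZero C M) :
    (op f v).snd = ∑ i, op (f.pderiv i) (fun i => (v i).fst) • (v i).snd := rfl

/-- The projection `C ⊕ M → C`. -/
noncomputable def fstHom : CInfRingHom (SqZero C M) C := ⟨fst, fun _ _ => rfl⟩

/-- The inclusion `C → C ⊕ M`. -/
noncomputable def inl : CInfRingHom C (SqZero C M) :=
  ⟨fun c => ⟨c, 0⟩, fun f c => SqZero.ext rfl (by simp [op_snd])⟩

/-- The inclusion `M → C ⊕ M`. -/
noncomputable def inr (m : M) : SqZero C M := ⟨0, m⟩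

@[simp] theorem fst_add (a b : SqZero C M) : (a + b).fst = a.fst + b.fst :=
  map_add (fstHom (C := C) (M := M)).toRingHom a b

@[simp] theorem fst_mul (a b : SqZero C M) : (a * b).fst = a.fst * b.fst :=
  map_mul (fstHom (C := C) (M := M)).toRingHom a b

@[simp] theorem fst_zero : (0 : SqZero C M).fst = 0 := map_zero (fstHom (C := C) (M := M)).toRingHom

@[simp] theorem fst_one : (1 : SqZero C M).fst = 1 := map_one (fstHom (C := C) (M := M)).toRingHom

@[simp] theorem snd_zero : (0 : SqZero C M).snd = 0 := by
  rw [zero_def, op_snd]; simp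

@[simp] theorem snd_one : (1 : SqZero C M).snd = 0 := by
  rw [one_def, op_snd]; simp

@[simp] theorem snd_add (a b : SqZero C M) : (a + b).snd = a.snd + b.snd := by
  rw [add_def, op_snd, Fin.sum_univ_two]
  rw [op_eq_op (f := SmoothFun.add.pderiv 0) (g := SmoothFun.const 1) _ (SmoothFun.pderiv_add 0),
    op_eq_op (f := SmoothFun.add.pderiv 1) (g := SmoothFun.const 1) _ (SmoothFun.pderiv_add 1)]
  simp [op_one]

@[simp] theorem snd_mul (a b : SqZero C M) :
    (a * b).snd = b.fst • a.snd + a.fst • b.snd := by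
  rw [mul_def, op_snd, Fin.sum_univ_two]
  rw [op_eq_op (f := SmoothFun.mul.pderiv 0) (g := SmoothFun.proj 1) _ SmoothFun.pderiv_mul_zero,
    op_eq_op (f := SmoothFun.mul.pderiv 1) (g := SmoothFun.proj 0) _ SmoothFun.pderiv_mul_one]
  simp [op_proj]

theorem inr_mul_inr (m m' : M) : (inr m * inr m' : SqZero C M) = 0 := by
  ext <;> simp [inr]

/-- The projection `C ⊕ M → M`. -/
noncomputable def sndHom : SqZero C M →+ M := ⟨⟨snd, snd_zero⟩, snd_add⟩

theorem exists_mul_eq_one {a : SqZero C M} {t : C} (h : a.fst * t = 1) :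
    ∃ b, a * b = 1 := by
  refine ⟨⟨t, -((t * t) • a.snd)⟩, SqZero.ext ?_ ?_⟩
  · rw [fst_mul, fst_one]
    exact h
  · rw [snd_mul, snd_one]
    dsimp only
    rw [smul_neg, smul_smul, ← mul_assoc, h, one_mul, add_neg_cancel]

/-- The map of square-zero extensions induced by a semilinear map. -/
noncomputable def map {D N : Type u} [CInfRing D] [AddCommGroup N] [Module D N]
    (φ : CInfRingHom C D)
    (ψ : M →ₛₗ[φ.toRingHom] N) : CInfRingHom (SqZero C M) (SqZero D N) where
  toFun a := ⟨φ a.fst, ψ a.snd⟩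
  map_op f c := by
    refine SqZero.ext (φ.map_op f _) ?_
    dsimp only
    rw [op_snd, op_snd, map_sum]
    refine Finset.sum_congr rfl fun i _ => ?_
    rw [map_smulₛₗ]
    congr 1
    exact φ.map_op _ _

end SqZero

/-! ### Points and germs -/

section Germ

variable {C : Type u} [CInfRing C]

namespace RPoint

theorem ext' {p q : RPoint C} (h : ∀ c, p c = q c) : p = q := by
  cases p; cases q; congr; exact funext h

theorem map_zero (p : RPoint C) : p 0 = 0 := by rw [zero_def, p.map_op]; rfl

theorem map_one (p : RPoint C) : p 1 = 1 := by rw [one_def, p.map_op]; rfl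

theorem map_add (p : RPoint C) (a b : C) : p (a + b) = p a + p b := by
  rw [add_def, p.map_op]; rfl

theorem map_mul (p : RPoint C) (a b : C) : p (a * b) = p a * p b := by
  rw [mul_def, p.map_op]; rfl

/-- The composite of a morphism with an `ℝ`-point. -/
def comp {D : Type u} [CInfRing D] (p : RPoint D) (φ : CInfRingHom C D) : RPoint C :=
  ⟨fun c => p (φ c), fun f c => by rw [φ.map_op', p.map_op]⟩

end RPoint

theorem op_fin_one (f : SmoothFun 1) (p : RPoint C) (c : C) :
    p (op f ![c]) = f.toFun ![p c] := by
  rw [p.map_op]; congr 1; funext i; fin_cases i; rfl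

theorem exists_smooth_inverse {t₀ : ℝ} (h₀ : t₀ ≠ 0) : ∃ χ r : ℝ → ℝ, ContDiff ℝ ∞ χ ∧
    ContDiff ℝ ∞ r ∧ χ t₀ ≠ 0 ∧ ∀ t, χ t * (t * r t) = χ t ∧ (χ t ≠ 0 → t * r t = 1) := by
  have ha : 0 < |t₀| := abs_pos.2 h₀
  let χ : ContDiffBump t₀ := ⟨|t₀| / 4, |t₀| / 2, by positivity, by linarith⟩
  let χ' : ContDiffBump t₀ := ⟨|t₀| / 8, |t₀| / 4, by positivity, by linarith⟩
  have hpos : ∀ t : ℝ, t ^ 2 + 1 - χ t ≠ 0 := by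
    intro t
    have h1 : χ t ≤ 1 := χ.le_one
    rcases eq_or_ne t 0 with rfl | ht
    · have : χ 0 = 0 := χ.zero_of_le_dist (by
        change |t₀| / 2 ≤ dist 0 t₀
        rw [dist_comm, Real.dist_eq, sub_zero]; linarith)
      rw [this]; norm_num
    · have : 0 < t ^ 2 := by positivity
      exact ne_of_gt (by linarith)
  have key : ∀ t, χ' t ≠ 0 → t * (t / (t ^ 2 + 1 - χ t)) = 1 := by
    intro t h
    have ht : dist t t₀ < |t₀| / 4 := by
      by_contra ht
      exact h (χ'.zero_of_le_dist (not_lt.1 ht))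
    have h1 : χ t = 1 := χ.one_of_mem_closedBall (by
      rw [Metric.mem_closedBall]; exact ht.le)
    have h2 : t ≠ 0 := by
      rintro rfl
      rw [dist_comm, Real.dist_eq, sub_zero] at ht; linarith
    rw [h1]; field_simp; ring_nf
  refine ⟨fun t => χ' t, fun t => t / (t ^ 2 + 1 - χ t), χ'.contDiff,
    contDiff_id.div (((contDiff_id.pow 2).add contDiff_const).sub χ.contDiff) hpos,
    (χ'.pos_of_mem_ball (Metric.mem_ball_self (by positivity))).ne', fun t => ⟨?_, key t⟩⟩
  by_cases h : χ' t = 0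
  · simp [h]
  · dsimp only; rw [key t h, mul_one]

theorem exists_inverse_germ (p : RPoint C) {s : C} (hs : p s ≠ 0) :
    ∃ e b : C, p b ≠ 0 ∧ b * (s * e) = b := by
  obtain ⟨χ, r, hχ, hr, h0, h⟩ := exists_smooth_inverse hs
  refine ⟨op (SmoothFun.ofReal r hr) ![s], op (SmoothFun.ofReal χ hχ) ![s], ?_, ?_⟩
  · rw [op_fin_one]; exact h0
  · obtain ⟨v, hv⟩ : ∃ v : Fin 1 → C, v = ![s] := ⟨_, rfl⟩
    have hs' : s = op (SmoothFun.proj 0) v := by rw [op_proj, hv]; rfl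
    rw [← hv]
    conv_lhs => enter [2, 1]; rw [hs']
    rw [op_mul_op, op_mul_op]
    exact op_eq_op _ fun x => (h (x 0)).1

/-- Two elements have the same germ at `p`. -/
def GermEq (p : RPoint C) (c c' : C) : Prop := ∃ b : C, p b ≠ 0 ∧ b * c = b * c'

theorem GermEq.refl (p : RPoint C) (c : C) : GermEq p c c := ⟨1, by simp [p.map_one], rfl⟩

theorem GermEq.symm {p : RPoint C} {c c' : C} : GermEq p c c' → GermEq p c' c :=
  fun ⟨b, hb, h⟩ => ⟨b, hb, h.symm⟩

theorem GermEq.trans {p : RPoint C} {c c' c'' : C} :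
    GermEq p c c' → GermEq p c' c'' → GermEq p c c'' := fun ⟨b, hb, h⟩ ⟨b', hb', h'⟩ =>
  ⟨b * b', by rw [p.map_mul]; exact mul_ne_zero hb hb', by
    rw [mul_right_comm, h, mul_right_comm, mul_assoc, h', mul_assoc]⟩

theorem GermEq.op {p : RPoint C} {n : ℕ} (f : SmoothFun n) {c c' : Fin n → C}
    (h : ∀ i, GermEq p (c i) (c' i)) : GermEq p (op f c) (op f c') := by
  choose b hb hbc using h
  obtain ⟨t, ht, htc⟩ : ∃ t : C, p t ≠ 0 ∧ ∀ i, t * c i = t * c' i := by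
    refine ⟨∏ i, b i, ?_, fun i => ?_⟩
    · let P : C →+* ℝ := { toFun := p, map_one' := p.map_one, map_zero' := p.map_zero,
                           map_add' := p.map_add, map_mul' := p.map_mul }
      change P _ ≠ 0
      rw [map_prod]
      exact Finset.prod_ne_zero_iff.2 fun i _ => hb i
    · rw [← Finset.mul_prod_erase _ _ (Finset.mem_univ i), mul_right_comm, hbc, mul_right_comm]
  obtain ⟨χ, r, hχ, hr, h0, h⟩ := exists_smooth_inverse ht
  let u : C := CInfRing.op (SmoothFun.ofReal χ hχ) ![t]
  let e : C := CInfRing.op (SmoothFun.ofReal r hr) ![t]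
  have key : ∀ c : Fin n → C, u * CInfRing.op f c = u * CInfRing.op f fun i => e * (t * c i) := by
    intro c
    let v : Fin (n + 1) → C := Fin.cons t c
    have hc : ∀ i, c i = CInfRing.op (SmoothFun.proj i.succ) v := fun i => by rw [op_proj]; rfl
    have ht : t = CInfRing.op (SmoothFun.proj 0) v := by rw [op_proj]; rfl
    have hu : u = CInfRing.op ((SmoothFun.ofReal χ hχ).comp ![SmoothFun.proj 0]) v := by
      rw [op_comp]; refine congrArg (CInfRing.op _) (funext fun i => ?_); fin_cases i; exact ht
    have he : e = CInfRing.op ((SmoothFun.ofReal r hr).comp ![SmoothFun.proj 0]) v := by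
      rw [op_comp]; refine congrArg (CInfRing.op _) (funext fun i => ?_); fin_cases i; exact ht
    rw [hu, he]
    conv_lhs => enter [2, 2, i]; rw [hc i]
    conv_rhs => enter [2, 2, i]; rw [hc i, ht, op_mul_op, op_mul_op]
    rw [← op_comp, ← op_comp, op_mul_op, op_mul_op]
    refine op_eq_op _ fun x => ?_
    change χ (x 0) * f.toFun (fun i => x i.succ) =
      χ (x 0) * f.toFun fun i => r (x 0) * (x 0 * x i.succ)
    by_cases hx : χ (x 0) = 0
    · rw [hx, zero_mul, zero_mul]
    · congr 2
      funext i
      rw [← mul_assoc, mul_comm (r _), (h _).2 hx, one_mul]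
  refine ⟨u, ?_, ?_⟩
  · rw [op_fin_one]; exact h0
  · rw [key c, key c']
    simp only [htc]

/-- A representative in `C` of a formal expression in `C_p`. -/
noncomputable def LocTerm.rep (p : RPoint C) : LocTerm C {s : C | p s ≠ 0} → C
  | .of c => c
  | .inv s => (exists_inverse_germ p s.2).choose
  | .op f a => CInfRing.op f fun i => (a i).rep p

theorem LocRel.germEq {p : RPoint C} {a b : LocTerm C {s : C | p s ≠ 0}}
    (h : LocRel {s : C | p s ≠ 0} a b) : GermEq p (a.rep p) (b.rep p) := by
  induction h with
  | refl a => exact GermEq.refl _ _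
  | symm _ ih => exact ih.symm
  | trans _ _ ih ih' => exact ih.trans ih'
  | congr f a b _ ih => exact GermEq.op f ih
  | op_comp g f a =>
    simp only [LocTerm.rep, CInfRing.op_comp]; exact GermEq.refl _ _
  | op_proj i a =>
    simp only [LocTerm.rep, CInfRing.op_proj]; exact GermEq.refl _ _
  | of_op f c =>
    simp only [LocTerm.rep]; exact GermEq.refl _ _
  | mul_inv s =>
    obtain ⟨b, hb, h⟩ := (exists_inverse_germ p s.2).choose_spec
    refine ⟨b, hb, ?_⟩
    have h1 : LocTerm.rep p (.op (SmoothFun.const 1) ![]) = 1 := op_one _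
    have h2 : LocTerm.rep p (.op SmoothFun.mul ![.of s.1, .inv s]) =
        s.1 * (exists_inverse_germ p s.2).choose := by
      rw [mul_def, LocTerm.rep]; congr 1; funext i; fin_cases i <;> simp [LocTerm.rep]
    rw [h1, h2, mul_one]
    exact h

theorem germEq_of_toLocalAt_eq {p : RPoint C} {c c' : C} (h : toLocalAt p c = toLocalAt p c') :
    GermEq p c c' := by
  simpa [LocTerm.rep] using LocRel.germEq (Quotient.exact h)

theorem toLocalAt_eq_iff {p : RPoint C} {c c' : C} :
    toLocalAt p c = toLocalAt p c' ↔ GermEq p c c' := by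
  refine ⟨germEq_of_toLocalAt_eq, fun ⟨b, hb, h⟩ => ?_⟩
  have hu : IsUnit ((toLocalAt p).toRingHom b) := Loc.isUnit_of hb
  have h1 := congrArg (toLocalAt p).toRingHom h
  rw [map_mul, map_mul] at h1
  exact hu.mul_left_cancel h1

theorem Loc.mk_eq_toLocalAt_rep (p : RPoint C) (a : LocTerm C {s : C | p s ≠ 0}) :
    Loc.mk _ a = toLocalAt p (a.rep p) := by
  induction a with
  | of c => simp only [LocTerm.rep]; rfl
  | inv s =>
    obtain ⟨b, hb, h⟩ := (exists_inverse_germ p s.2).choose_spec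
    have hs : IsUnit ((toLocalAt p).toRingHom s.1) := Loc.isUnit_of s.2
    refine hs.mul_left_cancel ?_
    simp only [LocTerm.rep]
    refine Eq.trans (b := 1) ?_ ?_
    · have h := Loc.mk_eq (LocRel.mul_inv (C := C) (S := {s : C | p s ≠ 0}) s)
      rw [← Loc.op_mk, ← Loc.op_mk] at h
      rw [mul_def, one_def]
      convert h using 1
      · change Loc.op _ _ = _
        congr 1; funext i; fin_cases i <;> rfl
      · change Loc.op _ _ = _
        congr 1; funext i; exact i.elim0
    · refine Eq.trans ?_ (map_mul (toLocalAt p).toRingHom _ _)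
      refine (map_one (toLocalAt p).toRingHom).symm.trans ?_
      exact (toLocalAt_eq_iff.2 ⟨b, hb, by rw [h, mul_one]⟩).symm
  | op f a ih =>
    rw [← Loc.op_mk]
    simp only [ih, LocTerm.rep]
    exact ((toLocalAt p).map_op f _).symm

theorem toLocalAt_surjective (p : RPoint C) : Function.Surjective (toLocalAt p) := by
  intro x
  obtain ⟨a, rfl⟩ := Quotient.exists_rep x
  exact ⟨_, (Loc.mk_eq_toLocalAt_rep p a).symm⟩

theorem GermEq.apply_eq {p : RPoint C} {c c' : C} (h : GermEq p c c') : p c = p c' := by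
  obtain ⟨b, hb, h⟩ := h
  have := congrArg p.toFun h
  change p (b * c) = p (b * c') at this
  rw [p.map_mul, p.map_mul] at this
  exact mul_left_cancel₀ hb this

/-- The `ℝ`-point of `C_p` induced by `p`. -/
noncomputable def localPoint (p : RPoint C) : RPoint (LocalAt p) where
  toFun x := p (toLocalAt_surjective p x).choose
  map_op f x := by
    rw [← p.map_op]
    refine (germEq_of_toLocalAt_eq ?_).apply_eq
    rw [(toLocalAt_surjective p _).choose_spec, CInfRingHom.map_op']
    congr 1
    funext i
    exact (toLocalAt_surjective p (x i)).choose_spec.symm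

theorem localPoint_toLocalAt (p : RPoint C) (c : C) : localPoint p (toLocalAt p c) = p c :=
  (germEq_of_toLocalAt_eq (toLocalAt_surjective p _).choose_spec).apply_eq

/-- The filter at `p` generated by the sublevel sets of nonnegative functions vanishing at `p`. -/
def sublevelFilter (p : RPoint C) : Filter (RPoint C) where
  sets := {U | ∃ (g : C) (ε : ℝ), 0 < ε ∧ p g = 0 ∧ (∀ q : RPoint C, 0 ≤ q g) ∧
    ∀ q : RPoint C, q g < ε → q ∈ U}
  univ_sets := ⟨0, 1, one_pos, p.map_zero, fun q => q.map_zero.ge, fun _ _ => trivial⟩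
  sets_of_superset := fun ⟨g, ε, hε, h0, hn, h⟩ hU => ⟨g, ε, hε, h0, hn, fun q hq => hU (h q hq)⟩
  inter_sets := fun ⟨g, ε, hε, h0, hn, h⟩ ⟨g', ε', hε', h0', hn', h'⟩ =>
    ⟨g + g', min ε ε', lt_min hε hε', by rw [p.map_add, h0, h0', add_zero],
      fun q => by rw [q.map_add]; exact add_nonneg (hn q) (hn' q), fun q hq => by
        rw [q.map_add] at hq
        exact ⟨h q (by linarith [hn' q, min_le_left ε ε']),
          h' q (by linarith [hn q, min_le_right ε ε'])⟩⟩

theorem sublevelFilter_le_nhds (p : RPoint C) : sublevelFilter p ≤ nhds p := by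
  rw [nhds_iInf, le_iInf_iff]
  intro c
  rw [nhds_induced, ← Filter.tendsto_iff_comap, Metric.tendsto_nhds]
  intro ε hε
  refine ⟨op (SmoothFun.ofReal (fun t => (t - p c) ^ 2)
    ((contDiff_id.sub contDiff_const).pow 2)) ![c], ε ^ 2, by positivity, ?_, fun q => ?_,
    fun q hq => ?_⟩
  · rw [op_fin_one]; simp [SmoothFun.ofReal]
  · rw [op_fin_one]; exact sq_nonneg _
  · rw [op_fin_one] at hq
    change dist (q c) (p c) < ε
    rw [Real.dist_eq]
    exact abs_lt_of_sq_lt_sq hq hε.le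

theorem exists_sublevel {p : RPoint C} {U : Set (RPoint C)} (hU : IsOpen U) (hp : p ∈ U) :
    ∃ (g : C) (ε : ℝ), 0 < ε ∧ p g = 0 ∧ ∀ q : RPoint C, q g < ε → q ∈ U :=
  let ⟨g, ε, hε, h0, _, h⟩ := sublevelFilter_le_nhds p (hU.mem_nhds hp)
  ⟨g, ε, hε, h0, h⟩

/-- Bump functions on the spectrum of a `C^∞`-ring. -/
theorem exists_bump {p : RPoint C} {U : Set (RPoint C)} (hU : IsOpen U) (hp : p ∈ U) :
    ∃ b : C, p b ≠ 0 ∧ ∀ q : RPoint C, q ∉ U → ∃ e : C, q e ≠ 0 ∧ e * b = 0 := by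
  obtain ⟨g, ε, hε, h0, h⟩ := exists_sublevel hU hp
  let χ : ContDiffBump (0 : ℝ) := ⟨ε / 4, ε / 2, by positivity, by linarith⟩
  let χ' : ContDiffBump (0 : ℝ) := ⟨ε / 2, ε, by positivity, by linarith⟩
  refine ⟨op (SmoothFun.ofReal (fun t => χ t) χ.contDiff) ![g], ?_, fun q hq =>
    ⟨op (SmoothFun.ofReal (fun t => 1 - χ' t) (contDiff_const.sub χ'.contDiff)) ![g], ?_, ?_⟩⟩
  · rw [op_fin_one]
    change χ (p g) ≠ 0
    rw [h0]
    exact (χ.pos_of_mem_ball (Metric.mem_ball_self (by positivity))).ne'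
  · rw [op_fin_one]
    change 1 - χ' (q g) ≠ 0
    rw [χ'.zero_of_le_dist]
    · norm_num
    · rw [Real.dist_eq, sub_zero]
      exact (not_lt.1 fun hlt => hq (h q hlt)).trans (le_abs_self _)
  · rw [op_mul_op, ← op_zero ![g]]
    refine op_eq_op _ fun x => ?_
    change (1 - χ' (x 0)) * χ (x 0) = 0
    by_cases hx : dist (x 0) 0 < ε / 2
    · rw [χ'.one_of_mem_closedBall (by rw [Metric.mem_closedBall]; exact hx.le), sub_self,
        zero_mul]
    · rw [χ.zero_of_le_dist (not_lt.1 hx), mul_zero]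

/-- Nonvanishing loci form a basis of the topology of the spectrum. -/
theorem exists_basic {p : RPoint C} {U : Set (RPoint C)} (hU : IsOpen U) (hp : p ∈ U) :
    ∃ b : C, p b ≠ 0 ∧ ∀ q : RPoint C, q b ≠ 0 → q ∈ U := by
  obtain ⟨b, hb, h⟩ := exists_bump hU hp
  refine ⟨b, hb, fun q hq => ?_⟩
  by_contra hqU
  obtain ⟨e, he, heb⟩ := h q hqU
  have := q.map_mul e b
  rw [heb, q.map_zero] at this
  exact mul_ne_zero he hq this.symm

end Germ

end CInfRing

namespace CInfRingedSpace

variable {W X Y Z : CInfRingedSpace.{u}}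

/-! ### Gluing -/

theorem sec_ext {U : Opens X.carrier} {s t : Sec X U}
    (h : ∀ x ∈ U, ∃ (V : Opens X.carrier) (hV : V ≤ U), x ∈ V ∧ res hV s = res hV t) : s = t := by
  choose V hV hx hst using fun x : U => h x.1 x.2
  exact TopCat.Sheaf.eq_of_locally_eq' ⟨X.presheaf ⋙ forget CInfRingCat, X.isSheaf⟩ V U
    (fun x => homOfLE (hV x)) (fun x hx' => Opens.mem_iSup.2 ⟨⟨x, hx'⟩, hx _⟩) s t hst

theorem sec_glue {ι : Type u} {U : Opens X.carrier} (V : ι → Opens X.carrier) (hV : ∀ i, V i ≤ U)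
    (hU : ∀ x ∈ U, ∃ i, x ∈ V i) (s : ∀ i, Sec X (V i))
    (hs : ∀ i j, res (inf_le_left : V i ⊓ V j ≤ V i) (s i) = res inf_le_right (s j)) :
    ∃ t : Sec X U, ∀ i, res (hV i) t = s i :=
  (TopCat.Sheaf.existsUnique_gluing' ⟨X.presheaf ⋙ forget CInfRingCat, X.isSheaf⟩ V U
    (fun i => homOfLE (hV i)) (fun x hx => Opens.mem_iSup.2 (hU x hx))
    (show ∀ i, ToType ((X.presheaf ⋙ forget CInfRingCat).obj (op (V i))) from s) hs).exists

theorem msec_ext {F : X.Modules} {U : Opens X.carrier} {s t : MSec F U}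
    (h : ∀ x ∈ U, ∃ (V : Opens X.carrier) (hV : V ≤ U), x ∈ V ∧ mres hV s = mres hV t) :
    s = t := by
  choose V hV hx hst using fun x : U => h x.1 x.2
  exact TopCat.Sheaf.eq_of_locally_eq' (C := AddCommGrpCat.{u}) ⟨F.val.presheaf, F.isSheaf⟩ V U
    (fun x => homOfLE (hV x)) (fun x hx' => Opens.mem_iSup.2 ⟨⟨x, hx'⟩, hx _⟩) s t hst

theorem msec_glue {F : X.Modules} {ι : Type u} {U : Opens X.carrier} (V : ι → Opens X.carrier)
    (hV : ∀ i, V i ≤ U) (hU : ∀ x ∈ U, ∃ i, x ∈ V i) (s : ∀ i, MSec F (V i))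
    (hs : ∀ i j, mres (inf_le_left : V i ⊓ V j ≤ V i) (s i) = mres inf_le_right (s j)) :
    ∃ t : MSec F U, ∀ i, mres (hV i) t = s i :=
  (TopCat.Sheaf.existsUnique_gluing' (C := AddCommGrpCat.{u}) ⟨F.val.presheaf, F.isSheaf⟩ V U
    (fun i => homOfLE (hV i)) (fun x hx => Opens.mem_iSup.2 (hU x hx))
    (show ∀ i, ToType (F.val.presheaf.obj (op (V i))) from s) hs).exists

theorem hom_ext' {f g : X ⟶ Y} (h : f.hom.base = g.hom.base)
    (h' : ∀ (V : Opens Y.carrier) (c : Sec Y V),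
      pull f V c = res (by rw [h]) (pull g V c)) : f = g := by
  rcases f with ⟨⟨fb, fc⟩⟩
  rcases g with ⟨⟨gb, gc⟩⟩
  dsimp at h
  subst h
  congr
  refine NatTrans.ext (funext fun V => ?_)
  refine CInfRingCat.Hom.ext (CInfRingHom.ext fun c => ?_)
  exact (h' V.unop c).trans (res_self _ _)

theorem pull_congr {f g : X ⟶ Y} (h : f = g) (V : Opens Y.carrier) (c : Sec Y V) :
    pull f V c = res (by rw [h]) (pull g V c) := by
  subst h
  exact (res_self _ _).symm

/-! ### Square-zero extensions of ringed spaces -/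

/-- The square-zero extension `(X, 𝒪_X ⊕ F)`. -/
noncomputable def sqZero (F : X.Modules) : CInfRingedSpace.{u} where
  carrier := X.carrier
  presheaf :=
    { obj := fun U => CInfRingCat.of (CInfRing.SqZero (Sec X U.unop) (MSec F U.unop))
      map := fun i => ⟨CInfRing.SqZero.map (res i.unop.le) (mres i.unop.le)⟩
      map_id := fun U => CInfRingCat.Hom.ext (CInfRingHom.ext fun a =>
        CInfRing.SqZero.ext (res_self _ _) (mres_self _ _))
      map_comp := fun i j => CInfRingCat.Hom.ext (CInfRingHom.ext fun a =>
        CInfRing.SqZero.ext (res_res _ _ _).symm (mres_mres _ _ _).symm) }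
  isSheaf := by
    refine TopCat.Presheaf.isSheaf_of_isSheafUniqueGluing_types _ fun ι U s hs => ?_
    have h1 := (TopCat.Presheaf.isSheaf_iff_isSheafUniqueGluing_types _).1 X.isSheaf U
      (fun i => (s i : CInfRing.SqZero (Sec X (U i)) (MSec F (U i))).fst)
      (fun i j => congrArg CInfRing.SqZero.fst (hs i j))
    have h2 := TopCat.Presheaf.IsSheaf.isSheafUniqueGluing (F := F.val.presheaf) F.isSheaf U
      (show ∀ i, ToType (F.val.presheaf.obj (op (U i))) from
        fun i => (s i : CInfRing.SqZero (Sec X (U i)) (MSec F (U i))).snd)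
      (fun i j => congrArg CInfRing.SqZero.snd (hs i j))
    obtain ⟨a, ha, ha'⟩ := h1
    obtain ⟨m, hm, hm'⟩ := h2
    refine ⟨⟨a, m⟩, fun i => CInfRing.SqZero.ext (ha i) (hm i), fun t ht =>
      CInfRing.SqZero.ext (ha' _ fun i => congrArg CInfRing.SqZero.fst (ht i))
        (hm' _ fun i => congrArg CInfRing.SqZero.snd (ht i))⟩

/-- The closed immersion `X → (X, 𝒪_X ⊕ F)`. -/
noncomputable def sqZeroIncl (F : X.Modules) : X ⟶ sqZero F :=
  InducedCategory.homMk
    { base := 𝟙 X.carrier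
      c := { app := fun (U : (Opens X.carrier)ᵒᵖ) =>
        ⟨CInfRing.SqZero.fstHom (C := Sec X U.unop) (M := MSec F U.unop)⟩ } }

/-- The morphism `(X, 𝒪_X ⊕ F) → Z` defined by a morphism `u : X → Z` and a derivation. -/
noncomputable def extMor (u : X ⟶ Z) {F : X.Modules} (α : (pullback u).obj Z.cotangent ⟶ F) :
    sqZero F ⟶ Z :=
  InducedCategory.homMk
    { base := u.hom.base
      c :=
        { app := fun V => ⟨⟨fun c => ⟨pull u V.unop c, der u α V.unop c⟩, fun f c =>
            CInfRing.SqZero.ext ((pull u V.unop).map_op f c) ((der_op u α f c).trans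
              (Finset.sum_congr rfl fun i _ =>
                congrArg (· • der u α V.unop (c i)) ((pull u V.unop).map_op _ _)))⟩⟩
          naturality := fun _ _ i => CInfRingCat.Hom.ext (CInfRingHom.ext fun c =>
            CInfRing.SqZero.ext (pull_res u i.unop.le c) (der_res u α i.unop.le c)) } }

theorem sqZeroIncl_extMor (u : X ⟶ Z) {F : X.Modules} (α : (pullback u).obj Z.cotangent ⟶ F) :
    sqZeroIncl F ≫ extMor u α = u :=
  hom_ext' rfl fun V c => (res_self (X := X) _ (pull u V c)).symm

theorem extMor_injective (u : X ⟶ Z) {F : X.Modules}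
    {α β : (pullback u).obj Z.cotangent ⟶ F} (h : extMor u α = extMor u β) : α = β := by
  refine der_injective u fun V c => ?_
  exact congrArg CInfRing.SqZero.snd ((pull_congr h V c).trans (res_self (X := sqZero F) _ _))

theorem extMor_comp (u : X ⟶ Y) (g : Y ⟶ Z) {F : X.Modules}
    (α : (pullback u).obj Y.cotangent ⟶ F) : extMor u α ≫ g = extMor (u ≫ g)
      ((pullbackComp u g).hom.app Z.cotangent ≫ (pullback u).map (Omega g) ≫ α) := by
  refine hom_ext' rfl fun V c => Eq.trans ?_ (res_self (X := sqZero F) _ _).symm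
  exact CInfRing.SqZero.ext rfl (der_pullbackComp u g α V c).symm

theorem exists_eq_extMor {F : X.Modules} (l : sqZero F ⟶ Z) :
    ∃ α : (pullback (sqZeroIncl F ≫ l)).obj Z.cotangent ⟶ F, l = extMor (sqZeroIncl F ≫ l) α := by
  obtain ⟨α, hα⟩ := exists_der_eq (sqZeroIncl F ≫ l) F
    (fun V c => (pull l V c : CInfRing.SqZero
      (Sec X ((Opens.map (sqZeroIncl F ≫ l).hom.base).obj V))
      (MSec F ((Opens.map (sqZeroIncl F ≫ l).hom.base).obj V))).snd)
    (fun V n h c => by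
      let a : Fin n → CInfRing.SqZero (Sec X ((Opens.map (sqZeroIncl F ≫ l).hom.base).obj V))
        (MSec F ((Opens.map (sqZeroIncl F ≫ l).hom.base).obj V)) := fun i => pull l V (c i)
      refine (congrArg CInfRing.SqZero.snd ((pull l V).map_op h c)).trans
        ((CInfRing.SqZero.op_snd h a).trans (Finset.sum_congr rfl fun i _ => ?_))
      exact congrArg (· • (a i).snd) ((pull (sqZeroIncl F ≫ l) V).map_op _ _).symm)
    (fun h c => congrArg CInfRing.SqZero.snd (pull_res l h c))
  refine ⟨α, hom_ext' rfl fun V c => Eq.trans ?_ (res_self (X := sqZero F) _ _).symm⟩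
  exact CInfRing.SqZero.ext rfl (hα V c).symm

theorem exists_eq_extMor_of_eq {F : X.Modules} (l : sqZero F ⟶ Z) (u : X ⟶ Z)
    (h : sqZeroIncl F ≫ l = u) : ∃ α : (pullback u).obj Z.cotangent ⟶ F, l = extMor u α := by
  subst h
  exact exists_eq_extMor l

theorem extMor_pullbackCongr {u v : X ⟶ Z} (h : u = v) {F : X.Modules}
    (α : (pullback v).obj Z.cotangent ⟶ F) :
    extMor u ((pullbackCongr h).hom.app Z.cotangent ≫ α) = extMor v α := by
  subst h
  simp [pullbackCongr]

theorem extMor_id_comp {F : X.Modules} (g : X ⟶ Z) (β : X.cotangent ⟶ F) :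
    extMor (𝟙 X) (Omega (𝟙 X) ≫ β) ≫ g = extMor g (Omega g ≫ β) := by
  have key : ∀ {u v : X ⟶ Z}, u = v → extMor u (Omega u ≫ β) = extMor v (Omega v ≫ β) := by
    rintro u _ rfl; rfl
  refine Eq.trans ?_ (key (Category.id_comp g))
  rw [extMor_comp, Omega_comp]
  simp only [Category.assoc]

/-- The identification of `𝟙_* F` with `F`. -/
noncomputable def pushforwardIdHom (F : X.Modules) :
    (SheafOfModules.pushforward (ringSheafHom (𝟙 X))).obj F ⟶ F where
  val :=
    { app := fun U => ModuleCat.ofHom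
        (X := (ModuleCat.restrictScalars ((ringSheafHom (𝟙 X)).hom.app U).hom).obj (F.val.obj U))
        (Y := F.val.obj U)
        { toFun := fun m => m
          map_add' := fun _ _ => rfl
          map_smul' := fun _ _ => rfl }
      naturality := fun _ => rfl }

theorem exists_eq_Omega_id_comp {F : X.Modules} (γ : (pullback (𝟙 X)).obj X.cotangent ⟶ F) :
    ∃ β : X.cotangent ⟶ F, γ = Omega (𝟙 X) ≫ β := by
  refine ⟨pullbackHomEquiv (𝟙 X) _ _ γ ≫ pushforwardIdHom F, der_injective _ fun V c => ?_⟩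
  rw [der_comp, der_Omega]
  rfl

theorem cotangent_hom_ext {F : X.Modules} {β β' : X.cotangent ⟶ F}
    (h : Omega (𝟙 X) ≫ β = Omega (𝟙 X) ≫ β') : β = β' := by
  apply (cotangentHomEquiv F).injective
  apply PresheafOfModules.hom_ext
  intro V
  refine cotangentModuleCat_hom_ext fun c => ?_
  have h1 := congrArg (fun α => der (𝟙 X) α V.unop c) h
  simp only [der_comp, der_Omega] at h1
  exact h1

end CInfRingedSpace

open CInfRingedSpace in
theorem exists_desc_of_isPullback {W X Y Z : LocallyFairCInfScheme.{u}}
    {e : W ⟶ X} {f : W ⟶ Y} {g : X ⟶ Z} {h : Y ⟶ Z} (sq : IsPullback e f g h)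
    (comm : e.hom ≫ g.hom = f.hom ≫ h.hom)
    {F : W.obj.Modules} (hF : IsLocallyFair (sqZero F))
    (α : (CInfRingedSpace.pullback e.hom).obj X.obj.cotangent ⟶ F)
    (α' : (CInfRingedSpace.pullback f.hom).obj Y.obj.cotangent ⟶ F)
    (hα : squareLeft e.hom f.hom g.hom h.hom comm ≫ biprod.desc α α' = 0) :
    ∃ β : W.obj.cotangent ⟶ F, Omega e.hom ≫ β = α ∧ Omega f.hom ≫ β = α' := by
  let E : LocallyFairCInfScheme.{u} := ⟨sqZero F, hF⟩
  let k : E ⟶ X := ObjectProperty.homMk (extMor e.hom α)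
  let k' : E ⟶ Y := ObjectProperty.homMk (extMor f.hom α')
  have hk : k ≫ g = k' ≫ h := by
    refine ObjectProperty.hom_ext _ ?_
    change extMor e.hom α ≫ g.hom = extMor f.hom α' ≫ h.hom
    rw [extMor_comp, extMor_comp, ← extMor_pullbackCongr comm]
    congr 1
    simpa [squareLeft, add_neg_eq_zero] using hα
  let i : W ⟶ E := ObjectProperty.homMk (sqZeroIncl F)
  have hl : i ≫ sq.lift k k' hk = 𝟙 W := by
    refine sq.hom_ext ?_ ?_
    · rw [Category.assoc, sq.lift_fst, Category.id_comp]
      exact ObjectProperty.hom_ext _ (sqZeroIncl_extMor _ _)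
    · rw [Category.assoc, sq.lift_snd, Category.id_comp]
      exact ObjectProperty.hom_ext _ (sqZeroIncl_extMor _ _)
  obtain ⟨γ, hγ⟩ := exists_eq_extMor_of_eq (sq.lift k k' hk).hom (𝟙 W.obj)
    (congrArg InducedCategory.Hom.hom hl)
  obtain ⟨β, rfl⟩ := exists_eq_Omega_id_comp γ
  refine ⟨β, extMor_injective _ ?_, extMor_injective _ ?_⟩
  · rw [← extMor_id_comp, ← hγ]
    exact congrArg InducedCategory.Hom.hom (sq.lift_fst k k' hk)
  · rw [← extMor_id_comp, ← hγ]
    exact congrArg InducedCategory.Hom.hom (sq.lift_snd k k' hk)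

open CInfRingedSpace in
theorem cotangent_hom_ext_of_isPullback {W X Y Z : LocallyFairCInfScheme.{u}}
    {e : W ⟶ X} {f : W ⟶ Y} {g : X ⟶ Z} {h : Y ⟶ Z} (sq : IsPullback e f g h)
    {F : W.obj.Modules} (hF : IsLocallyFair (sqZero F)) {β β' : W.obj.cotangent ⟶ F}
    (he : Omega e.hom ≫ β = Omega e.hom ≫ β') (hf : Omega f.hom ≫ β = Omega f.hom ≫ β') :
    β = β' := by
  let E : LocallyFairCInfScheme.{u} := ⟨sqZero F, hF⟩
  let k : (W.obj.cotangent ⟶ F) → (E ⟶ W) := fun β =>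
    ObjectProperty.homMk (extMor (𝟙 W.obj) (Omega (𝟙 W.obj) ≫ β))
  have hk : k β = k β' := by
    refine sq.hom_ext (ObjectProperty.hom_ext _ ?_) (ObjectProperty.hom_ext _ ?_)
    · exact (extMor_id_comp e.hom β).trans ((congrArg _ he).trans (extMor_id_comp e.hom β').symm)
    · exact (extMor_id_comp f.hom β).trans ((congrArg _ hf).trans (extMor_id_comp f.hom β').symm)
  exact cotangent_hom_ext (extMor_injective _ (congrArg InducedCategory.Hom.hom hk))

namespace CInfRingCat

/-- A bijective morphism of `C^∞`-rings is an isomorphism. -/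
noncomputable def isoOfBijective {C D : CInfRingCat.{u}} (φ : C ⟶ D)
    (h : Function.Bijective φ.hom) : C ≅ D where
  hom := φ
  inv := ⟨⟨(Equiv.ofBijective _ h).symm, fun f c => by
    rw [Equiv.symm_apply_eq]
    refine Eq.trans ?_ (φ.hom.map_op f _).symm
    congr 1
    funext i
    exact ((Equiv.ofBijective _ h).apply_symm_apply (c i)).symm⟩⟩
  hom_inv_id := Hom.ext (CInfRingHom.ext fun c => (Equiv.ofBijective _ h).symm_apply_apply c)
  inv_hom_id := Hom.ext (CInfRingHom.ext fun c => (Equiv.ofBijective _ h).apply_symm_apply c)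

end CInfRingCat

namespace CInfRingedSpace

open CInfRing

/-- A homeomorphism of `X` with `Spec A` and morphisms from `A` to the sections over open sets,
which induce isomorphisms of the localizations of `A` with the stalks of `X`. -/
structure SpecChart (X : CInfRingedSpace.{u}) (A : Type u) [CInfRing A] where
  toHomeo : RPoint A ≃ₜ X.carrier
  sec : ∀ U : Opens X.carrier, CInfRingHom A (Sec X U)
  res_sec : ∀ {U V : Opens X.carrier} (h : V ≤ U) (a : A), res h (sec U a) = sec V a
  exists_sec : ∀ (U : Opens X.carrier) (p : RPoint A) (s : Sec X U), toHomeo p ∈ U →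
    ∃ (V : Opens X.carrier) (h : V ≤ U) (a : A), toHomeo p ∈ V ∧ res h s = sec V a
  local_eq : ∀ (U : Opens X.carrier) (p : RPoint A) (a b : A), toHomeo p ∈ U →
    sec U a = sec U b → toLocalAt p a = toLocalAt p b
  eq_of_local_eq : ∀ (p : RPoint A) (a b : A), toLocalAt p a = toLocalAt p b →
    ∃ U : Opens X.carrier, toHomeo p ∈ U ∧ sec U a = sec U b

namespace SpecChart

variable {X : CInfRingedSpace.{u}} {A : Type u} [CInfRing A] (κ : SpecChart X A)

/-- The open set of `X` corresponding to an open set of `Spec A`. -/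
def pre (U : Opens (specTop A)) : Opens X.carrier :=
  ⟨κ.toHomeo.symm ⁻¹' U.1, U.2.preimage κ.toHomeo.symm.continuous⟩

theorem mem_pre {U : Opens (specTop A)} {p : RPoint A} : κ.toHomeo p ∈ κ.pre U ↔ p ∈ U := by
  change κ.toHomeo.symm (κ.toHomeo p) ∈ U.1 ↔ p ∈ U.1
  rw [Homeomorph.symm_apply_apply]

theorem exists_eq_toHomeo (x : X.carrier) : ∃ p, x = κ.toHomeo p :=
  ⟨κ.toHomeo.symm x, (κ.toHomeo.apply_symm_apply x).symm⟩

/-- The germ of a section as an element of a localization of `A`. -/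
noncomputable def germ {U : Opens X.carrier} (s : Sec X U) (p : RPoint A)
    (hp : κ.toHomeo p ∈ U) : LocalAt p :=
  toLocalAt p (κ.exists_sec U p s hp).choose_spec.choose_spec.choose

theorem germ_eq {U V : Opens X.carrier} (s : Sec X U) {p : RPoint A} (hp : κ.toHomeo p ∈ U)
    (hV : V ≤ U) (hpV : κ.toHomeo p ∈ V) {a : A} (h : res hV s = κ.sec V a) :
    κ.germ s p hp = toLocalAt p a := by
  obtain ⟨hpV', h'⟩ := (κ.exists_sec U p s hp).choose_spec.choose_spec.choose_spec
  refine (κ.local_eq (V ⊓ (κ.exists_sec U p s hp).choose) p _ _ ⟨hpV, hpV'⟩ ?_).symm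
  rw [← κ.res_sec inf_le_left, ← h, ← κ.res_sec inf_le_right, ← h', res_res, res_res]

theorem germ_res {U V : Opens X.carrier} (h : V ≤ U) (s : Sec X U) {p : RPoint A}
    (hp : κ.toHomeo p ∈ V) : κ.germ (res h s) p hp = κ.germ s p (h hp) := by
  obtain ⟨V', hV', a, hpV', h'⟩ := κ.exists_sec V p (res h s) hp
  rw [κ.germ_eq _ hp hV' hpV' h']
  rw [res_res] at h'
  rw [κ.germ_eq _ (h hp) _ hpV' h']

theorem germ_op {U : Opens X.carrier} {n : ℕ} (f : SmoothFun n) (s : Fin n → Sec X U)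
    {p : RPoint A} (hp : κ.toHomeo p ∈ U) :
    κ.germ (op f s) p hp = op f fun i => κ.germ (s i) p hp := by
  choose V hV a hpV h using fun i => κ.exists_sec U p (s i) hp
  have hmem : κ.toHomeo p ∈ U ⊓ ⨅ k, V k := by
    refine ⟨hp, ?_⟩
    rw [Opens.coe_iInf, Set.mem_iInter]
    exact hpV
  have hs : ∀ i, res (inf_le_left : U ⊓ ⨅ k, V k ≤ U) (s i) = κ.sec (U ⊓ ⨅ k, V k) (a i) := by
    intro i
    have hle : U ⊓ ⨅ k, V k ≤ V i := inf_le_right.trans (iInf_le V i)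
    rw [← κ.res_sec hle, ← h, res_res]
  rw [κ.germ_eq (op f s) hp inf_le_left hmem (a := op f a), CInfRingHom.map_op']
  · congr 1
    funext i
    rw [κ.germ_eq (s i) hp inf_le_left hmem (hs i)]
  · rw [CInfRingHom.map_op', CInfRingHom.map_op']
    congr 1
    funext i
    exact hs i

theorem eq_of_germ_eq {U : Opens X.carrier} {s t : Sec X U}
    (h : ∀ p (hp : κ.toHomeo p ∈ U), κ.germ s p hp = κ.germ t p hp) : s = t := by
  refine sec_ext fun x hx => ?_
  obtain ⟨p, rfl⟩ := κ.exists_eq_toHomeo x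
  obtain ⟨V, hV, a, hpV, hs⟩ := κ.exists_sec U p s hx
  obtain ⟨V', hV', a', hpV', ht⟩ := κ.exists_sec U p t hx
  have h1 := h p hx
  rw [κ.germ_eq s hx hV hpV hs, κ.germ_eq t hx hV' hpV' ht] at h1
  obtain ⟨V'', hpV'', h''⟩ := κ.eq_of_local_eq p a a' h1
  have l1 : V ⊓ (V' ⊓ V'') ≤ V := inf_le_left
  have l2 : V ⊓ (V' ⊓ V'') ≤ V' := inf_le_right.trans inf_le_left
  have l3 : V ⊓ (V' ⊓ V'') ≤ V'' := inf_le_right.trans inf_le_right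
  refine ⟨V ⊓ (V' ⊓ V''), l1.trans hV, ⟨hpV, hpV', hpV''⟩, ?_⟩
  rw [← res_res hV l1, hs, ← res_res hV' l2, ht, κ.res_sec, κ.res_sec, ← κ.res_sec l3, h'',
    κ.res_sec]

theorem germ_sec (U : Opens X.carrier) (a : A) {p : RPoint A} (hp : κ.toHomeo p ∈ U) :
    κ.germ (κ.sec U a) p hp = toLocalAt p a :=
  κ.germ_eq _ hp le_rfl hp (res_self _ _)

/-- The regular function defined by a section. -/
noncomputable def toRegular (U : Opens (specTop A)) :
    CInfRingHom (Sec X (κ.pre U)) (RegularFun U) where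
  toFun s := ⟨fun p => κ.germ s p.1 (κ.mem_pre.2 p.2), isRegular_of fun p₀ => by
    obtain ⟨V, hV, a, hpV, h⟩ := κ.exists_sec (κ.pre U) p₀.1 s (κ.mem_pre.2 p₀.2)
    refine ⟨⟨κ.toHomeo ⁻¹' V, V.2.preimage κ.toHomeo.continuous⟩, hpV,
      homOfLE fun p hp => κ.mem_pre.1 (hV hp), a, fun p => ?_⟩
    exact κ.germ_eq s _ hV p.2 h⟩
  map_op f s := Subtype.ext (funext fun p => κ.germ_op f s (κ.mem_pre.2 p.2))

theorem toRegular_bijective (U : Opens (specTop A)) : Function.Bijective (κ.toRegular U) := by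
  refine ⟨fun s t h => κ.eq_of_germ_eq fun p hp => ?_, fun r => ?_⟩
  · exact congrArg (fun r : RegularFun U => r.1 ⟨p, κ.mem_pre.1 hp⟩) h
  · choose V hpV i c h using fun p : U => exists_of_isRegular r.2 p
    obtain ⟨t, ht⟩ := sec_glue (X := X) (U := κ.pre U) (fun p => κ.pre (V p))
      (fun p x hx => (i p).le (show κ.toHomeo.symm x ∈ V p from hx))
      (fun x hx => by
        obtain ⟨p, rfl⟩ := κ.exists_eq_toHomeo x
        exact ⟨⟨p, κ.mem_pre.1 hx⟩, κ.mem_pre.2 (hpV _)⟩)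
      (fun p => κ.sec _ (c p)) (fun p q => by
        rw [κ.res_sec, κ.res_sec]
        refine κ.eq_of_germ_eq fun p' hp' => ?_
        rw [κ.germ_sec, κ.germ_sec]
        exact (h p ⟨p', κ.mem_pre.1 hp'.1⟩).symm.trans (h q ⟨p', κ.mem_pre.1 hp'.2⟩))
    refine ⟨t, Subtype.ext (funext fun p => ?_)⟩
    refine (κ.germ_eq t (κ.mem_pre.2 p.2) _ (κ.mem_pre.2 (hpV p)) (ht p)).trans ?_
    exact (h p ⟨p.1, hpV p⟩).symm

/-- The isomorphism with the spectrum. -/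
noncomputable def isoSpec : X ≅ Spec A :=
  InducedCategory.isoMk <| AlgebraicGeometry.PresheafedSpace.isoOfComponents
    (TopCat.isoOfHomeo (X := X.carrier) (Y := specTop A) κ.toHomeo.symm)
    (NatIso.ofComponents (fun (U : (Opens (specTop A))ᵒᵖ) => CInfRingCat.isoOfBijective
      (C := X.presheaf.obj (op (κ.pre U.unop))) (D := CInfRingCat.of (RegularFun U.unop))
      ⟨κ.toRegular U.unop⟩ (κ.toRegular_bijective U.unop))
      (fun {U V : (Opens (specTop A))ᵒᵖ} i => CInfRingCat.Hom.ext
        (CInfRingHom.ext fun s => Subtype.ext (funext fun p =>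
          κ.germ_res (U := κ.pre U.unop) (V := κ.pre V.unop)
          (fun x hx => i.unop.le (show κ.toHomeo.symm x ∈ V.unop from hx)) s
          (κ.mem_pre.2 p.2)))))

end SpecChart

end CInfRingedSpace

namespace CInfRingedSpace

open CInfRing AlgebraicGeometry

/-! ### Open immersions of spectra -/

section OpenImmersion

variable {X : CInfRingedSpace.{u}} {D : Type u} [CInfRing D] (j : Spec D ⟶ X)
  [hj : PresheafedSpace.IsOpenImmersion j.hom]

/-- The image of a point. -/
noncomputable def img (p : RPoint D) : X.carrier := j.hom.base p

/-- The image of an open set. -/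
noncomputable def imgOpens (U : Opens (specTop D)) : Opens X.carrier := hj.base_open.functor.obj U

theorem isOpenEmbedding_img : Topology.IsOpenEmbedding (img j) := hj.base_open

theorem mem_imgOpens {U : Opens (specTop D)} {p : RPoint D} : img j p ∈ imgOpens j U ↔ p ∈ U :=
  ⟨fun ⟨_, hq, h⟩ => (isOpenEmbedding_img j).injective h ▸ hq, fun h => ⟨p, h, rfl⟩⟩

/-- The range of an open immersion. -/
noncomputable def rangeOpens : Opens X.carrier := imgOpens j ⊤

theorem mem_rangeOpens (p : RPoint D) : img j p ∈ rangeOpens j :=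
  (mem_imgOpens j).2 trivial

theorem exists_eq_img {x : X.carrier} (hx : x ∈ rangeOpens j) : ∃ p, img j p = x :=
  let ⟨p, _, h⟩ := hx; ⟨p, h⟩

theorem imgOpens_le (U : Opens (specTop D)) : imgOpens j U ≤ rangeOpens j :=
  fun _ ⟨p, _, h⟩ => ⟨p, trivial, h⟩

theorem pull_bijective {V : Opens X.carrier} (hV : V ≤ rangeOpens j) :
    Function.Bijective (pull j V) := by
  have h : IsIso (j.hom.c.app (op V)) := by
    refine PresheafedSpace.IsOpenImmersion.c_iso' j.hom ((Opens.map j.hom.base).obj V) ?_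
    refine Opens.ext ?_
    refine ((Set.image_preimage_eq_iff (f := j.hom.base) (s := V.1)).2 fun x hx => ?_).symm
    obtain ⟨p, hp⟩ := exists_eq_img j (hV hx)
    exact ⟨p, hp⟩
  exact ConcreteCategory.bijective_of_isIso (j.hom.c.app (op V))

/-- The section over an open subset of the chart defined by an element of the ring. -/
noncomputable def dsec {V : Opens X.carrier} (hV : V ≤ rangeOpens j) : CInfRingHom D (Sec X V) where
  toFun d := (Equiv.ofBijective _ (pull_bijective j hV)).symm (RegularFun.of _ d)
  map_op f c := by
    refine (pull_bijective j hV).1 (((Equiv.ofBijective _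
      (pull_bijective j hV)).apply_symm_apply _).trans ?_)
    refine Eq.trans ?_ ((pull j V).map_op f _).symm
    refine ((RegularFun.of _).map_op f c).trans (congrArg (CInfRing.op f) (funext fun i => ?_))
    exact ((Equiv.ofBijective _ (pull_bijective j hV)).apply_symm_apply _).symm

theorem pull_dsec {V : Opens X.carrier} (hV : V ≤ rangeOpens j) (d : D) :
    pull j V (dsec j hV d) = RegularFun.of ((Opens.map j.hom.base).obj V) d :=
  (Equiv.ofBijective _ (pull_bijective j hV)).apply_symm_apply _

theorem res_dsec {U V : Opens X.carrier} (hU : U ≤ rangeOpens j) (h : V ≤ U) (d : D) :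
    res h (dsec j hU d) = dsec j (h.trans hU) d := by
  refine (pull_bijective j (h.trans hU)).1 ?_
  rw [pull_res, pull_dsec, pull_dsec]
  rfl

theorem exists_dsec {U : Opens X.carrier} {p : RPoint D} (hp : img j p ∈ U) (s : Sec X U) :
    ∃ (V : Opens X.carrier) (h : V ≤ U) (hV : V ≤ rangeOpens j) (d : D), img j p ∈ V ∧
      res h s = dsec j hV d := by
  obtain ⟨V, hpV, i, d, h⟩ := exists_of_isRegular (pull j U s).2 ⟨p, hp⟩
  have hle : imgOpens j V ≤ U := by
    rintro _ ⟨q, hq, rfl⟩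
    exact i.le hq
  refine ⟨imgOpens j V, hle, imgOpens_le j V, d, (mem_imgOpens j).2 hpV, ?_⟩
  refine (pull_bijective j (imgOpens_le j V)).1 ?_
  rw [pull_res, pull_dsec]
  exact Subtype.ext (funext fun q => h ⟨q.1, (mem_imgOpens j).1 q.2⟩)

theorem exists_dsec_eq {U : Opens X.carrier} {p : RPoint D} (hp : img j p ∈ U) {a b : D}
    (h : toLocalAt p a = toLocalAt p b) : ∃ (V : Opens X.carrier) (_ : V ≤ U)
      (hV : V ≤ rangeOpens j), img j p ∈ V ∧ dsec j hV a = dsec j hV b := by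
  obtain ⟨t, ht, htab⟩ := toLocalAt_eq_iff.1 h
  let N : Opens (specTop D) := ⟨{q : RPoint D | q t ≠ 0}, isOpen_ne.preimage (continuous_eval t)⟩
  have hV : imgOpens j N ⊓ U ≤ rangeOpens j := inf_le_left.trans (imgOpens_le j N)
  refine ⟨imgOpens j N ⊓ U, inf_le_right, hV, ⟨(mem_imgOpens j).2 ht, hp⟩, ?_⟩
  refine (pull_bijective j hV).1 ?_
  rw [pull_dsec, pull_dsec]
  exact Subtype.ext (funext fun q =>
    toLocalAt_eq_iff.2 ⟨t, (mem_imgOpens j (p := q.1)).1 q.2.1, htab⟩)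

/-- Evaluation of sections at a point. -/
noncomputable def evalAt {V : Opens X.carrier} (p : RPoint D) (hp : img j p ∈ V) :
    RPoint (Sec X V) :=
  (localPoint p).comp
    ⟨fun s => (pull j V s).1 ⟨p, hp⟩, fun f c =>
      congrArg (fun r : RegularFun ((Opens.map j.hom.base).obj V) => r.1 ⟨p, hp⟩)
        ((pull j V).map_op f c)⟩

theorem evalAt_dsec {V : Opens X.carrier} (hV : V ≤ rangeOpens j) (p : RPoint D)
    (hp : img j p ∈ V) (d : D) : evalAt j p hp (dsec j hV d) = p d := by
  refine Eq.trans ?_ (localPoint_toLocalAt p d)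
  change localPoint p ((pull j V (dsec j hV d)).1 ⟨p, hp⟩) = _
  rw [pull_dsec]
  rfl

theorem evalAt_res {U V : Opens X.carrier} (h : V ≤ U) (p : RPoint D) (hp : img j p ∈ V)
    (s : Sec X U) : evalAt j p hp (res h s) = evalAt j p (h hp) s := by
  change localPoint p ((pull j V (res h s)).1 ⟨p, hp⟩) = _
  rw [pull_res]
  rfl

/-- A section which does not vanish at a point is invertible near the point. -/
theorem exists_isUnit_res {U : Opens X.carrier} {p : RPoint D} (hp : img j p ∈ U) (s : Sec X U)
    (hs : evalAt j p hp s ≠ 0) :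
    ∃ (V : Opens X.carrier) (h : V ≤ U), img j p ∈ V ∧ ∃ t, res h s * t = 1 := by
  obtain ⟨V, hVU, hV, d, hpV, h⟩ := exists_dsec j hp s
  rw [← evalAt_res j hVU p hpV, h, evalAt_dsec] at hs
  obtain ⟨e, b, hb, hbe⟩ := exists_inverse_germ p hs
  obtain ⟨V', hV'V, hV', hpV', h'⟩ := exists_dsec_eq j hpV (a := d * e) (b := 1)
    (toLocalAt_eq_iff.2 ⟨b, hb, by rw [hbe, mul_one]⟩)
  refine ⟨V', hV'V.trans hVU, hpV', dsec j hV' e, ?_⟩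
  rw [← res_res hVU hV'V, h, res_dsec j hV]
  refine Eq.trans ?_ (h'.trans (map_one (dsec j hV').toRingHom))
  exact (map_mul (dsec j hV').toRingHom d e).symm

end OpenImmersion

theorem exists_openImmersion {X : CInfRingedSpace.{u}} {U : Opens X.carrier} {C : Type u}
    [CInfRing C] (φ : X.restrict U ≅ Spec C) : ∃ j : Spec C ⟶ X,
      PresheafedSpace.IsOpenImmersion j.hom ∧ ∀ x ∈ U, ∃ p : RPoint C, img j p = x := by
  have h1 : PresheafedSpace.IsOpenImmersion (X.ofRestrict U).hom :=
    PresheafedSpace.IsOpenImmersion.ofRestrict X.toPresheafedSpace U.isOpenEmbedding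
  have h2 : IsIso φ.inv.hom :=
    ⟨φ.hom.hom, congrArg InducedCategory.Hom.hom φ.inv_hom_id,
      congrArg InducedCategory.Hom.hom φ.hom_inv_id⟩
  refine ⟨φ.inv ≫ X.ofRestrict U, PresheafedSpace.IsOpenImmersion.comp φ.inv.hom
    (X.ofRestrict U).hom, fun x hx => ⟨φ.hom.hom.base ⟨x, hx⟩, ?_⟩⟩
  have h3 : (φ.hom ≫ φ.inv).hom.base ⟨x, hx⟩ = (⟨x, hx⟩ : U) := by rw [φ.hom_inv_id]; rfl
  exact congrArg Subtype.val h3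

/-! ### The square-zero extension of a local space is local -/

theorem isLocal_sqZero {X : CInfRingedSpace.{u}} (hX : X.IsLocal) (F : X.Modules) :
    (sqZero F).IsLocal := by
  intro x
  obtain ⟨hloc, ⟨φ⟩⟩ := hX x
  let η : (sqZero F).commRingPresheaf ⟶ X.commRingPresheaf :=
    { app := fun (U : (Opens X.carrier)ᵒᵖ) => CommRingCat.ofHom
        (SqZero.fstHom (C := Sec X U.unop) (M := MSec F U.unop)).toRingHom }
  let ψ : (sqZero F).commRingPresheaf.stalk x →+* X.commRingPresheaf.stalk x :=
    ((TopCat.Presheaf.stalkFunctor CommRingCat (X := X.carrier) x).map η).hom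
  have hψ : ∀ (U : Opens X.carrier) (hxU : x ∈ U) (a : SqZero (Sec X U) (MSec F U)),
      ψ ((sqZero F).commRingPresheaf.germ U x hxU a) = X.commRingPresheaf.germ U x hxU a.fst :=
    fun U hxU a => TopCat.Presheaf.stalkFunctor_map_germ_apply U x hxU η a
  have hsurj : Function.Surjective ψ := by
    intro a
    obtain ⟨U, hxU, s, rfl⟩ := TopCat.Presheaf.exists_germ_eq X.commRingPresheaf a
    exact ⟨_, hψ U hxU ⟨s, 0⟩⟩
  have hlocal : IsLocalHom ψ := by
    refine ⟨fun a ha => ?_⟩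
    obtain ⟨U, hxU, s, rfl⟩ := TopCat.Presheaf.exists_germ_eq (sqZero F).commRingPresheaf a
    let s' : SqZero (Sec X U) (MSec F U) := s
    change IsUnit (ψ ((sqZero F).commRingPresheaf.germ U x hxU s')) at ha
    rw [hψ U hxU s'] at ha
    obtain ⟨b, hb⟩ := ha.exists_right_inv
    obtain ⟨V, hxV, t, rfl⟩ := TopCat.Presheaf.exists_germ_eq X.commRingPresheaf b
    have h1 : X.commRingPresheaf.germ (U ⊓ V) x ⟨hxU, hxV⟩
        (res (X := X) (inf_le_left : U ⊓ V ≤ U) s'.fst *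
          res (X := X) (inf_le_right : U ⊓ V ≤ V) t) =
        X.commRingPresheaf.germ (U ⊓ V) x ⟨hxU, hxV⟩ 1 := by
      rw [map_one, ← hb]
      refine (map_mul (X.commRingPresheaf.germ (U ⊓ V) x ⟨hxU, hxV⟩).hom _ _).trans ?_
      exact congrArg₂ (· * ·)
        (TopCat.Presheaf.germ_res_apply X.commRingPresheaf (homOfLE inf_le_left) x _ _)
        (TopCat.Presheaf.germ_res_apply X.commRingPresheaf (homOfLE inf_le_right) x _ _)
    obtain ⟨V', hxV', i, i', h2⟩ := TopCat.Presheaf.germ_eq X.commRingPresheaf x _ _ _ _ h1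
    let t' : Sec X V' := res (i.le.trans inf_le_right) t
    have h3 : res (X := X) (i.le.trans inf_le_left) s'.fst * t' = 1 := by
      refine Eq.trans ?_ (h2.trans (map_one (res (X := X) i'.le).toRingHom))
      refine Eq.trans ?_ (map_mul (res (X := X) i.le).toRingHom _ _).symm
      exact congrArg₂ (· * ·) (res_res _ _ _).symm (res_res _ _ _).symm
    let m : MSec F V' := mres (i.le.trans inf_le_left) s'.snd
    obtain ⟨r, hr⟩ := SqZero.exists_mul_eq_one
      (a := (⟨res (i.le.trans inf_le_left) s'.fst, m⟩ : SqZero (Sec X V') (MSec F V'))) h3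
    refine IsUnit.of_mul_eq_one ((sqZero F).commRingPresheaf.germ V' x hxV' r) ?_
    rw [← TopCat.Presheaf.germ_res_apply (sqZero F).commRingPresheaf
      (homOfLE (i.le.trans inf_le_left)) x hxV' s]
    refine (map_mul ((sqZero F).commRingPresheaf.germ V' x hxV').hom _ _).symm.trans ?_
    exact (congrArg ((sqZero F).commRingPresheaf.germ V' x hxV').hom hr).trans (map_one _)
  have hlocal' : IsLocalRing ((sqZero F).commRingPresheaf.stalk x) :=
    RingHom.domain_isLocalRing ψ
  refine ⟨hlocal', ⟨(RingEquiv.ofBijective (IsLocalRing.ResidueField.map ψ)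
    ⟨RingHom.injective _, fun a => ?_⟩).trans φ⟩⟩
  obtain ⟨a, rfl⟩ := IsLocalRing.residue_surjective a
  obtain ⟨a, rfl⟩ := hsurj a
  exact ⟨IsLocalRing.residue _ a, IsLocalRing.ResidueField.map_residue ψ a⟩

end CInfRingedSpace

namespace CInfRing

/-! ### Finitely generated subrings -/

section Adjoin

variable {C : Type u} [CInfRing C]

/-- Membership in the `C^∞`-subring generated by a set. -/
inductive AdjoinMem (S : Set C) : C → Prop
  | of {c : C} : c ∈ S → AdjoinMem S c
  | op {n : ℕ} (f : SmoothFun n) (c : Fin n → C) : (∀ i, AdjoinMem S (c i)) →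
    AdjoinMem S (CInfRing.op f c)

/-- The `C^∞`-subring generated by a set. -/
def Adjoin (S : Set C) : Type u := {c : C // AdjoinMem S c}

namespace Adjoin

variable {S : Set C}

noncomputable instance : CInfRing (Adjoin S) where
  op f c := ⟨op f fun i => (c i).1, .op f _ fun i => (c i).2⟩
  op_comp g f _ := Subtype.ext (op_comp g f _)
  op_proj i _ := Subtype.ext (op_proj i _)

/-- The inclusion of a `C^∞`-subring. -/
def incl : CInfRingHom (Adjoin S) C := ⟨Subtype.val, fun _ _ => rfl⟩

theorem incl_injective : Function.Injective (incl (S := S)) := Subtype.val_injective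

theorem finitelyGenerated (hS : S.Finite) : FinitelyGenerated (Adjoin S) := by
  obtain ⟨n, v, hv⟩ : ∃ (n : ℕ) (v : Fin n → C), Set.range v = S := by
    have := hS.fintype
    exact ⟨_, fun i => ((Fintype.equivFin S).symm i).1, by
      rw [show (fun i => ((Fintype.equivFin S).symm i).1) =
        Subtype.val ∘ (Fintype.equivFin S).symm from rfl,
        (Fintype.equivFin S).symm.surjective.range_comp, Subtype.range_val]⟩
  refine ⟨n, fun i => ⟨v i, .of (hv ▸ ⟨i, rfl⟩)⟩, fun a => ?_⟩
  suffices h : ∀ c, AdjoinMem S c → ∃ f : SmoothFun n, c = op f v by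
    obtain ⟨f, hf⟩ := h a.1 a.2
    exact ⟨f, Subtype.ext hf⟩
  intro c hc
  induction hc with
  | of hc =>
    obtain ⟨i, rfl⟩ := hv ▸ hc
    exact ⟨SmoothFun.proj i, (op_proj _ _).symm⟩
  | op g c _ ih =>
    choose f hf using ih
    exact ⟨g.comp f, by rw [op_comp]; exact congrArg _ (funext hf)⟩

theorem rpoint_ext {p q : RPoint (Adjoin S)}
    (h : ∀ c (hc : c ∈ S), p ⟨c, .of hc⟩ = q ⟨c, .of hc⟩) : p = q := by
  refine RPoint.ext' fun a => ?_
  obtain ⟨c, hc⟩ := a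
  induction hc with
  | of hc => exact h _ hc
  | op f c hc ih =>
    exact (p.map_op f fun i => ⟨c i, hc i⟩).trans
      ((congrArg f.toFun (funext ih)).trans (q.map_op f fun i => ⟨c i, hc i⟩).symm)

theorem continuous_of {T : Type*} [TopologicalSpace T] {θ : T → RPoint (Adjoin S)}
    (h : ∀ c (hc : c ∈ S), Continuous fun t => θ t ⟨c, .of hc⟩) : Continuous θ := by
  refine continuous_iInf_rng.2 fun a => continuous_induced_rng.2 ?_
  obtain ⟨c, hc⟩ := a
  change Continuous fun t => θ t ⟨c, hc⟩
  induction hc with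
  | of hc => exact h _ hc
  | op f c hc ih =>
    rw [show (fun t => θ t ⟨op f c, .op f c hc⟩) = fun t => f.toFun fun i => θ t ⟨c i, hc i⟩ from
      funext fun t => (θ t).map_op f fun i => ⟨c i, hc i⟩]
    exact f.smooth.continuous.comp (continuous_pi ih)

/-- A morphism whose values on generators lie in a `C^∞`-subring takes values there. -/
theorem mem_of_generators {D : Type u} [CInfRing D] (φ : CInfRingHom D C) {n : ℕ} {x : Fin n → D}
    (hx : ∀ d, ∃ f : SmoothFun n, d = op f x) (h : ∀ i, AdjoinMem S (φ (x i))) (d : D) :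
    AdjoinMem S (φ d) := by
  obtain ⟨f, rfl⟩ := hx d
  rw [φ.map_op']
  exact .op f _ h

end Adjoin

theorem RPoint.continuous_comp {D : Type u} [CInfRing D] (φ : CInfRingHom D C) :
    Continuous fun p : RPoint C => p.comp φ :=
  continuous_iInf_rng.2 fun d => continuous_induced_rng.2 (continuous_eval (φ d))

end Adjoin

end CInfRing

namespace CInfRingedSpace

open CInfRing AlgebraicGeometry

/-- Charts of open subspaces. -/
noncomputable def specChartRestrict {X : CInfRingedSpace.{u}} {V : Opens X.carrier} {A : Type u}
    [CInfRing A] (θ : RPoint A ≃ₜ V) (ι : CInfRingHom A (Sec X V))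
    (h1 : ∀ {U : Opens X.carrier} (_ : U ≤ V) (s : Sec X U) (x : X.carrier), x ∈ U →
      ∃ (V' : Opens X.carrier) (h : V' ≤ U) (h' : V' ≤ V) (a : A), x ∈ V' ∧
        res h s = res h' (ι a))
    (h2 : ∀ {U : Opens X.carrier} (hU : U ≤ V) (p : RPoint A) (a b : A), (θ p).1 ∈ U →
      res hU (ι a) = res hU (ι b) → toLocalAt p a = toLocalAt p b)
    (h3 : ∀ (p : RPoint A) (a b : A), toLocalAt p a = toLocalAt p b →
      ∃ (U : Opens X.carrier) (hU : U ≤ V), (θ p).1 ∈ U ∧ res hU (ι a) = res hU (ι b)) :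
    SpecChart (X.restrict V) A :=
  have hle : ∀ U : Opens V, V.isOpenEmbedding.functor.obj U ≤ V := by
    rintro U _ ⟨x, _, rfl⟩
    exact x.2
  have hmem : ∀ (U : Opens X.carrier) (_ : U ≤ V), V.isOpenEmbedding.functor.obj
      ((Opens.map V.inclusion').obj U) ≤ U := by
    rintro U - _ ⟨x, hx, rfl⟩
    exact hx
  { toHomeo := θ
    sec := fun U => (res (hle U)).comp ι
    res_sec := fun {U U'} h a => res_res (X := X) (hle U)
      (V.isOpenEmbedding.functor.monotone h) (ι a)
    exists_sec := fun U p s hp => by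
      obtain ⟨V', h, h', a, hx, hs⟩ := h1 (hle U) s (θ p).1 ⟨θ p, hp, rfl⟩
      have hU : (Opens.map V.inclusion').obj V' ≤ U := by
        intro x hx
        obtain ⟨y, hy, hxy⟩ := h hx
        exact (Subtype.val_injective hxy) ▸ hy
      refine ⟨(Opens.map V.inclusion').obj V', hU, a, hx, ?_⟩
      refine Eq.trans ?_ ((congrArg (res (hmem V' h')) hs).trans ?_)
      · exact (res_res (X := X) h (hmem V' h') s).symm
      · exact res_res (X := X) h' (hmem V' h') (ι a)
    local_eq := fun U p a b hp h => h2 (hle U) p a b ⟨θ p, hp, rfl⟩ h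
    eq_of_local_eq := fun p a b h => by
      obtain ⟨U, hU, hx, hs⟩ := h3 p a b h
      refine ⟨(Opens.map V.inclusion').obj U, hx, ?_⟩
      refine Eq.trans ?_ ((congrArg (res (hmem U hU)) hs).trans ?_)
      · exact (res_res (X := X) hU (hmem U hU) (ι a)).symm
      · exact res_res (X := X) hU (hmem U hU) (ι b) }

theorem exists_mul_eq_one_of_locally {X : CInfRingedSpace.{u}} {U : Opens X.carrier} (s : Sec X U)
    (h : ∀ x ∈ U, ∃ (V : Opens X.carrier) (hV : V ≤ U), x ∈ V ∧ ∃ t, res hV s * t = 1) :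
    ∃ t, s * t = 1 := by
  choose V hV hxV t ht using fun x : U => h x.1 x.2
  obtain ⟨r, hr⟩ := sec_glue V hV (fun x hx => ⟨⟨x, hx⟩, hxV _⟩) t (fun i j => by
    have hi := congrArg (res (inf_le_left : V i ⊓ V j ≤ V i)).toRingHom (ht i)
    have hj := congrArg (res (inf_le_right : V i ⊓ V j ≤ V j)).toRingHom (ht j)
    rw [map_mul, map_one] at hi hj
    refine left_inv_eq_right_inv (a := res (inf_le_left.trans (hV i)) s)
      ((mul_comm _ _).trans ?_) ?_
    · rw [← hi]; exact congrArg (· * _) (res_res (hV i) inf_le_left s).symm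
    · rw [← hj]; exact congrArg (· * _) (res_res (hV j) inf_le_right s).symm)
  refine ⟨r, sec_ext fun x hx => ⟨V ⟨x, hx⟩, hV _, hxV _, ?_⟩⟩
  refine (map_mul (res (hV ⟨x, hx⟩)).toRingHom s r).trans ?_
  refine Eq.trans ?_ (map_one (res (hV ⟨x, hx⟩)).toRingHom).symm
  exact (congrArg (_ * ·) (hr _)).trans (ht _)

/-- A sheaf of modules is locally finitely generated. -/
def LocallyFG {X : CInfRingedSpace.{u}} (F : X.Modules) : Prop :=
  ∀ x : X.carrier, ∃ (U : Opens X.carrier) (n : ℕ) (q : Fin n → MSec F U), x ∈ U ∧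
    ∀ (V : Opens X.carrier) (hV : V ≤ U) (s : MSec F V), ∀ y ∈ V,
      ∃ (V' : Opens X.carrier) (h : V' ≤ V) (a : Fin n → Sec X V'), y ∈ V' ∧
        mres h s = ∑ i, a i • mres (h.trans hV) (q i)


end CInfRingedSpace

namespace CInfRingedSpace

open CInfRing AlgebraicGeometry

section SqZeroChart

variable {X : CInfRingedSpace.{u}} {D : Type u} [CInfRing D] (j : Spec D ⟶ X)
  [hj : PresheafedSpace.IsOpenImmersion j.hom]

/-- The inverse of the parametrization of a chart. -/
noncomputable def coord {V : Opens X.carrier} (hV : V ≤ rangeOpens j) (y : V) : RPoint D :=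
  (isOpenEmbedding_img j).isEmbedding.toHomeomorph.symm
    ⟨y.1, exists_eq_img j (hV y.2)⟩

theorem img_coord {V : Opens X.carrier} (hV : V ≤ rangeOpens j) (y : V) :
    img j (coord j hV y) = y.1 :=
  congrArg Subtype.val ((isOpenEmbedding_img j).isEmbedding.toHomeomorph.apply_symm_apply
    ⟨y.1, exists_eq_img j (hV y.2)⟩)

theorem continuous_coord {V : Opens X.carrier} (hV : V ≤ rangeOpens j) :
    Continuous (coord j hV) :=
  (Homeomorph.continuous _).comp (Continuous.subtype_mk continuous_subtype_val _)

variable {F : X.Modules} {V : Opens X.carrier} (hV : V ≤ rangeOpens j) {n m : ℕ} (x : Fin n → D)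
  (r : Sec X V) (q : Fin m → MSec F V)

/-- Generators of a square-zero extension. -/
def sqZeroGen : Set (SqZero (Sec X V) (MSec F V)) :=
  Set.range (fun i => SqZero.inl (dsec j hV (x i))) ∪
    ({SqZero.inl r} ∪ Set.range fun k => SqZero.inr (q k))

theorem finite_sqZeroGen : (sqZeroGen j hV x r q).Finite :=
  (Set.finite_range _).union ((Set.finite_singleton _).union (Set.finite_range _))

/-- The coordinate ring of a square-zero extension over a principal open subset of a chart. -/
abbrev SqZeroRing : Type u := Adjoin (sqZeroGen j hV x r q)

variable {x} (hx : ∀ d : D, ∃ f : SmoothFun n, d = op f x)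

/-- The inclusion of the ring of the chart. -/
noncomputable def sqZeroInl : CInfRingHom D (SqZeroRing j hV x r q) where
  toFun d := ⟨SqZero.inl (dsec j hV d), Adjoin.mem_of_generators (SqZero.inl.comp (dsec j hV)) hx
    (fun i => .of (.inl ⟨i, rfl⟩)) d⟩
  map_op f c := Subtype.ext ((SqZero.inl.comp (dsec j hV)).map_op f c)

/-- The inverse of the function defining the principal open subset. -/
noncomputable def sqZeroInv : SqZeroRing j hV x r q := ⟨SqZero.inl r, .of (.inr (.inl rfl))⟩

/-- The elements of square zero. -/
noncomputable def sqZeroInr (k : Fin m) : SqZeroRing j hV x r q :=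
  ⟨SqZero.inr (q k), .of (.inr (.inr ⟨k, rfl⟩))⟩

theorem rpoint_sqZeroInr (P : RPoint (SqZeroRing j hV x r q)) (k : Fin m) :
    P (sqZeroInr j hV r q k) = 0 := by
  have h : sqZeroInr j hV (x := x) r q k * sqZeroInr j hV r q k = 0 :=
    Adjoin.incl_injective (((map_mul Adjoin.incl.toRingHom _ _).trans
      (SqZero.inr_mul_inr _ _)).trans (map_zero Adjoin.incl.toRingHom).symm)
  have h' := congrArg P.toFun h
  change P (_ * _) = P 0 at h'
  rw [P.map_mul, P.map_zero] at h'
  exact mul_self_eq_zero.1 h'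

variable {r} {d : D} (hr : dsec j hV d * r = 1)

include hr in
theorem rpoint_sqZeroInv (P : RPoint (SqZeroRing j hV x r q)) :
    P (sqZeroInl j hV r q hx d) * P (sqZeroInv j hV r q) = 1 := by
  have h : sqZeroInl j hV r q hx d * sqZeroInv j hV r q = 1 :=
    Adjoin.incl_injective (((map_mul Adjoin.incl.toRingHom _ _).trans
      ((map_mul (SqZero.inl (C := Sec X V) (M := MSec F V)).toRingHom (dsec j hV d) r).symm.trans
      ((congrArg _ hr).trans (map_one _)))).trans (map_one Adjoin.incl.toRingHom).symm)
  rw [← P.map_mul, h, P.map_one]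

include hr in
theorem rpoint_sqZeroRing_ext {P P' : RPoint (SqZeroRing j hV x r q)}
    (h : P.comp (sqZeroInl j hV r q hx) = P'.comp (sqZeroInl j hV r q hx)) : P = P' := by
  have h' : ∀ d, P (sqZeroInl j hV r q hx d) = P' (sqZeroInl j hV r q hx d) :=
    fun d => congrArg (fun p : RPoint D => p d) h
  refine Adjoin.rpoint_ext ?_
  rintro _ (⟨i, rfl⟩ | rfl | ⟨k, rfl⟩)
  · exact h' (x i)
  · have h1 := rpoint_sqZeroInv j hV q hx hr P
    have h2 := rpoint_sqZeroInv j hV q hx hr P'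
    rw [h'] at h1
    exact mul_left_cancel₀ (left_ne_zero_of_mul_eq_one h2) (h1.trans h2.symm)
  · exact (rpoint_sqZeroInr j hV r q P k).trans (rpoint_sqZeroInr j hV r q P' k).symm

/-- The point of the coordinate ring over a point of the open subset. -/
noncomputable def sqZeroPoint (r : Sec X V) (p : RPoint D) (hp : img j p ∈ V) :
    RPoint (SqZeroRing j hV x r q) :=
  (evalAt j p hp).comp (SqZero.fstHom.comp Adjoin.incl)

theorem sqZeroPoint_inl (p : RPoint D) (hp : img j p ∈ V) (d : D) :
    sqZeroPoint j hV q r p hp (sqZeroInl j hV r q hx d) = p d :=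
  evalAt_dsec j hV p hp d

theorem sqZeroPoint_comp_inl (p : RPoint D) (hp : img j p ∈ V) :
    (sqZeroPoint j hV q r p hp).comp (sqZeroInl j hV r q hx) = p :=
  RPoint.ext' fun d => sqZeroPoint_inl j hV q hx p hp d

include hr in
theorem eq_sqZeroPoint (P : RPoint (SqZeroRing j hV x r q))
    (hp : img j (P.comp (sqZeroInl j hV r q hx)) ∈ V) :
    P = sqZeroPoint j hV q r (P.comp (sqZeroInl j hV r q hx)) hp :=
  rpoint_sqZeroRing_ext j hV q hx hr (sqZeroPoint_comp_inl j hV q hx _ hp).symm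

variable (hd : ∀ p : RPoint D, p d ≠ 0 → img j p ∈ V)

/-- The homeomorphism of the spectrum with the open subset. -/
noncomputable def sqZeroHomeo : RPoint (SqZeroRing j hV x r q) ≃ₜ V where
  toFun P := ⟨img j (P.comp (sqZeroInl j hV r q hx)), hd _
    (left_ne_zero_of_mul_eq_one (rpoint_sqZeroInv j hV q hx hr P))⟩
  invFun y := sqZeroPoint j hV q r (coord j hV y) ((img_coord j hV y).symm ▸ y.2)
  left_inv P := by
    refine rpoint_sqZeroRing_ext j hV q hx hr ?_
    rw [sqZeroPoint_comp_inl]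
    exact (isOpenEmbedding_img j).injective (img_coord j hV _)
  right_inv y := Subtype.ext (by
    dsimp only
    rw [sqZeroPoint_comp_inl, img_coord])
  continuous_toFun := Continuous.subtype_mk ((isOpenEmbedding_img j).continuous.comp
    (RPoint.continuous_comp _)) _
  continuous_invFun := by
    have hc : ∀ d, Continuous fun y : V => coord j hV y d := fun d =>
      (continuous_eval d).comp (continuous_coord j hV)
    refine Adjoin.continuous_of ?_
    rintro _ (⟨i, rfl⟩ | rfl | ⟨k, rfl⟩)
    · refine (hc (x i)).congr fun y => ?_
      exact (sqZeroPoint_inl j hV q hx _ _ (x i)).symm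
    · have h : ∀ y : V, coord j hV y d * sqZeroPoint (x := x) j hV q r (coord j hV y)
          ((img_coord j hV y).symm ▸ y.2) (sqZeroInv j hV r q) = 1 := fun y => by
        rw [← sqZeroPoint_inl j hV q hx (coord j hV y) ((img_coord j hV y).symm ▸ y.2)]
        exact rpoint_sqZeroInv j hV q hx hr _
      refine ((hc d).inv₀ fun y => left_ne_zero_of_mul_eq_one (h y)).congr fun y => ?_
      exact inv_eq_of_mul_eq_one_right (h y)
    · refine continuous_const (y := (0 : ℝ)).congr fun y => ?_
      exact (rpoint_sqZeroInr j hV r q (sqZeroPoint j hV q r _ _) k).symm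

include hx in
theorem exists_res_eq_incl (hq : ∀ (U : Opens X.carrier) (hU : U ≤ V) (s : MSec F U), ∀ y ∈ U,
      ∃ (V' : Opens X.carrier) (h : V' ≤ U) (a : Fin m → Sec X V'), y ∈ V' ∧
        mres h s = ∑ i, a i • mres (h.trans hU) (q i))
    {U : Opens X.carrier} (hU : U ≤ V) (s : SqZero (Sec X U) (MSec F U)) {p : RPoint D}
    (hp : img j p ∈ U) : ∃ (V' : Opens X.carrier) (h : V' ≤ U) (h' : V' ≤ V)
      (a : SqZeroRing j hV x r q), img j p ∈ V' ∧ res (X := sqZero F) h s =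
        res (X := sqZero F) h' (Adjoin.incl a) := by
  obtain ⟨V₁, hV₁, hV₁', c, hp₁, hc⟩ := exists_dsec j hp s.fst
  obtain ⟨V₂, hV₂, b, hp₂, hb⟩ := hq U hU s.snd _ hp
  choose V₃ hV₃ hV₃' a hp₃ ha using fun k => exists_dsec j hp₂ (b k)
  have l1 : V₁ ⊓ (V₂ ⊓ ⨅ k, V₃ k) ≤ V₁ := inf_le_left
  have l2 : V₁ ⊓ (V₂ ⊓ ⨅ k, V₃ k) ≤ V₂ := inf_le_right.trans inf_le_left
  have l3 : ∀ k, V₁ ⊓ (V₂ ⊓ ⨅ k, V₃ k) ≤ V₃ k := fun k =>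
    inf_le_right.trans (inf_le_right.trans (iInf_le V₃ k))
  refine ⟨V₁ ⊓ (V₂ ⊓ ⨅ k, V₃ k), l1.trans hV₁, (l1.trans hV₁).trans hU,
    sqZeroInl j hV r q hx c + ∑ k, sqZeroInl j hV r q hx (a k) * sqZeroInr j hV r q k,
    ⟨hp₁, hp₂, ?_⟩, ?_⟩
  · rw [Opens.coe_iInf, Set.mem_iInter]
    exact hp₃
  · have h1 : Adjoin.incl (sqZeroInl j hV r q hx c +
        ∑ k, sqZeroInl j hV r q hx (a k) * sqZeroInr j hV r q k) =
        (⟨dsec j hV c, ∑ k, dsec j hV (a k) • q k⟩ : SqZero (Sec X V) (MSec F V)) := by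
      have h2 : ∀ k, Adjoin.incl (sqZeroInl j hV r q hx (a k) * sqZeroInr j hV r q k) =
          (SqZero.inr (dsec j hV (a k) • q k) : SqZero (Sec X V) (MSec F V)) := fun k => by
        refine (map_mul Adjoin.incl.toRingHom _ _).trans (SqZero.ext ?_ ?_)
        · exact (SqZero.fst_mul _ _).trans (mul_zero _)
        · refine (SqZero.snd_mul _ _).trans ?_
          change (0 : Sec X V) • (0 : MSec F V) + dsec j hV (a k) • q k = _
          rw [zero_smul, zero_add]
          rfl
      refine (map_add Adjoin.incl.toRingHom _ _).trans ((congrArg₂ (· + ·) rfl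
        ((map_sum Adjoin.incl.toRingHom _ _).trans
          (Finset.sum_congr rfl fun k _ => h2 k))).trans (SqZero.ext ?_ ?_))
      · refine (SqZero.fst_add _ _).trans ((congrArg₂ (· + ·) rfl
          ((map_sum SqZero.fstHom.toRingHom _ _).trans
            (Finset.sum_eq_zero fun k _ => rfl))).trans (add_zero _))
      · exact (SqZero.snd_add _ _).trans ((congrArg₂ (· + ·) rfl
          (map_sum (SqZero.sndHom (C := Sec X V) (M := MSec F V)) _ _)).trans (zero_add _))
    refine Eq.trans ?_ (congrArg (res (X := sqZero F) _) h1).symm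
    refine SqZero.ext ?_ ?_
    · change res (X := X) _ s.fst = res (X := X) _ (dsec j hV c)
      rw [← res_res hV₁ l1, hc, res_dsec, res_dsec]
    · change mres (F := F) _ s.snd = mres (F := F) _ (∑ k, dsec j hV (a k) • q k)
      rw [← mres_mres hV₂ l2, hb, map_sum, map_sum]
      refine Finset.sum_congr rfl fun k _ => ?_
      rw [map_smulₛₗ, map_smulₛₗ, mres_mres]
      congr 1
      change res (X := X) l2 (b k) = res (X := X) _ (dsec j hV (a k))
      rw [← res_res (hV₃ k) (l3 k), ha, res_dsec, res_dsec]

theorem toLocalAt_eq_of_res_eq {U : Opens X.carrier} (hU : U ≤ V)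
    (P : RPoint (SqZeroRing j hV x r q)) {a b : SqZeroRing j hV x r q}
    (hP : img j (P.comp (sqZeroInl j hV r q hx)) ∈ U)
    (h : res (X := sqZero F) hU (Adjoin.incl a) = res (X := sqZero F) hU (Adjoin.incl b)) :
    toLocalAt P a = toLocalAt P b := by
  obtain ⟨χ, hχ, hχ'⟩ := exists_bump (p := P.comp (sqZeroInl j hV r q hx))
    (U := (img j) ⁻¹' U) (U.2.preimage (isOpenEmbedding_img j).continuous) hP
  refine toLocalAt_eq_iff.2 ⟨sqZeroInl j hV r q hx χ, hχ, Adjoin.incl_injective ?_⟩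
  have hmul : ∀ a, Adjoin.incl (sqZeroInl j hV r q hx χ * a) =
      SqZero.inl (dsec j hV χ) * Adjoin.incl a := fun a => map_mul Adjoin.incl.toRingHom _ _
  rw [hmul, hmul]
  refine sec_ext (X := sqZero F) fun y hy => ?_
  by_cases hyU : y ∈ U
  · refine ⟨U, hU, hyU, ?_⟩
    refine (map_mul (res (X := sqZero F) hU).toRingHom _ _).trans
      (Eq.trans ?_ (map_mul (res (X := sqZero F) hU).toRingHom _ _).symm)
    exact congrArg _ h
  · obtain ⟨p, rfl⟩ := exists_eq_img j (hV hy)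
    obtain ⟨e, he, heχ⟩ := hχ' p hyU
    obtain ⟨V', hV', hpV', t, ht⟩ := exists_isUnit_res j hy (dsec j hV e)
      (by rwa [evalAt_dsec])
    have h0 : res (X := X) hV' (dsec j hV χ) = 0 := by
      have h1 : res hV' (dsec j hV e) * res hV' (dsec j hV χ) = 0 := by
        rw [res_dsec, res_dsec]
        refine (map_mul (dsec j (hV'.trans hV)).toRingHom e χ).symm.trans ?_
        rw [heχ]
        exact map_zero (dsec j (hV'.trans hV)).toRingHom
      have h2 : t * _ = t * _ := congrArg (t * ·) h1
      rwa [← mul_assoc, mul_comm t, ht, one_mul, mul_zero] at h2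
    have h0' : res (X := sqZero F) hV' (SqZero.inl (dsec j hV χ) :
        SqZero (Sec X V) (MSec F V)) = 0 :=
      (congrArg (fun c : Sec X V' => (SqZero.inl c : SqZero (Sec X V') (MSec F V')))
        h0).trans (map_zero (SqZero.inl (C := Sec X V') (M := MSec F V')).toRingHom) |>.symm ▸
        SqZero.ext rfl (map_zero _)
    have h1 : ∀ a : SqZero (Sec X V) (MSec F V), res (X := sqZero F) hV'
        ((SqZero.inl (dsec j hV χ) : SqZero (Sec X V) (MSec F V)) * a) = 0 := fun a =>
      (map_mul (res (X := sqZero F) hV').toRingHom _ _).trans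
        ((congrArg (· * _) h0').trans (zero_mul _))
    exact ⟨V', hV', hpV', (h1 _).trans (h1 _).symm⟩

include hr in
theorem exists_res_eq_of_toLocalAt_eq (P : RPoint (SqZeroRing j hV x r q))
    (hP : img j (P.comp (sqZeroInl j hV r q hx)) ∈ V) {a b : SqZeroRing j hV x r q}
    (h : toLocalAt P a = toLocalAt P b) : ∃ (U : Opens X.carrier) (hU : U ≤ V),
      img j (P.comp (sqZeroInl j hV r q hx)) ∈ U ∧
        res (X := sqZero F) hU (Adjoin.incl a) = res (X := sqZero F) hU (Adjoin.incl b) := by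
  obtain ⟨t, ht, hab⟩ := toLocalAt_eq_iff.1 h
  have ht' := congrArg (fun P : RPoint _ => P t) (eq_sqZeroPoint j hV q hx hr P hP)
  rw [ht'] at ht
  obtain ⟨U, hU, hPU, c, hc⟩ := exists_isUnit_res j hP (Adjoin.incl t).fst ht
  obtain ⟨c', hc'⟩ := SqZero.exists_mul_eq_one
    (a := (res (X := sqZero F) hU (Adjoin.incl t) : SqZero (Sec X U) (MSec F U))) hc
  refine ⟨U, hU, hPU, ?_⟩
  have hmul : ∀ a, res (X := sqZero F) hU (Adjoin.incl (t * a)) =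
      res (X := sqZero F) hU (Adjoin.incl t) * res (X := sqZero F) hU (Adjoin.incl a) := fun a =>
    map_mul ((res (X := sqZero F) hU).comp Adjoin.incl).toRingHom t a
  have h1 := (hmul a).symm.trans
    ((congrArg (fun a => res (X := sqZero F) hU (Adjoin.incl a)) hab).trans (hmul b))
  exact (IsUnit.of_mul_eq_one (M := Sec (sqZero F) U) c' hc').mul_left_cancel h1

end SqZeroChart

/-- Square-zero extensions of locally fair schemes by locally finitely generated modules. -/
theorem isLocallyFair_sqZero {X : CInfRingedSpace.{u}} (hX : X.IsLocallyFair) {F : X.Modules}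
    (hF : LocallyFG F) : (sqZero F).IsLocallyFair := by
  have key : ∀ y : X.carrier, ∃ U : Opens X.carrier, y ∈ U ∧
      ∃ (C : Type u) (_ : CInfRing C), Fair C ∧
        Nonempty ((sqZero F).restrict U ≅ Spec C) := by
    intro y
    obtain ⟨U, hyU, D, _, hD, ⟨φ⟩⟩ := hX.2 y
    obtain ⟨j, hj, hjU⟩ := exists_openImmersion φ
    obtain ⟨p, rfl⟩ := hjU y hyU
    obtain ⟨n, x, hx⟩ := hD.1
    obtain ⟨U', m, q, hpU', hq⟩ := hF (img j p)
    obtain ⟨d, hd, hd'⟩ := exists_basic (p := p) (U := (img j) ⁻¹' U')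
      (U'.2.preimage (isOpenEmbedding_img j).continuous) hpU'
    let B : Opens (specTop D) := ⟨{p : RPoint D | p d ≠ 0}, isOpen_ne.preimage (continuous_eval d)⟩
    have hV : imgOpens j B ≤ rangeOpens j := imgOpens_le j B
    have hVU : imgOpens j B ≤ U' := by
      rintro _ ⟨p, hp, rfl⟩
      exact hd' p hp
    obtain ⟨r, hr⟩ := exists_mul_eq_one_of_locally (dsec j hV d) (fun y hy => by
      obtain ⟨p, rfl⟩ := exists_eq_img j (hV hy)
      refine exists_isUnit_res j hy (dsec j hV d) ?_
      rw [evalAt_dsec]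
      exact (mem_imgOpens j).1 hy)
    let q' : Fin m → MSec F (imgOpens j B) := fun k => mres hVU (q k)
    have hB : ∀ p : RPoint D, p d ≠ 0 → img j p ∈ imgOpens j B := fun p hp =>
      (mem_imgOpens j).2 hp
    let θ := sqZeroHomeo j hV q' hx hr hB
    have hθ : ∀ P, (θ P).1 = img j (P.comp (sqZeroInl j hV r q' hx)) := fun P => rfl
    refine ⟨imgOpens j B, hB p hd, SqZeroRing j hV x r q', inferInstance,
      ⟨Adjoin.finitelyGenerated (finite_sqZeroGen j hV x r q'), fun a ha => ?_⟩,
      ⟨(specChartRestrict (X := sqZero F) θ Adjoin.incl ?_ ?_ ?_).isoSpec⟩⟩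
    · refine Adjoin.incl_injective (sec_ext (X := sqZero F) fun y hy => ?_)
      obtain ⟨P, hP⟩ := θ.surjective ⟨y, hy⟩
      have hP' : img j (P.comp (sqZeroInl j hV r q' hx)) = y := congrArg Subtype.val hP
      obtain ⟨U, hU, hyU, h⟩ := exists_res_eq_of_toLocalAt_eq j hV q' hx hr P (hP' ▸ hy)
        ((ha P).trans (map_zero (toLocalAt P).toRingHom).symm)
      exact ⟨U, hU, hP' ▸ hyU, h⟩
    · intro U hU s y hy
      obtain ⟨p, rfl⟩ := exists_eq_img j (hV (hU hy))
      exact exists_res_eq_incl j hV q' hx (fun U hU s y hy => by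
        obtain ⟨V', h, a, hyV', ha⟩ := hq U (hU.trans hVU) s y hy
        exact ⟨V', h, a, hyV', ha.trans (Finset.sum_congr rfl fun k _ =>
          congrArg (a k • ·) (mres_mres _ _ _).symm)⟩) hU s hy
    · intro U hU P a b hP h
      exact toLocalAt_eq_of_res_eq j hV q' hx hU P hP h
    · intro P a b h
      exact exists_res_eq_of_toLocalAt_eq j hV q' hx hr P (θ P).2 h
  refine ⟨⟨isLocal_sqZero hX.1.1 F, fun y => ?_⟩, key⟩
  obtain ⟨U, hy, C, i, -, h⟩ := key y
  exact ⟨U, hy, C, i, h⟩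

end CInfRingedSpace

namespace CInfRingedSpace

open CInfRing AlgebraicGeometry

variable {W X Y : CInfRingedSpace.{u}}

/-! ### Subsheaves of modules -/

/-- A submodule of a sheaf of modules defined by a local condition is a sheaf. -/
noncomputable def subsheaf {Q : W.Modules} (N : Q.val.Submodule)
    (hN : ∀ (V : Opens W.carrier) (s : MSec Q V), (∀ y ∈ V, ∃ (V' : Opens W.carrier) (h : V' ≤ V),
      y ∈ V' ∧ mres h s ∈ N.obj (op V')) → s ∈ N.obj (op V)) : W.Modules where
  val := N.toPresheafOfModules
  isSheaf := by
    refine (TopCat.Presheaf.isSheaf_iff_isSheaf_comp (CategoryTheory.forget AddCommGrpCat.{u})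
      N.toPresheafOfModules.presheaf).2 ?_
    refine TopCat.Presheaf.isSheaf_of_isSheafUniqueGluing_types _ fun ι U s hs => ?_
    have h2 := TopCat.Presheaf.IsSheaf.isSheafUniqueGluing (F := Q.val.presheaf) Q.isSheaf U
      (show ∀ i, ToType (Q.val.presheaf.obj (op (U i))) from
        fun i => (s i : N.obj (op (U i))).1)
      (fun i j => congrArg Subtype.val (hs i j))
    obtain ⟨m, hm, hm'⟩ := h2
    have hmN : m ∈ N.obj (op (iSup U)) := by
      refine hN _ m fun y hy => ?_
      obtain ⟨i, hi⟩ := Opens.mem_iSup.1 hy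
      refine ⟨U i, le_iSup U i, hi, ?_⟩
      have : mres (le_iSup U i) m = (s i : N.obj (op (U i))).1 := hm i
      rw [this]
      exact (s i : N.obj (op (U i))).2
    exact ⟨(⟨m, hmN⟩ : N.obj (op (iSup U))), fun i => Subtype.ext (hm i), fun t ht =>
      Subtype.ext (hm' (t : N.obj (op (iSup U))).1 fun i => congrArg Subtype.val (ht i))⟩

section

variable {Q : W.Modules} (N : Q.val.Submodule)
    (hN : ∀ (V : Opens W.carrier) (s : MSec Q V), (∀ y ∈ V, ∃ (V' : Opens W.carrier) (h : V' ≤ V),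
      y ∈ V' ∧ mres h s ∈ N.obj (op V')) → s ∈ N.obj (op V))

/-- The inclusion of a subsheaf. -/
noncomputable def subsheafι : subsheaf N hN ⟶ Q where
  val := N.ι

instance : Mono (subsheafι N hN) :=
  (SheafOfModules.forget _).mono_of_mono_map (inferInstanceAs (Mono N.ι))

theorem exists_comp_subsheafι (e : W ⟶ X) (π : (pullback e).obj X.cotangent ⟶ Q)
    (h : ∀ V c, der e π V c ∈ N.obj (op ((Opens.map e.hom.base).obj V))) :
    ∃ α, α ≫ subsheafι N hN = π := by
  obtain ⟨α, hα⟩ := exists_der_eq e (subsheaf N hN)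
    (fun V c => (⟨der e π V c, h V c⟩ : N.obj (op ((Opens.map e.hom.base).obj V))))
    (fun V n f c => Subtype.ext ((der_op e π f c).trans
      (map_sum (N.obj (op ((Opens.map e.hom.base).obj V))).subtype
        (fun i => (show W.ringSheaf.obj.obj (op ((Opens.map e.hom.base).obj V)) from
          pull e V (CInfRing.op (f.pderiv i) c)) •
          (⟨der e π V (c i), h V (c i)⟩ : N.obj (op ((Opens.map e.hom.base).obj V))))
        Finset.univ).symm))
    (fun h c => Subtype.ext (der_res e π h c))
  refine ⟨α, der_injective e fun V c => ?_⟩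
  rw [der_comp, hα]
  rfl

/-- A subsheaf through which two jointly epimorphic morphisms factor is everything. -/
theorem mem_of_jointly_epi (e : W ⟶ X) (f : W ⟶ Y) (π : (pullback e).obj X.cotangent ⟶ Q)
    (π' : (pullback f).obj Y.cotangent ⟶ Q)
    (hπ : ∀ {G : W.Modules} (u v : Q ⟶ G), π ≫ u = π ≫ v → π' ≫ u = π' ≫ v → u = v)
    (hN : ∀ (V : Opens W.carrier) (s : MSec Q V), (∀ y ∈ V, ∃ (V' : Opens W.carrier) (h : V' ≤ V),
      y ∈ V' ∧ mres h s ∈ N.obj (op V')) → s ∈ N.obj (op V))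
    (h : ∀ V c, der e π V c ∈ N.obj (op ((Opens.map e.hom.base).obj V)))
    (h' : ∀ V c, der f π' V c ∈ N.obj (op ((Opens.map f.hom.base).obj V)))
    (V : Opens W.carrier) (s : MSec Q V) : s ∈ N.obj (op V) := by
  obtain ⟨α, hα⟩ := exists_comp_subsheafι N hN e π h
  obtain ⟨α', hα'⟩ := exists_comp_subsheafι N hN f π' h'
  have hepi : Epi (subsheafι N hN) := ⟨fun u v huv => by
    refine hπ u v ?_ ?_
    · rw [← hα, Category.assoc, Category.assoc, huv]
    · rw [← hα', Category.assoc, Category.assoc, huv]⟩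
  have hiso : IsIso (subsheafι N hN) := isIso_of_mono_of_epi _
  have h1 := congrArg (fun γ : Q ⟶ Q => γ.val.app (op V) s) (IsIso.inv_hom_id (subsheafι N hN))
  have h2 : ((inv (subsheafι N hN)).val.app (op V) s : N.obj (op V)).1 = s := h1
  rw [← h2]
  exact ((inv (subsheafι N hN)).val.app (op V) s : N.obj (op V)).2

end

/-! ### Local generation of quotients of cotangent sheaves -/

theorem mres_mem_span {Q : W.Modules} {U : Opens W.carrier} {T : Set (MSec Q U)}
    {V V' : Opens W.carrier} {h : V ≤ U} {s : MSec Q V}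
    (hs : s ∈ Submodule.span (Sec W V) (mres (F := Q) h '' T)) (h' : V' ≤ V) :
    mres h' s ∈ Submodule.span (Sec W V') (mres (F := Q) (h'.trans h) '' T) := by
  induction hs using Submodule.span_induction with
  | mem s hs =>
    obtain ⟨t, ht, rfl⟩ := hs
    rw [mres_mres]
    exact Submodule.subset_span ⟨t, ht, rfl⟩
  | zero => rw [map_zero]; exact zero_mem _
  | add s t _ _ hs ht => rw [map_add]; exact add_mem hs ht
  | smul a s _ hs => rw [map_smulₛₗ]; exact Submodule.smul_mem _ _ hs

/-- The sections over `V` which are, near every point of `U`, linear combinations of elements of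
a set of sections over `U`. -/
def locallySpanned (Q : W.Modules) {U : Opens W.carrier} (T : Set (MSec Q U)) :
    Q.val.Submodule where
  obj V :=
    { carrier := {s : MSec Q V.unop | ∀ y ∈ V.unop, y ∈ U → ∃ (V' : Opens W.carrier)
        (h : V' ≤ V.unop) (h' : V' ≤ U), y ∈ V' ∧
          mres h s ∈ Submodule.span (Sec W V') (mres (F := Q) h' '' T)}
      add_mem' := fun {s t} hs ht y hy hyU => by
        obtain ⟨V₁, h₁, h₁', hy₁, hs⟩ := hs y hy hyU
        obtain ⟨V₂, h₂, h₂', hy₂, ht⟩ := ht y hy hyU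
        refine ⟨V₁ ⊓ V₂, inf_le_left.trans h₁, inf_le_left.trans h₁', ⟨hy₁, hy₂⟩, ?_⟩
        have hs' := mres_mem_span hs (inf_le_left : V₁ ⊓ V₂ ≤ V₁)
        have ht' := mres_mem_span ht (inf_le_right : V₁ ⊓ V₂ ≤ V₂)
        rw [mres_mres] at hs' ht'
        refine (Submodule.mem_carrier _).1 ?_
        rw [show mres (F := Q) (inf_le_left.trans h₁ : V₁ ⊓ V₂ ≤ V.unop) (s + t) = _ from
          map_add _ _ _]
        exact add_mem hs' ht'
      zero_mem' := fun y hy hyU => ⟨V.unop ⊓ U, inf_le_left, inf_le_right, ⟨hy, hyU⟩, by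
        rw [show mres (F := Q) (inf_le_left : V.unop ⊓ U ≤ V.unop) 0 = 0 from map_zero _]
        exact zero_mem _⟩
      smul_mem' := fun a s hs y hy hyU => by
        obtain ⟨V₁, h₁, h₁', hy₁, hs⟩ := hs y hy hyU
        refine ⟨V₁, h₁, h₁', hy₁, ?_⟩
        have : mres (F := Q) h₁ ((show Sec W V.unop from a) • (show MSec Q V.unop from s)) = _ :=
          map_smulₛₗ (mres (F := Q) h₁) _ _
        exact this ▸ Submodule.smul_mem _ _ hs }
  map {V V'} i s hs y hy hyU := by
    obtain ⟨V₁, h₁, h₁', hy₁, hs⟩ := hs y (i.unop.le hy) hyU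
    refine ⟨V₁ ⊓ V'.unop, inf_le_right, inf_le_left.trans h₁', ⟨hy₁, hy⟩, ?_⟩
    have hs' := mres_mem_span hs (inf_le_left : V₁ ⊓ V'.unop ≤ V₁)
    rw [mres_mres] at hs'
    have : mres (F := Q) (inf_le_right : V₁ ⊓ V'.unop ≤ V'.unop) (mres i.unop.le s) = _ :=
      mres_mres _ _ _
    exact this ▸ hs'

theorem mem_locallySpanned_of_locally {Q : W.Modules} {U : Opens W.carrier} (T : Set (MSec Q U))
    (V : Opens W.carrier) (s : MSec Q V) (hs : ∀ y ∈ V, ∃ (V' : Opens W.carrier) (h : V' ≤ V),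
      y ∈ V' ∧ mres h s ∈ (locallySpanned Q T).obj (op V')) :
    s ∈ (locallySpanned Q T).obj (op V) := by
  intro y hy hyU
  obtain ⟨V', h, hyV', hs⟩ := hs y hy
  obtain ⟨V₁, h₁, h₁', hy₁, hs⟩ := hs y hyV' hyU
  refine ⟨V₁, h₁.trans h, h₁', hy₁, ?_⟩
  rwa [mres_mres] at hs

theorem der_mem_locallySpanned {D : Type u} [CInfRing D] (j : Spec D ⟶ X)
    [PresheafedSpace.IsOpenImmersion j.hom] {n : ℕ} {x : Fin n → D}
    (hx : ∀ d : D, ∃ f : SmoothFun n, d = op f x) (e : W ⟶ X) {Q : W.Modules}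
    (π : (pullback e).obj X.cotangent ⟶ Q) {U : Opens W.carrier}
    (hU : U ≤ (Opens.map e.hom.base).obj (rangeOpens j)) {T : Set (MSec Q U)}
    (hT : ∀ i, mres hU (der e π (rangeOpens j) (dsec j le_rfl (x i))) ∈ T)
    (V : Opens X.carrier) (c : Sec X V) :
    der e π V c ∈ (locallySpanned Q T).obj (op ((Opens.map e.hom.base).obj V)) := by
  intro y hy hyU
  obtain ⟨p, hp⟩ := exists_eq_img j (hU hyU)
  obtain ⟨V₁, h₁, h₁', d, hd, hcd⟩ := exists_dsec j (hp ▸ hy : img j p ∈ V) c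
  obtain ⟨f, rfl⟩ := hx d
  have hyV₁ : y ∈ (Opens.map e.hom.base).obj V₁ := (hp ▸ hd : e.hom.base y ∈ V₁)
  have l1 : (Opens.map e.hom.base).obj V₁ ⊓ U ≤ (Opens.map e.hom.base).obj V₁ := inf_le_left
  refine ⟨(Opens.map e.hom.base).obj V₁ ⊓ U, l1.trans ((Opens.map e.hom.base).monotone h₁),
    inf_le_right, ⟨hyV₁, hyU⟩, ?_⟩
  rw [← mres_mres ((Opens.map e.hom.base).monotone h₁) l1, ← der_res e π h₁, hcd,
    CInfRingHom.map_op', der_op, map_sum]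
  refine sum_mem fun i _ => ?_
  rw [map_smulₛₗ]
  refine Submodule.smul_mem _ _ (Submodule.subset_span ⟨_, hT i, ?_⟩)
  rw [← res_dsec j le_rfl h₁', der_res, mres_mres, mres_mres]

/-- Quotients of sums of pullbacks of cotangent sheaves are locally finitely generated. -/
theorem locallyFG_of_jointly_epi (hX : X.IsLocallyFair) (hY : Y.IsLocallyFair) (e : W ⟶ X)
    (f : W ⟶ Y) {Q : W.Modules} (π : (pullback e).obj X.cotangent ⟶ Q)
    (π' : (pullback f).obj Y.cotangent ⟶ Q)
    (hπ : ∀ {G : W.Modules} (u v : Q ⟶ G), π ≫ u = π ≫ v → π' ≫ u = π' ≫ v → u = v) :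
    LocallyFG Q := by
  intro w
  have key : ∀ {X : CInfRingedSpace.{u}} (_ : X.IsLocallyFair) (y : X.carrier),
      ∃ (D : Type u) (_ : CInfRing D) (j : Spec D ⟶ X)
        (_ : PresheafedSpace.IsOpenImmersion j.hom) (n : ℕ) (x : Fin n → D),
        (∀ d : D, ∃ f : SmoothFun n, d = op f x) ∧
        y ∈ rangeOpens j := by
    intro X hX y
    obtain ⟨U, hyU, D, _, hD, ⟨φ⟩⟩ := hX.2 y
    obtain ⟨j, hj, hjU⟩ := exists_openImmersion φ
    obtain ⟨p, rfl⟩ := hjU y hyU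
    obtain ⟨n, x, hx⟩ := hD.1
    exact ⟨D, _, j, hj, n, x, hx, mem_rangeOpens j p⟩
  obtain ⟨D, _, j, _, n, x, hx, hjw⟩ := key hX (e.hom.base w)
  obtain ⟨D', _, j', _, n', x', hx', hjw'⟩ := key hY (f.hom.base w)
  let U : Opens W.carrier := (Opens.map e.hom.base).obj (rangeOpens j) ⊓
    (Opens.map f.hom.base).obj (rangeOpens j')
  let t : Fin n ⊕ Fin n' → MSec Q U := Sum.elim
    (fun i => mres inf_le_left (der e π (rangeOpens j) (dsec j le_rfl (x i))))
    (fun i => mres inf_le_right (der f π' (rangeOpens j') (dsec j' le_rfl (x' i))))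
  refine ⟨U, n + n', fun i => t (finSumFinEquiv.symm i), ⟨hjw, hjw'⟩, fun V hV s y hy => ?_⟩
  have hs := mem_of_jointly_epi (locallySpanned Q (Set.range t)) e f π π' hπ
    (mem_locallySpanned_of_locally _)
    (der_mem_locallySpanned j hx e π inf_le_left fun i => ⟨.inl i, rfl⟩)
    (der_mem_locallySpanned j' hx' f π' inf_le_right fun i => ⟨.inr i, rfl⟩) V s
  obtain ⟨V', h, h', hyV', hs⟩ := hs y hy (hV hy)
  refine ⟨V', h, ?_⟩
  have hrange : mres (F := Q) h' '' Set.range t =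
      Set.range fun i => mres (F := Q) h' (t (finSumFinEquiv.symm i)) := by
    rw [← Set.range_comp]
    exact (finSumFinEquiv.symm.surjective.range_comp (mres (F := Q) h' ∘ t)).symm
  rw [hrange, Submodule.mem_span_range_iff_exists_fun] at hs
  obtain ⟨a, ha⟩ := hs
  exact ⟨a, hyV', ha.symm⟩

end CInfRingedSpace

namespace CInfRing

open CInfRingedSpace
open scoped TensorProduct

/-! ### Sheaves of modules on spectra -/

variable {C : Type u} [CInfRing C]

/-- The section of the structure sheaf of `Spec C` defined by an element of `C`. -/
noncomputable abbrev specSec (U : Opens (specTop C)) : CInfRingHom C (RegularFun U) :=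
  RegularFun.of U

theorem exists_specSec {U : Opens (specTop C)} (s : RegularFun U) {p : RPoint C} (hp : p ∈ U) :
    ∃ (V : Opens (specTop C)) (h : V ≤ U) (c : C), p ∈ V ∧
      RegularFun.res (homOfLE h) s = specSec V c := by
  obtain ⟨V, hpV, i, c, h⟩ := exists_of_isRegular s.2 ⟨p, hp⟩
  exact ⟨V, i.le, c, hpV, Subtype.ext (funext h)⟩

theorem exists_specSec_mul_eq_one {p : RPoint C} {c : C} (hc : p c ≠ 0) :
    ∃ (V : Opens (specTop C)) (e : C), p ∈ V ∧ specSec V e * specSec V c = 1 := by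
  obtain ⟨V, hV, hpV, e, he⟩ := exists_local_inverse c p hc
  exact ⟨⟨V, hV⟩, e, hpV, (mul_comm _ _).trans ((map_mul (specSec ⟨V, hV⟩).toRingHom c e).symm.trans
    (Eq.trans (Subtype.ext (funext fun q => (map_mul (toLocalAt q.1).toRingHom c e).trans
      ((he q.1 q.2).trans (map_one (toLocalAt q.1).toRingHom).symm)))
      (map_one (specSec ⟨V, hV⟩).toRingHom)))⟩

theorem specSec_eq_zero {V : Opens (specTop C)} {e c : C} (he : ∀ p ∈ V, RPoint.toFun p e ≠ 0)
    (h : e * c = 0) : specSec V c = 0 := by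
  refine Eq.trans (Subtype.ext (funext fun q => ?_)) (map_zero (specSec V).toRingHom)
  exact toLocalAt_eq_iff.2 ⟨e, he q.1 q.2, h.trans (mul_zero e).symm⟩

/-- Bump functions on spectra. -/
theorem exists_bump_specSec {U : Opens (specTop C)} {p : RPoint C} (hp : p ∈ U) :
    ∃ (c : C) (N : Opens (specTop C)), p c ≠ 0 ∧ (∀ q, q ∈ U ∨ q ∈ N) ∧ specSec N c = 0 := by
  obtain ⟨c, hc, h⟩ := exists_bump U.2 hp
  let ι := {e : C // e * c = 0}
  let B : C → Opens (specTop C) := fun e =>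
    ⟨{q : RPoint C | q e ≠ 0}, isOpen_ne.preimage (continuous_eval e)⟩
  refine ⟨c, ⨆ e : {e : C // e * c = 0}, B e.1, hc, fun q => ?_, ?_⟩
  · by_cases hq : q ∈ U
    · exact .inl hq
    · obtain ⟨e, he, hec⟩ := h q hq
      exact .inr (Opens.mem_iSup.2 ⟨⟨e, hec⟩, he⟩)
  · refine sec_ext (X := Spec C) fun q hq => ?_
    obtain ⟨e, he⟩ := Opens.mem_iSup.1 hq
    refine ⟨B e.1, le_iSup (fun e : {e : C // e * c = 0} => B e.1) e, he, ?_⟩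
    refine Eq.trans ?_ (map_zero (res (X := Spec C) _).toRingHom).symm
    exact specSec_eq_zero (fun _ hq => hq) e.2

/-- Sections of a sheaf of modules on a spectrum. -/
def SpecMod (E : (Spec C).Modules) (U : Opens (specTop C)) : Type u := MSec E U

noncomputable instance (E : (Spec C).Modules) (U : Opens (specTop C)) :
    AddCommGroup (SpecMod E U) :=
  inferInstanceAs (AddCommGroup (E.val.obj (Opposite.op U)))

noncomputable instance (E : (Spec C).Modules) (U : Opens (specTop C)) :
    Module (RegularFun U) (SpecMod E U) :=
  inferInstanceAs (Module ((Spec C).ringSheaf.obj.obj (Opposite.op U)) (E.val.obj (Opposite.op U)))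

/-- Restriction of regular functions. -/
noncomputable abbrev specRes {U V : Opens (specTop C)} (h : V ≤ U) :
    CInfRingHom (RegularFun U) (RegularFun V) := RegularFun.res (homOfLE h)

/-- Restriction of sections of a sheaf of modules. -/
noncomputable def specMRes {E : (Spec C).Modules} {U V : Opens (specTop C)} (h : V ≤ U) :
    SpecMod E U →ₛₗ[(specRes h).toRingHom] SpecMod E V :=
  mres (X := Spec C) (F := E) h

theorem specMRes_specMRes {E : (Spec C).Modules} {U V W : Opens (specTop C)} (h : V ≤ U)
    (h' : W ≤ V) (s : SpecMod E U) : specMRes h' (specMRes h s) = specMRes (h'.trans h) s :=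
  mres_mres (X := Spec C) (F := E) h h' s

/-- The global sections of a sheaf of modules on a spectrum. -/
def GlobalSec (E : (Spec C).Modules) : Type u := SpecMod E (⊤ : Opens (specTop C))

variable (E : (Spec C).Modules)

noncomputable instance : AddCommGroup (GlobalSec E) :=
  inferInstanceAs (AddCommGroup (SpecMod E (⊤ : Opens (specTop C))))

noncomputable instance : Module C (GlobalSec E) :=
  Module.compHom (SpecMod E (⊤ : Opens (specTop C))) (specSec (⊤ : Opens (specTop C))).toRingHom

/-- Restriction of global sections. -/
noncomputable def GlobalSec.res (U : Opens (specTop C)) : GlobalSec E →+ SpecMod E U :=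
  (specMRes (E := E) (le_top : U ≤ ⊤)).toAddMonoidHom

variable {E}

theorem GlobalSec.res_smul (U : Opens (specTop C)) (c : C) (m : GlobalSec E) :
    GlobalSec.res E U (c • m) = specSec U c • GlobalSec.res E U m :=
  (specMRes (E := E) (le_top : U ≤ ⊤)).map_smulₛₗ (specSec ⊤ c) m

theorem GlobalSec.specMRes_res {U V : Opens (specTop C)} (h : V ≤ U) (m : GlobalSec E) :
    specMRes h (GlobalSec.res E U m) = GlobalSec.res E V m :=
  specMRes_specMRes _ _ _

variable (E) in
/-- The map `𝒪(U) ⊗ Γ(E) → E(U)`. -/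
noncomputable def tensorEval (U : Opens (specTop C)) : baseChange (GlobalSec E) U →+ SpecMod E U :=
  TensorProduct.liftAddHom
    { toFun := fun s : RegularFun U =>
        (DistribSMul.toAddMonoidHom (SpecMod E U) s).comp
          (GlobalSec.res E U)
      map_zero' := AddMonoidHom.ext fun m => zero_smul (RegularFun U) (GlobalSec.res E U m)
      map_add' := fun s t => AddMonoidHom.ext fun m =>
        add_smul s t (GlobalSec.res E U m) }
    fun c s m => by
      change (c • s) • GlobalSec.res E U m =
        s • GlobalSec.res E U (c • m)
      rw [GlobalSec.res_smul, smul_smul, mul_comm]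
      congr 1

theorem tensorEval_tmul (U : Opens (specTop C)) (s : RegularFun U) (m : GlobalSec E) :
    tensorEval E U (s ⊗ₜ m) = s • GlobalSec.res E U m := rfl

theorem tensorEval_smul (U : Opens (specTop C)) (s : RegularFun U)
    (t : baseChange (GlobalSec E) U) :
    tensorEval E U (s • t) = s • tensorEval E U t := by
  induction t using TensorProduct.induction_on with
  | zero => rw [smul_zero, map_zero, smul_zero]
  | add t t' h h' => rw [smul_add, map_add, map_add, smul_add, h, h']
  | tmul r m =>
    rw [TensorProduct.smul_tmul', tensorEval_tmul, tensorEval_tmul, smul_smul]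
    rfl

theorem tensorEval_res {U V : Opens (specTop C)} (i : V ⟶ U) (t : baseChange (GlobalSec E) U) :
    tensorEval E V ((RegularFun.resLinear i).rTensor _ t) = specMRes i.le (tensorEval E U t) := by
  induction t using TensorProduct.induction_on with
  | zero => simp only [map_zero]
  | add t t' h h' => simp only [map_add, h, h']
  | tmul r m =>
    rw [LinearMap.rTensor_tmul, tensorEval_tmul, tensorEval_tmul, map_smulₛₗ,
      GlobalSec.specMRes_res]
    rfl

variable (E) in
/-- The map `𝒪(U) ⊗ Γ(E) → E(U)` as a morphism of modules. -/
noncomputable def tensorEvalApp (U : Opens (specTop C)) :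
    preMSpecObj (GlobalSec E) (Opposite.op U) ⟶ E.val.obj (Opposite.op U) :=
  ModuleCat.ofHom (R := RegularFun U) (X := baseChange (GlobalSec E) U)
    (Y := SpecMod E U)
    { toFun := tensorEval E U
      map_add' := map_add _
      map_smul' := tensorEval_smul U }

variable (E) in
/-- The canonical morphism to a sheaf of modules from the presheaf defined by its global
sections. -/
noncomputable def tensorEvalHom : preMSpec (GlobalSec E) ⟶ E.val where
  app U := tensorEvalApp E U.unop
  naturality i := ModuleCat.hom_ext (LinearMap.ext fun t => tensorEval_res i.unop t)

theorem exists_eq_one_tmul {M : Type u} [AddCommGroup M] [Module C M] {U : Opens (specTop C)}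
    (t : baseChange M U) {p : RPoint C} (hp : p ∈ U) :
    ∃ (V : Opens (specTop C)) (i : V ⟶ U) (m : M), p ∈ V ∧
      (RegularFun.resLinear i).rTensor M t = 1 ⊗ₜ m := by
  induction t using TensorProduct.induction_on with
  | zero => exact ⟨U, 𝟙 U, 0, hp, by rw [map_zero, TensorProduct.tmul_zero]⟩
  | add t t' h h' =>
    obtain ⟨V, i, m, hpV, h⟩ := h
    obtain ⟨V', i', m', hpV', h'⟩ := h'
    refine ⟨V ⊓ V', homOfLE inf_le_left ≫ i, m + m', ⟨hpV, hpV'⟩, ?_⟩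
    rw [map_add, rTensor_res_comp, h, show homOfLE inf_le_left ≫ i = homOfLE inf_le_right ≫ i'
      from rfl, rTensor_res_comp, h', LinearMap.rTensor_tmul, LinearMap.rTensor_tmul,
      TensorProduct.tmul_add]
    congr 2
    · exact map_one (RegularFun.res (homOfLE (inf_le_left : V ⊓ V' ≤ V))).toRingHom
    · exact map_one (RegularFun.res (homOfLE (inf_le_right : V ⊓ V' ≤ V'))).toRingHom
  | tmul s m =>
    obtain ⟨V, h, c, hpV, hs⟩ := exists_specSec s hp
    refine ⟨V, homOfLE h, c • m, hpV, ?_⟩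
    rw [LinearMap.rTensor_tmul, ← TensorProduct.smul_tmul, Algebra.smul_def, mul_one]
    congr 1

theorem exists_rTensor_eq_zero {U : Opens (specTop C)} {t : baseChange (GlobalSec E) U}
    (ht : tensorEval E U t = 0) {p : RPoint C} (hp : p ∈ U) :
    ∃ (V : Opens (specTop C)) (i : V ⟶ U), p ∈ V ∧ (RegularFun.resLinear i).rTensor _ t = 0 := by
  obtain ⟨V, i, m, hpV, hm⟩ := exists_eq_one_tmul t hp
  have hmV : GlobalSec.res E V m = 0 := by
    have h := tensorEval_res i t
    rw [hm, ht, map_zero, tensorEval_tmul] at h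
    exact (one_smul (RegularFun V) _).symm.trans h
  obtain ⟨c, N, hc, hN, hcN⟩ := exists_bump_specSec hpV
  have hcm : c • m = 0 := by
    refine msec_ext (F := E) (U := (⊤ : Opens (specTop C))) fun q _ => ?_
    rcases hN q with hq | hq
    · refine ⟨V, le_top, hq, (GlobalSec.res_smul V c m).trans ?_⟩
      rw [hmV, smul_zero]
      exact (map_zero (GlobalSec.res E V)).symm
    · refine ⟨N, le_top, hq, (GlobalSec.res_smul N c m).trans ?_⟩
      rw [hcN, zero_smul]
      exact (map_zero (GlobalSec.res E N)).symm
  obtain ⟨V', e, hpV', he⟩ := exists_specSec_mul_eq_one hc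
  refine ⟨V ⊓ V', homOfLE inf_le_left ≫ i, ⟨hpV, hpV'⟩, ?_⟩
  rw [rTensor_res_comp, hm, LinearMap.rTensor_tmul]
  have h1 : RegularFun.resLinear (homOfLE (inf_le_left : V ⊓ V' ≤ V)) 1 =
      c • (RegularFun.of (V ⊓ V') e : RegularFun (V ⊓ V')) := by
    rw [Algebra.smul_def]
    refine (map_one (RegularFun.res (homOfLE (inf_le_left : V ⊓ V' ≤ V))).toRingHom).trans ?_
    refine Eq.trans ?_ (mul_comm _ _)
    have h2 := congrArg (specRes (inf_le_right : V ⊓ V' ≤ V')).toRingHom he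
    rw [map_one, map_mul] at h2
    exact h2.symm
  rw [h1, TensorProduct.smul_tmul, hcm, TensorProduct.tmul_zero]

theorem exists_tensorEval_eq {U : Opens (specTop C)} (s : SpecMod E U) {p : RPoint C} (hp : p ∈ U) :
    ∃ (V : Opens (specTop C)) (h : V ≤ U) (t : baseChange (GlobalSec E) V), p ∈ V ∧
      tensorEval E V t = specMRes h s := by
  obtain ⟨c, N, hc, hN, hcN⟩ := exists_bump_specSec hp
  obtain ⟨(m : GlobalSec E), hm⟩ := msec_glue (F := E) (ι := ULift.{u} Bool)
    (U := (⊤ : Opens (specTop C)))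
    (fun b => if b.down then U else N) (fun _ => le_top)
    (fun q _ => (hN q).elim (fun h => ⟨⟨true⟩, h⟩) (fun h => ⟨⟨false⟩, h⟩))
    (fun b => match b with
      | ⟨true⟩ => specSec U c • s
      | ⟨false⟩ => 0) (by
    have h0 : ∀ {V : Opens (specTop C)} (h : V ≤ U) (_ : V ≤ N),
        specMRes h (specSec U c • s) = 0 := fun {V} h h' => by
      rw [map_smulₛₗ]
      have : (specRes h).toRingHom (specSec U c) = 0 := by
        refine (congrArg (specRes h') hcN).trans ?_
        exact map_zero (specRes h').toRingHom
      rw [this, zero_smul]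
    rintro ⟨_ | _⟩ ⟨_ | _⟩
    · rfl
    · exact (map_zero _).trans (h0 (V := N ⊓ U) inf_le_right inf_le_left).symm
    · exact (h0 (V := U ⊓ N) inf_le_left inf_le_right).trans (map_zero _).symm
    · rfl)
  have hmU : GlobalSec.res E U m = specSec U c • s := hm ⟨true⟩
  obtain ⟨V, e, hpV, he⟩ := exists_specSec_mul_eq_one hc
  refine ⟨V ⊓ U, inf_le_right, RegularFun.of (V ⊓ U) e ⊗ₜ m, ⟨hpV, hp⟩, ?_⟩
  rw [tensorEval_tmul, ← GlobalSec.specMRes_res (inf_le_right : V ⊓ U ≤ U), hmU,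
    map_smulₛₗ, smul_smul]
  have h2 := congrArg (specRes (inf_le_left : V ⊓ U ≤ V)).toRingHom he
  rw [map_one, map_mul] at h2
  exact (congrArg (· • _) h2).trans (one_smul _ _)

variable (E) in
/-- Sheaves of modules on spectra are determined by their global sections. -/
theorem nonempty_iso_MSpec : Nonempty (E ≅ MSpec (GlobalSec E)) := by
  have h1 : Presheaf.IsLocallyInjective (Opens.grothendieckTopology (specTop C))
      ((PresheafOfModules.toPresheaf _).map (tensorEvalHom E)) := by
    refine ⟨fun {U} (t t' : baseChange (GlobalSec E) U.unop) h p hp => ?_⟩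
    have h0 : tensorEval E U.unop (t - t') = 0 := by
      rw [map_sub, sub_eq_zero]
      exact h
    obtain ⟨V, i, hpV, hV⟩ := exists_rTensor_eq_zero h0 hp
    rw [map_sub, sub_eq_zero] at hV
    exact ⟨V, i, hV, hpV⟩
  have h2 : Presheaf.IsLocallySurjective (Opens.grothendieckTopology (specTop C))
      ((PresheafOfModules.toPresheaf _).map (tensorEvalHom E)) := by
    refine ⟨fun {U} (s : MSec E U) p hp => ?_⟩
    obtain ⟨V, h, t, hpV, ht⟩ := exists_tensorEval_eq s hp
    exact ⟨V, homOfLE h, ⟨t, ht⟩, hpV⟩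
  have h3 : (MorphismProperty.isomorphisms _).inverseImage (Spec C).sheafify (tensorEvalHom E) := by
    rw [← PresheafOfModules.inverseImage_W_toPresheaf_eq_inverseImage_isomorphisms]
    exact GrothendieckTopology.W_of_isLocallyBijective (Opens.grothendieckTopology (specTop C))
      ((PresheafOfModules.toPresheaf _).map (tensorEvalHom E))
  have h4 : IsIso ((Spec C).sheafify.map (tensorEvalHom E)) := h3
  let κ : (Spec C).sheafify.obj E.val ≅ E :=
    (asIso (PresheafOfModules.sheafificationAdjunction (𝟙 (Spec C).ringSheaf.obj)).counit).app E
  exact ⟨(asIso ((Spec C).sheafify.map (tensorEvalHom E)) ≪≫ κ).symm⟩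

end CInfRing

namespace CInfRingedSpace

/-- All sheaves of modules on `C^∞`-schemes are quasicoherent. -/
theorem isQuasicoherent_of_isScheme {X : CInfRingedSpace.{u}} (hX : X.IsScheme) (E : X.Modules) :
    X.IsQuasicoherent E := by
  intro x
  obtain ⟨U, hx, C, _, ⟨φ⟩⟩ := hX.2 x
  exact ⟨U, hx, C, _, φ.symm, _, _, _, CInfRing.nonempty_iso_MSpec _⟩

end CInfRingedSpace

namespace CInfRingedSpace

variable {W X Y Z : CInfRingedSpace.{u}}

theorem pullbackCongr_app_Omega {u v : X ⟶ Z} (h : u = v) :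
    (pullbackCongr h).hom.app Z.cotangent ≫ Omega v = Omega u := by
  subst h
  simp [pullbackCongr]

theorem squareLeft_squareRight (e : W ⟶ X) (f : W ⟶ Y) (g : X ⟶ Z) (h : Y ⟶ Z)
    (comm : e ≫ g = f ≫ h) : squareLeft e f g h comm ≫ squareRight e f = 0 := by
  have h1 := (Omega_comp e g).symm
  have h2 := pullbackCongr_app_Omega comm
  rw [Omega_comp f h] at h2
  simp only [squareLeft, squareRight, biprod.lift_desc, Category.assoc, Preadditive.neg_comp,
    h1, h2]
  exact add_neg_cancel _

/-- Quasicoherent sheaves on a scheme form an exact full subcategory. -/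
theorem isRightExactSequence_qcoh (hX : X.IsScheme) {A B C : X.Modules} {a : A ⟶ B} {b : B ⟶ C}
    (h : IsRightExactSequence a b) (hA : X.IsQuasicoherent A) (hB : X.IsQuasicoherent B)
    (hC : X.IsQuasicoherent C) :
    IsRightExactSequence (ObjectProperty.homMk a : (⟨A, hA⟩ : X.QCoh) ⟶ ⟨B, hB⟩)
      (ObjectProperty.homMk b : (⟨B, hB⟩ : X.QCoh) ⟶ ⟨C, hC⟩) := by
  let R : X.Modules ⥤ X.QCoh := ObjectProperty.lift _ (𝟭 X.Modules) (isQuasicoherent_of_isScheme hX)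
  have hR : R.IsEquivalence :=
    { faithful := inferInstanceAs (ObjectProperty.lift _ (𝟭 X.Modules) _).Faithful
      full := inferInstanceAs (ObjectProperty.lift _ (𝟭 X.Modules) _).Full
      essSurj := ⟨fun E => ⟨E.obj, ⟨Iso.refl _⟩⟩⟩ }
  have hR0 : R.PreservesZeroMorphisms := ⟨fun _ _ => rfl⟩
  obtain ⟨w, hex, hepi⟩ := h
  exact ⟨ObjectProperty.hom_ext _ w, hex.map R, inferInstanceAs (Epi (R.map b))⟩

end CInfRingedSpace

open CInfRingedSpace in
/-- The cotangent sequence of a Cartesian square. -/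
theorem isRightExactSequence_of_isPullback {W X Y Z : LocallyFairCInfScheme.{u}}
    {e : W ⟶ X} {f : W ⟶ Y} {g : X ⟶ Z} {h : Y ⟶ Z} (sq : IsPullback e f g h)
    (comm : e.hom ≫ g.hom = f.hom ≫ h.hom) :
    IsRightExactSequence (squareLeft e.hom f.hom g.hom h.hom comm)
      (squareRight e.hom f.hom) := by
  have w := squareLeft_squareRight e.hom f.hom g.hom h.hom comm
  refine ⟨w, ?_, ?_⟩
  · let π := cokernel.π (squareLeft e.hom f.hom g.hom h.hom comm)
    have hF : LocallyFG (cokernel (squareLeft e.hom f.hom g.hom h.hom comm)) :=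
      locallyFG_of_jointly_epi X.property Y.property e.hom f.hom (biprod.inl ≫ π)
        (biprod.inr ≫ π) fun u v hu hv => (cancel_epi π).1 (biprod.hom_ext' _ _
          (by simpa using hu) (by simpa using hv))
    have hπ : biprod.desc (biprod.inl ≫ π) (biprod.inr ≫ π) = π := by
      apply biprod.hom_ext' <;> simp
    obtain ⟨β, h1, h2⟩ := exists_desc_of_isPullback sq comm
      (isLocallyFair_sqZero W.property hF) (biprod.inl ≫ π) (biprod.inr ≫ π)
      (by rw [hπ]; exact cokernel.condition _)
    have hβ : squareRight e.hom f.hom ≫ β = π := by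
      apply biprod.hom_ext' <;> simp [squareRight, h1, h2]
    rw [ShortComplex.exact_iff_kernel_ι_comp_cokernel_π_zero]
    change kernel.ι (squareRight e.hom f.hom) ≫ π = 0
    rw [← hβ, kernel.condition_assoc, zero_comp]
  · let π := cokernel.π (squareRight e.hom f.hom)
    have hF : LocallyFG (cokernel (squareRight e.hom f.hom)) :=
      locallyFG_of_jointly_epi W.property W.property (𝟙 W.obj) (𝟙 W.obj) (Omega (𝟙 W.obj) ≫ π)
        (Omega (𝟙 W.obj) ≫ π) fun u v hu _ => (cancel_epi π).1
          (cotangent_hom_ext (by simpa using hu))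
    have h0 : squareRight e.hom f.hom ≫ π = 0 := cokernel.condition _
    have h1 : Omega e.hom ≫ π = 0 := (biprod.inl_desc_assoc _ _ π).symm.trans
      ((congrArg (biprod.inl ≫ ·) h0).trans comp_zero)
    have h2 : Omega f.hom ≫ π = 0 := (biprod.inr_desc_assoc _ _ π).symm.trans
      ((congrArg (biprod.inr ≫ ·) h0).trans comp_zero)
    have hπ : π = 0 := cotangent_hom_ext_of_isPullback sq
      (isLocallyFair_sqZero W.property hF) (h1.trans comp_zero.symm) (h2.trans comp_zero.symm)
    exact Abelian.epi_of_cokernel_π_eq_zero _ hπ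

theorem theorem6p17 :
    (∀ {X Y Z : CInfRingedSpace.{u}}, X.IsScheme → Y.IsScheme → Z.IsScheme →
      ∀ (f : X ⟶ Y) (g : Y ⟶ Z),
        CInfRingedSpace.Omega (f ≫ g) =
          (CInfRingedSpace.pullbackComp f g).hom.app Z.cotangent ≫
            (CInfRingedSpace.pullback f).map (CInfRingedSpace.Omega g) ≫
              CInfRingedSpace.Omega f) ∧
    (∀ {W X Y Z : LocallyFairCInfScheme.{u}}
      (e : W ⟶ X) (f : W ⟶ Y) (g : X ⟶ Z) (h : Y ⟶ Z) (sq : IsPullback e f g h),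
      have comm : e.hom ≫ g.hom = f.hom ≫ h.hom := congrArg InducedCategory.Hom.hom sq.w
      let a := CInfRingedSpace.squareLeft e.hom f.hom g.hom h.hom comm
      let b := CInfRingedSpace.squareRight e.hom f.hom
      ∃ (hA : W.obj.IsQuasicoherent
          ((CInfRingedSpace.pullback (e.hom ≫ g.hom)).obj Z.obj.cotangent))
        (hB : W.obj.IsQuasicoherent
          ((CInfRingedSpace.pullback e.hom).obj X.obj.cotangent ⊞
            (CInfRingedSpace.pullback f.hom).obj Y.obj.cotangent))
        (hC : W.obj.IsQuasicoherent W.obj.cotangent),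
        IsRightExactSequence a b ∧
        IsRightExactSequence
          (ObjectProperty.homMk a : (⟨_, hA⟩ : W.obj.QCoh) ⟶ ⟨_, hB⟩)
          (ObjectProperty.homMk b : (⟨_, hB⟩ : W.obj.QCoh) ⟶ ⟨_, hC⟩)) := by
  refine ⟨fun _ _ _ f g => CInfRingedSpace.Omega_comp f g, fun {W _ _ _} e f g h sq => ?_⟩
  have hex := isRightExactSequence_of_isPullback sq (congrArg InducedCategory.Hom.hom sq.w)
  exact ⟨CInfRingedSpace.isQuasicoherent_of_isScheme W.property.1 _,
    CInfRingedSpace.isQuasicoherent_of_isScheme W.property.1 _,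
    CInfRingedSpace.isQuasicoherent_of_isScheme W.property.1 _, hex,
    CInfRingedSpace.isRightExactSequence_qcoh W.property.1 hex _ _ _⟩
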